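/- **Setting.** Fix $k\in\mathbb R$, $\epsilon_0,\mu_0>0$, finitely many interfaces $x_1<\dots<x_{m-1}$ in $\mathbb R$ ($m\ge 1$), $x_0=-\infty$, $x_m=\infty$, layers $I_j=(x_{j-1},x_j)$, and functions $\hat\chi^{(1)}(x,\omega),\hat\chi^{(3)}(x,\omega)\in\mathbb C$ for $x\in\mathbb R$, $\omega\in\mathbb C$. Put $V(x,\omega)=-\omega\epsilon_0\mu_0(1+\hat\chi^{(1)}(x,\omega))$, $B(x,\omega)=\mathrm{diag}(\mathrm iV,\mathrm iV,\mathrm i\omega)$, $Au=\nabla_k\times u=(\mathrm iku_3,\,-u_3',\,u_2'-\mathrm iku_1)$ with domain $D(A)=\{u\in L^2(\mathbb R,\mathbb C^3):\nabla_k\times u\in L^2\}$, $L_k(\omega)=A-B(\cdot,\omega)$, and, with $u_E=(u_1,u_2,0)$, $$h(x,\omega,u)=-\mathrm i\omega\epsilon_0\mu_0^3\hat\chi^{(3)}(x,\omega)\bigl(2|u_E|^2u_E+(u_E\cdot u_E)\overline{u_E}\bigr).$$ Let $\langle f,g\rangle=\int_{\mathbb R} f\cdot\overline g\,dx$, let $\mathcal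 H^1$ be the space of $u\in L^2(\mathbb R,\mathbb C^3)$ with $u|_{I_j}\in H^1(I_j)$ for all $j$, and $\|u\|_{\mathcal H^1}=\sum_j\|u\|_{H^1(I_j)}$. A *solution* is a pair $(\omega,u)\in\mathbb C\times(D(A)\cap\mathcal H^1)$ with $L_k(\omega)u=h(\cdot,\omega,u)$. **Assumptions.** Let $0\ne\omega_0\in\mathbb R$, and for some $\delta>0$, with $B_\delta(\omega_0)\subset\mathbb C$ the open ball: * $\lambda=0$ is an eigenvalue of $L_k(\omega_0)$ that is algebraically simple (one-dimensional kernel, and $L_k(\omega_0)u=v$ has no solution $u\in D(A)$ for $0\ne v\in\ker L_k(\omega_0)$), isolated in the spectrum of $L_k(\omega_0)$, and of finite algebraic multiplicity (its Riesz projection has finite rank). * For each $j$: $V(x,\cdot)$ is holomorphic on $B_\delta(\omega_0)$ for almost every $x\in I_j$; for every $\omega\in B_\delta(\omega_0)$ one has $V\neq0$ a.e. on $I_j$ and $V,\,1/V,\,\partial_\omega V,\,\partial_\omega^2V\in W^{1,\infty}(I_j)$; and $\sup_{\omega\in B_\delta(\omega_0)}\|V(\cdot,\omega)\|_{W^{1,\infty}(I_j)}<\infty$.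 * For each $j$, $\omega\mapsto\hat\chi^{(3)}(\cdot,\omega)\in W^{1,\infty}(I_j)$ is Lipschitz continuous on $B_\delta(\omega_0)$. * $\varphi_0\in D(A)$, $L_k(\omega_0)\varphi_0=0$, $\|\varphi_0\|_{L^2}=1$; $\varphi_0^*\in D(L_k(\omega_0)^*)$, $L_k(\omega_0)^*\varphi_0^*=0$, $\langle\varphi_0,\varphi_0^*\rangle=1$; and $\langle\partial_\omega B(\cdot,\omega_0)\varphi_0,\varphi_0^*\rangle\ne0$. * (PT symmetry of the materials) For every real $\omega\in(\omega_0-\delta,\omega_0+\delta)$ and almost every $x\in\mathbb R$: $V(x,\omega)=\overline{V(-x,\omega)}$ and $\hat\chi^{(3)}(x,\omega)=\overline{\hat\chi^{(3)}(-x,\omega)}$. **Theorem.** Let $\nu=-\langle h(\cdot,\omega_0,\varphi_0),\varphi_0^*\rangle/\langle\partial_\omega B(\cdot,\omega_0)\varphi_0,\varphi_0^*\rangle$. There is a unique $\phi\in D(A)\cap\mathcal H^1$ with $\langle\phi,\varphi_0^*\rangle=0$ and $L_k(\omega_0)\phi=h(\cdot,\omega_0,\varphi_0)+\nu\,\partial_\omega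 B(\cdot,\omega_0)\varphi_0$. There are $\varepsilon_0,r>0$, $C\in\mathbb R$ and a family of solutions $(\omega_\varepsilon,u_\varepsilon)$, $\varepsilon\in(0,\varepsilon_0)$, continuous in $\varepsilon$ with values in $\mathbb C\times\mathcal H^1$, such that: 1. $\langle u_\varepsilon,\varphi_0^*\rangle=\varepsilon^{1/2}$ and $$\omega_\varepsilon=\omega_0+\varepsilon\nu+\varepsilon^2\sigma_\varepsilon,\qquad u_\varepsilon=\varepsilon^{1/2}\varphi_0+\varepsilon^{3/2}\phi+\varepsilon^{5/2}\psi_\varepsilon,$$ with $\sigma_\varepsilon\in\mathbb C$, $\psi_\varepsilon\in D(A)\cap\mathcal H^1$, $\langle\psi_\varepsilon,\varphi_0^*\rangle=0$, $|\sigma_\varepsilon|\le C$, $\|\psi_\varepsilon\|_{\mathcal H^1}\le C$. 2. For each $\varepsilon\in(0,\varepsilon_0)$, $(\omega_\varepsilon,u_\varepsilon)$ is the only solution $(\omega,u)$ with $|\omega-\omega_0|<r$, $\|u\|_{\mathcal H^1}<r$ and $\langle u,\varphi_0^*\rangle=\varepsilon^{1/2}$. Moreover, every solution $(\omega,u)$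 with $u\ne0$ in some neighbourhood of $(\omega_0,0)$ in $\mathbb C\times\mathcal H^1$ is of the form $(\omega_\varepsilon,c\,u_\varepsilon)$ with $\varepsilon\in(0,\varepsilon_0)$, $c\in\mathbb C$, $|c|=1$. 3. $\omega_\varepsilon\in\mathbb R$ for all $\varepsilon\in(0,\varepsilon_0)$. 4. The solutions can be chosen PT-symmetric: there is $c\in\mathbb C$, $|c|=1$, such that $c\varphi_0$ is PT-symmetric, i.e. equals $x\mapsto\overline{c\varphi_0(-x)}$ a.e.; and for every such $c$ and every $\varepsilon\in(0,\varepsilon_0)$, $(\omega_\varepsilon,c\,u_\varepsilon)$ is a solution and $c\,u_\varepsilon$ is PT-symmetric. -/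

import Mathlib

open MeasureTheory Set Filter Topology
open scoped ENNReal ComplexConjugate

noncomputable section

namespace SPP

/-! ### Weak derivatives and first order Sobolev norms on open subsets of the line -/

open scoped ContDiff in
/-- `g` is the weak derivative of `f` on the open set `I`. -/
def HasWeakDerivOn {E : Type*} [NormedAddCommGroup E] [NormedSpace ℝ E]
    (f g : ℝ → E) (I : Set ℝ) : Prop :=
  LocallyIntegrableOn f I ∧ LocallyIntegrableOn g I ∧
    ∀ η : ℝ → ℝ, ContDiff ℝ ∞ η → HasCompactSupport η → tsupport η ⊆ I →
      ∫ x, deriv η x • f x = -∫ x, η x • g x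

/-- The `W^{1,p}(I)` norm `‖f‖_{L^p(I)} + ‖f'‖_{L^p(I)}`. The weak derivative is unique up to null
sets, so that the infimum only selects it; the value is `⊤` if there is none. Thus
`f ∈ W^{1,p}(I)` means `sobolevNorm p f I < ⊤`. -/
def sobolevNorm {E : Type*} [NormedAddCommGroup E] [NormedSpace ℝ E]
    (p : ℝ≥0∞) (f : ℝ → E) (I : Set ℝ) : ℝ≥0∞ :=
  ⨅ (g : ℝ → E) (_ : HasWeakDerivOn f g I),
    eLpNorm f p (volume.restrict I) + eLpNorm g p (volume.restrict I)

/-! ### Spectral notions for an unbounded operator on a Hilbert space -/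

section Spectral

variable {H : Type*} [NormedAddCommGroup H] [InnerProductSpace ℂ H]

/-- `u` lies in the domain of `T` and `T u = 0`. -/
def IsNullVector (T : H →ₗ.[ℂ] H) (u : H) : Prop :=
  ∃ hu : u ∈ T.domain, T ⟨u, hu⟩ = 0

/-- `R` is a bounded inverse of the bijection `T - z : D(T) → H`. -/
def IsResolventAt (T : H →ₗ.[ℂ] H) (z : ℂ) (R : H →L[ℂ] H) : Prop :=
  (∀ f : H, ∃ u : T.domain, (u : H) = R f ∧ T u - z • (u : H) = f) ∧
    ∀ u : T.domain, R (T u - z • (u : H)) = u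

/-- The resolvent set of `T`. -/
def resolventSet (T : H →ₗ.[ℂ] H) : Set ℂ :=
  {z | ∃ R : H →L[ℂ] H, IsResolventAt T z R}

open Classical in
/-- The resolvent `(T - z)⁻¹`, for `z` in the resolvent set. -/
def resolventOp (T : H →ₗ.[ℂ] H) (z : ℂ) : H →L[ℂ] H :=
  if h : z ∈ resolventSet T then h.choose else 0

/-- The Riesz projection `-(2πi)⁻¹ ∮_{|z - z₀| = ρ} (T - z)⁻¹ dz`. -/
def rieszProjection (T : H →ₗ.[ℂ] H) (z₀ : ℂ) (ρ : ℝ) : H →L[ℂ] H :=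
  (-(2 * (Real.pi : ℂ) * Complex.I)⁻¹) • ∮ z in C(z₀, ρ), resolventOp T z

/-- `z₀` is isolated from the rest of the spectrum of `T` and has finite algebraic multiplicity,
that is, its Riesz projection has finite rank. -/
def IsIsolatedOfFiniteMultiplicity (T : H →ₗ.[ℂ] H) (z₀ : ℂ) : Prop :=
  ∃ ρ : ℝ, 0 < ρ ∧ (∀ z : ℂ, z ≠ z₀ → ‖z - z₀‖ ≤ ρ → z ∈ resolventSet T) ∧
    FiniteDimensional ℂ (LinearMap.range (rieszProjection T z₀ ρ : H →ₗ[ℂ] H))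

/-- `0` is an algebraically simple eigenvalue of `T`: the kernel is one-dimensional and
`T u = v` has no solution `u ∈ D(T)` for `v` in the kernel, `v ≠ 0`. -/
def IsAlgebraicallySimpleZero (T : H →ₗ.[ℂ] H) : Prop :=
  Module.finrank ℂ (LinearMap.ker T.toFun) = 1 ∧
    ∀ v : H, IsNullVector T v → v ≠ 0 → ¬ ∃ u : T.domain, T u = v

end Spectral

/-! ### The space `L²(ℝ, ℂ³)`, the curl operator and multiplication operators -/

/-- The space `ℂ³` with its Euclidean norm. -/
abbrev C3 : Type := EuclideanSpace ℂ (Fin 3)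

/-- The Hilbert space `L²(ℝ, ℂ³)`. The components `u₁, u₂, u₃` are `u x 0`, `u x 1`, `u x 2`. -/
abbrev L2 : Type := Lp C3 2 (volume : Measure ℝ)

/-- A component of an `L²` function is locally integrable. -/
theorem locallyIntegrable_comp (u : L2) (j : Fin 3) :
    LocallyIntegrable (fun x => u x j) (volume : Measure ℝ) := by
  have h : LocallyIntegrable (fun x => u x) (volume : Measure ℝ) :=
    (Lp.memLp u).locallyIntegrable (by norm_num)
  intro x
  obtain ⟨s, hs, hi⟩ := h x
  exact ⟨s, hs, (EuclideanSpace.proj (𝕜 := ℂ) j : C3 →L[ℂ] ℂ).integrable_comp hi⟩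

theorem HasWeakDerivOn.add' {f₁ f₂ g₁ g₂ : ℝ → ℂ} (h₁ : HasWeakDerivOn f₁ g₁ univ)
    (h₂ : HasWeakDerivOn f₂ g₂ univ) :
    HasWeakDerivOn (fun x => f₁ x + f₂ x) (fun x => g₁ x + g₂ x) univ := by
  obtain ⟨a₁, b₁, c₁⟩ := h₁
  obtain ⟨a₂, b₂, c₂⟩ := h₂
  refine ⟨a₁.add a₂, b₁.add b₂, fun η h1 h2 h3 => ?_⟩
  rw [locallyIntegrableOn_univ] at a₁ a₂ b₁ b₂
  have hd : Continuous (deriv η) := h1.continuous_deriv (by simp)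
  have hi : ∀ {f : ℝ → ℂ}, LocallyIntegrable f volume →
      Integrable (fun x => η x • f x) volume := fun hf =>
    hf.integrable_smul_left_of_hasCompactSupport h1.continuous h2
  have hi' : ∀ {f : ℝ → ℂ}, LocallyIntegrable f volume →
      Integrable (fun x => deriv η x • f x) volume := fun hf =>
    hf.integrable_smul_left_of_hasCompactSupport hd h2.deriv
  simp only [smul_add]
  rw [integral_add (hi' a₁) (hi' a₂), integral_add (hi b₁) (hi b₂), c₁ η h1 h2 h3, c₂ η h1 h2 h3]
  ring

theorem HasWeakDerivOn.const_mul' {f g : ℝ → ℂ} (h : HasWeakDerivOn f g univ) (c : ℂ) :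
    HasWeakDerivOn (fun x => c * f x) (fun x => c * g x) univ := by
  obtain ⟨a, b, d⟩ := h
  refine ⟨?_, ?_, fun η h1 h2 h3 => ?_⟩
  · exact a.smul c
  · exact b.smul c
  · have e : ∀ (a : ℝ → ℝ) (b : ℝ → ℂ), ∫ x, a x • (c * b x) = c * ∫ x, a x • b x := by
      intro a b
      rw [← integral_const_mul]
      congr 1
      ext x
      rw [mul_smul_comm]
    rw [e, e, d η h1 h2 h3]
    ring

theorem HasWeakDerivOn.congr' {f₁ f₂ g₁ g₂ : ℝ → ℂ} (h : HasWeakDerivOn f₁ g₁ univ)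
    (hf : f₁ =ᵐ[volume] f₂) (hg : g₁ =ᵐ[volume] g₂) : HasWeakDerivOn f₂ g₂ univ := by
  obtain ⟨a, b, d⟩ := h
  rw [locallyIntegrableOn_univ] at a b
  refine ⟨?_, ?_, fun η h1 h2 h3 => ?_⟩
  · rw [locallyIntegrableOn_univ]
    exact a.congr hf
  · rw [locallyIntegrableOn_univ]
    exact b.congr hg
  · have e1 : ∫ x, deriv η x • f₂ x = ∫ x, deriv η x • f₁ x :=
      integral_congr_ae (hf.mono fun x hx => by simp [hx])
    have e2 : ∫ x, η x • g₂ x = ∫ x, η x • g₁ x :=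
      integral_congr_ae (hg.mono fun x hx => by simp [hx])
    rw [e1, e2]
    exact d η h1 h2 h3

theorem HasWeakDerivOn.ae_zero {f g : ℝ → ℂ} (h : HasWeakDerivOn f g univ)
    (hf : f =ᵐ[volume] 0) : g =ᵐ[volume] 0 := by
  obtain ⟨a, b, d⟩ := h
  rw [locallyIntegrableOn_univ] at a b
  refine ae_eq_zero_of_integral_contDiff_smul_eq_zero b fun η h1 h2 => ?_
  have := d η h1 h2 (subset_univ _)
  rw [integral_eq_zero_of_ae (hf.mono fun x hx => by simp [hx])] at this
  exact neg_eq_zero.mp this.symm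

/-- `v = ∇_k × u` in the sense of distributions, where `∇_k = (∂ₓ, ik, 0)`, that is,
`v₁ = ik u₃`, `v₂ = -u₃'`, `v₃ = u₂' - ik u₁`. -/
def IsCurl (k : ℝ) (u v : L2) : Prop :=
  (∀ᵐ x, v x 0 = Complex.I * k * u x 2) ∧
    HasWeakDerivOn (fun x => u x 2) (fun x => -(v x 1)) univ ∧
    HasWeakDerivOn (fun x => u x 1) (fun x => v x 2 + Complex.I * k * u x 0) univ

/-- The graph of `A = ∇_k ×`. -/
def curlGraph (k : ℝ) : Submodule ℂ (L2 × L2) where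
  carrier := {p | IsCurl k p.1 p.2}
  add_mem' := by
    rintro ⟨u, v⟩ ⟨u', v'⟩ ⟨h1, h2, h3⟩ ⟨h1', h2', h3'⟩
    have hu := Lp.coeFn_add u u'
    have hv := Lp.coeFn_add v v'
    refine ⟨?_, ?_, ?_⟩
    · filter_upwards [h1, h1', hu, hv] with x a b c d
      simp only [Prod.mk_add_mk, c, d, Pi.add_apply, PiLp.add_apply] at a b ⊢
      rw [a, b]; ring
    · refine (h2.add' h2').congr' ?_ ?_
      · filter_upwards [hu] with x c
        simp only [Prod.mk_add_mk, c, Pi.add_apply, PiLp.add_apply]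
      · filter_upwards [hv] with x c
        simp only [Prod.mk_add_mk, c, Pi.add_apply, PiLp.add_apply]; ring
    · refine (h3.add' h3').congr' ?_ ?_
      · filter_upwards [hu] with x c
        simp only [Prod.mk_add_mk, c, Pi.add_apply, PiLp.add_apply]
      · filter_upwards [hu, hv] with x c d
        simp only [Prod.mk_add_mk, c, d, Pi.add_apply, PiLp.add_apply]; ring
  zero_mem' := by
    have h0 := Lp.coeFn_zero C3 2 (volume : Measure ℝ)
    have hz : HasWeakDerivOn (fun _ : ℝ => (0 : ℂ)) (fun _ => 0) univ :=
      ⟨locallyIntegrable_zero.locallyIntegrableOn _, locallyIntegrable_zero.locallyIntegrableOn _,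
        by simp⟩
    refine ⟨?_, hz.congr' ?_ ?_, hz.congr' ?_ ?_⟩ <;> filter_upwards [h0] with x c <;>
      simp
  smul_mem' := by
    rintro a ⟨u, v⟩ ⟨h1, h2, h3⟩
    have hu := Lp.coeFn_smul a u
    have hv := Lp.coeFn_smul a v
    refine ⟨?_, ?_, ?_⟩
    · filter_upwards [h1, hu, hv] with x b c d
      simp only [Prod.smul_mk, c, d, Pi.smul_apply, PiLp.smul_apply, smul_eq_mul] at b ⊢
      rw [b]; ring
    · refine (h2.const_mul' a).congr' ?_ ?_
      · filter_upwards [hu] with x c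
        simp [c]
      · filter_upwards [hv] with x c
        simp [c]
    · refine (h3.const_mul' a).congr' ?_ ?_
      · filter_upwards [hu] with x c
        simp [c]
      · filter_upwards [hu, hv] with x c d
        simp [c, d]; ring

/-- The operator `A = ∇_k ×` on `L²(ℝ, ℂ³)` with domain
`D(A) = {u ∈ L² : ∇_k × u ∈ L²}`. -/
def curlOp (k : ℝ) : L2 →ₗ.[ℂ] L2 := (curlGraph k).toLinearPMap

theorem curlGraph_singleValued (k : ℝ) (p : L2 × L2) (hp : p ∈ curlGraph k) (h0 : p.1 = 0) :
    p.2 = 0 := by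
  obtain ⟨u, v⟩ := p
  obtain ⟨h1, h2, h3⟩ := hp
  simp only at h0 h1 h2 h3
  subst h0
  have hz := Lp.coeFn_zero C3 2 (volume : Measure ℝ)
  have e2 := h2.ae_zero (by filter_upwards [hz] with x c; simp)
  have e3 := h3.ae_zero (by filter_upwards [hz] with x c; simp)
  rw [Lp.eq_zero_iff_ae_eq_zero]
  filter_upwards [h1, e2, e3, hz] with x a b c d
  ext j
  fin_cases j
  · simpa [d] using a
  · simpa [d] using b
  · simpa [d] using c

/-- The graph of `curlOp k` is the relation `IsCurl k`. -/
theorem mem_graph_curlOp (k : ℝ) (u v : L2) : (u, v) ∈ (curlOp k).graph ↔ IsCurl k u v := by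
  rw [curlOp, Submodule.toLinearPMap_graph_eq _ (curlGraph_singleValued k)]
  rfl

/-- The graph of the multiplication by `diag(d₁, d₂, d₃)`, on its maximal domain. -/
def mulGraph (d : ℝ → Fin 3 → ℂ) : Submodule ℂ (L2 × L2) where
  carrier := {p | ∀ᵐ x, ∀ j, p.2 x j = d x j * p.1 x j}
  add_mem' := by
    rintro ⟨u, v⟩ ⟨u', v'⟩ h h'
    filter_upwards [h, h', Lp.coeFn_add u u', Lp.coeFn_add v v'] with x a b c e j
    have a := a j
    have b := b j
    simp only [Prod.mk_add_mk, c, e, Pi.add_apply, PiLp.add_apply] at a b ⊢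
    rw [a, b]; ring
  zero_mem' := by
    filter_upwards [Lp.coeFn_zero C3 2 (volume : Measure ℝ)] with x c j
    simp
  smul_mem' := by
    rintro z ⟨u, v⟩ h
    filter_upwards [h, Lp.coeFn_smul z u, Lp.coeFn_smul z v] with x a c e j
    have a := a j
    simp only [Prod.smul_mk, c, e, Pi.smul_apply, PiLp.smul_apply, smul_eq_mul] at a ⊢
    rw [a]; ring

/-- The operator of multiplication by `diag(d₁, d₂, d₃)` on `L²(ℝ, ℂ³)`, on its maximal domain
(which is the whole space if the `d_j` are measurable and essentially bounded). -/
def mulOp (d : ℝ → Fin 3 → ℂ) : L2 →ₗ.[ℂ] L2 := (mulGraph d).toLinearPMap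

theorem mulGraph_singleValued (d : ℝ → Fin 3 → ℂ) (p : L2 × L2) (hp : p ∈ mulGraph d)
    (h0 : p.1 = 0) : p.2 = 0 := by
  obtain ⟨u, v⟩ := p
  have hp : ∀ᵐ x, ∀ j, v x j = d x j * u x j := hp
  simp only at h0
  subst h0
  rw [Lp.eq_zero_iff_ae_eq_zero]
  filter_upwards [hp, Lp.coeFn_zero C3 2 (volume : Measure ℝ)] with x a c
  ext j
  simpa [c] using a j

/-- The graph of `mulOp d`. -/
theorem mem_graph_mulOp (d : ℝ → Fin 3 → ℂ) (u v : L2) :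
    (u, v) ∈ (mulOp d).graph ↔ ∀ᵐ x, ∀ j, v x j = d x j * u x j := by
  rw [mulOp, Submodule.toLinearPMap_graph_eq _ (mulGraph_singleValued d)]
  rfl

/-- The pairing `⟨f, g⟩ = ∫ f · conj g` of `L²(ℝ, ℂ³)`, written for functions. -/
def pairing (f g : ℝ → C3) : ℂ := ∫ x, inner ℂ (g x) (f x)

/-- `u` lies in the domain of `T` and `T u = f` almost everywhere. -/
def Solves (T : L2 →ₗ.[ℂ] L2) (u : L2) (f : ℝ → C3) : Prop :=
  ∃ hu : u ∈ T.domain, ∀ᵐ x, T ⟨u, hu⟩ x = f x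

/-- `u(x) = conj (u(-x))` for almost every `x`. -/
def IsPTSymmetric (u : L2) : Prop := ∀ᵐ x, ∀ j, u x j = conj (u (-x) j)

/-! ### The layered medium -/

/-- A layered medium on the line with interfaces `x₁ < … < xₙ`, hence `n + 1` layers, the
susceptibilities `χ⁽¹⁾(x, ω)`, `χ⁽³⁾(x, ω)` in the frequency domain, the constants `ε₀, μ₀ > 0` of
free space, and the tangential wave number `k`. -/
structure Medium where
  k : ℝ
  eps0 : ℝ
  mu0 : ℝ
  eps0_pos : 0 < eps0
  mu0_pos : 0 < mu0
  n : ℕ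
  interface : Fin n → ℝ
  interface_strictMono : StrictMono interface
  chi1 : ℝ → ℂ → ℂ
  chi3 : ℝ → ℂ → ℂ

namespace Medium

variable (M : Medium)

/-- The open layers: the `i`-th one lies between the consecutive interfaces with (zero-based)
indices `i - 1` and `i`; the first and the last layer are unbounded. -/
def layer (i : Fin (M.n + 1)) : Set ℝ :=
  {y | ∀ j : Fin M.n, ((j : ℕ) < i → M.interface j < y) ∧ ((i : ℕ) ≤ j → y < M.interface j)}

/-- `V(x, ω) = -ω ε₀ μ₀ (1 + χ⁽¹⁾(x, ω))`. -/
def V (x : ℝ) (ω : ℂ) : ℂ := -ω * M.eps0 * M.mu0 * (1 + M.chi1 x ω)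

/-- The diagonal of `B(x, ω) = diag(iV, iV, iω)`. -/
def Bdiag (ω : ℂ) (x : ℝ) : Fin 3 → ℂ :=
  ![Complex.I * M.V x ω, Complex.I * M.V x ω, Complex.I * ω]

/-- The operator pencil `L_k(ω) = A - B(ω)`. -/
def L (ω : ℂ) : L2 →ₗ.[ℂ] L2 := curlOp M.k - mulOp (M.Bdiag ω)

/-- The function `∂_ω B(x, ω) w`. -/
def dB (ω : ℂ) (x : ℝ) (w : C3) : C3 :=
  !₂[Complex.I * deriv (fun z => M.V x z) ω * w 0,
    Complex.I * deriv (fun z => M.V x z) ω * w 1, Complex.I * w 2]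

/-- The cubic nonlinearity
`h(x, ω, u) = -iω ε₀ μ₀³ χ⁽³⁾(x, ω) (2 |u_E|² u_E + (u_E · u_E) conj u_E)`, `u_E = (u₁, u₂, 0)`. -/
def h (x : ℝ) (ω : ℂ) (w : C3) : C3 :=
  (-Complex.I * ω * M.eps0 * M.mu0 ^ 3 * M.chi3 x ω) •
    !₂[2 * ((‖w 0‖ ^ 2 + ‖w 1‖ ^ 2 : ℝ) : ℂ) * w 0 + (w 0 ^ 2 + w 1 ^ 2) * conj (w 0),
      2 * ((‖w 0‖ ^ 2 + ‖w 1‖ ^ 2 : ℝ) : ℂ) * w 1 + (w 0 ^ 2 + w 1 ^ 2) * conj (w 1), 0]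

/-- The norm of the broken Sobolev space `𝓗¹` of functions that are `H¹` on each layer: the sum of
the `H¹` norms on the layers; `u ∈ 𝓗¹` means that it is finite. -/
def brokenNorm (u : L2) : ℝ≥0∞ := ∑ i, sobolevNorm 2 (fun x => u x) (M.layer i)

/-- `u ∈ D(A) ∩ 𝓗¹`. -/
def InSpace (u : L2) : Prop := u ∈ (curlOp M.k).domain ∧ M.brokenNorm u < ⊤

/-- `(ω, u)` with `u ∈ D(A) ∩ 𝓗¹` solves `L_k(ω) u = h(·, ω, u)`. -/
def IsSolution (ω : ℂ) (u : L2) : Prop :=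
  M.InSpace u ∧ Solves (M.L ω) u (fun x => M.h x ω (u x))

/-- `ω₀` is an algebraically simple, isolated eigenvalue of the pencil: `λ = 0` is such an
eigenvalue of `L_k(ω₀) u = λ u`. -/
def SimpleIsolatedEigenvalue (ω₀ : ℂ) : Prop :=
  IsAlgebraicallySimpleZero (M.L ω₀) ∧ IsIsolatedOfFiniteMultiplicity (M.L ω₀) 0

/-- `V` is holomorphic in `ω` near `ω₀`, with values in `W^{1,∞}` of each layer together with
`1/V`, `∂_ω V`, `∂_ω² V`, and it is bounded in `W^{1,∞}` of each layer uniformly in `ω`. -/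
def RegularV (ω₀ : ℂ) : Prop :=
  ∃ δ : ℝ, 0 < δ ∧ ∀ i,
    (∀ᵐ x, x ∈ M.layer i → DifferentiableOn ℂ (fun ω => M.V x ω) (Metric.ball ω₀ δ)) ∧
    (∃ K : ℝ, ∀ ω ∈ Metric.ball ω₀ δ,
      sobolevNorm ⊤ (fun x => M.V x ω) (M.layer i) ≤ ENNReal.ofReal K) ∧
    ∀ ω ∈ Metric.ball ω₀ δ,
      (∀ᵐ x, x ∈ M.layer i → M.V x ω ≠ 0) ∧
      sobolevNorm ⊤ (fun x => (M.V x ω)⁻¹) (M.layer i) < ⊤ ∧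
      sobolevNorm ⊤ (fun x => deriv (fun z => M.V x z) ω) (M.layer i) < ⊤ ∧
      sobolevNorm ⊤ (fun x => iteratedDeriv 2 (fun z => M.V x z) ω) (M.layer i) < ⊤

/-- `ω ↦ χ⁽³⁾(·, ω) ∈ W^{1,∞}(I)` is Lipschitz continuous near `ω₀` for each layer `I`. -/
def LipschitzChi3 (ω₀ : ℂ) : Prop :=
  ∃ δ : ℝ, 0 < δ ∧
    (∀ i, ∀ ω ∈ Metric.ball ω₀ δ, sobolevNorm ⊤ (fun x => M.chi3 x ω) (M.layer i) < ⊤) ∧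
    ∃ K : ℝ, 0 < K ∧ ∀ i, ∀ ω₁ ∈ Metric.ball ω₀ δ, ∀ ω₂ ∈ Metric.ball ω₀ δ,
      sobolevNorm ⊤ (fun x => M.chi3 x ω₁ - M.chi3 x ω₂) (M.layer i) ≤
        ENNReal.ofReal (K * ‖ω₁ - ω₂‖)

/-- `V` and `χ⁽³⁾` are PT-symmetric at all real frequencies near `ω₀`. -/
def PTSymmetric (ω₀ : ℝ) : Prop :=
  ∃ δ : ℝ, 0 < δ ∧ ∀ ω ∈ Ioo (ω₀ - δ) (ω₀ + δ), ∀ᵐ x : ℝ,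
    M.V x (ω : ℂ) = conj (M.V (-x) (ω : ℂ)) ∧ M.chi3 x (ω : ℂ) = conj (M.chi3 (-x) (ω : ℂ))

/-- The coefficient `ν = -⟨h(·, ω₀, φ₀), φ₀*⟩ / ⟨∂_ω B(·, ω₀) φ₀, φ₀*⟩`. -/
def nu (ω₀ : ℂ) (φ₀ φs : L2) : ℂ :=
  -pairing (fun x => M.h x ω₀ (φ₀ x)) φs / pairing (fun x => M.dB ω₀ x (φ₀ x)) φs

/-- `φ ∈ D(A) ∩ 𝓗¹ ∩ ⟨φ₀*⟩^⊥` solves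
`L_k(ω₀) φ = h(·, ω₀, φ₀) + ν ∂_ω B(·, ω₀) φ₀`. -/
def IsCorrector (ω₀ : ℂ) (φ₀ φs φ : L2) : Prop :=
  M.InSpace φ ∧ inner ℂ φs φ = 0 ∧
    Solves (M.L ω₀) φ (fun x => M.h x ω₀ (φ₀ x) + M.nu ω₀ φ₀ φs • M.dB ω₀ x (φ₀ x))

end Medium

end SPP

end

noncomputable section

namespace SPP

/-! ### Primitives on an interval -/

/-! Write ω = ω₀ + z and let D(z) be the divided difference of B between ω₀ and ω₀ + z. Then L(ω₀ +
z) = L(ω₀) - z D(z) without remainder, and the equation becomes L(ω₀)u = g with g = h(ω₀ + z, u) + z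
D(z)u. The finite-rank Riesz projection and the simplicity of the eigenvalue yield a bounded
generalized inverse K of L(ω₀) with values in the kernel of ℓ = ⟨·, φ₀*⟩
(`exists_generalized_inverse`). The equation is therefore equivalent to the Lyapunov–Schmidt system
ℓ(g) = 0, u = ℓ(u)φ₀ + K g (`Reduction.isSolution_iff`).

Since h(cu) = |c|²c h(u), the ansatz u = √ε(φ₀ + y) with ℓ(y) = 0 removes all fractional powers: the
system turns into (z, y) = ε F(z, y), where F is `reducedMap` (`reducedSolution_iff`). The first
component of F is the quotient -ℓ(h)/ℓ(D) taken at φ₀ + y; its denominator is nonzero near the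
origin by transversality. As F is Lipschitz near 0, ε F is a contraction of a fixed ball for small ε
(`exists_fixedPoint_branch`). This gives existence, uniqueness, continuity in ε, and the expansion ε
F(0) + O(ε²), in which F(0) consists of ν and the corrector. Conversely, for a small solution the
component off the line of φ₀ is small relative to u, because h is cubic and z is small
(`exists_forall_norm_sub_le`); after a rotation of the phase and the scaling it is a fixed point in
the ball.

All this takes place in the broken Sobolev space, which has to be a Banach algebra up to a constant
(one-dimensional Sobolev inequality) and has to be mapped to itself by K. The latter is a regularity
statement: the curl controls the derivatives of the second and third components, the first row of
the equation is algebraic and is solved for u₁ by dividing by V, and the closed graph theorem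
supplies boundedness. Lipschitz dependence of D on z follows from Cauchy estimates in ω, applied to
V(x, ·) and to V(x, ·) - V(y, ·), the latter being of size |x - y|.

For real ω the operator L(ω) anticommutes with u ↦ conj u(-·), and so do D and h on symmetric
functions. Hence F preserves the closed set of pairs with z real and y symmetric, up to the phase of
φ₀. The Picard iteration from 0 never leaves this set, and so its limit, the branch, lies in it:
this is the reality of ω and the PT symmetry of u (`Reduction.reducedMap_symm`). -/

/-- `F` is a primitive of the locally integrable function `g` on `I`. -/
def IsPrim (F g : ℝ → ℂ) (I : Set ℝ) : Prop :=
  LocallyIntegrableOn g I ∧ ∀ a ∈ I, ∀ b ∈ I, F b - F a = ∫ x in a..b, g x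

theorem intervalIntegrable_of_locallyIntegrableOn {E : Type*} [NormedAddCommGroup E]
    {g : ℝ → E} {I : Set ℝ} (hI : OrdConnected I) (hg : LocallyIntegrableOn g I) {a b : ℝ}
    (ha : a ∈ I) (hb : b ∈ I) : IntervalIntegrable g volume a b := by
  rw [intervalIntegrable_iff']
  exact hg.integrableOn_compact_subset (hI.uIcc_subset ha hb) isCompact_uIcc

theorem absolutelyContinuousOnInterval_const {E : Type*} [NormedAddCommGroup E] [NormedSpace ℝ E]
    (c : E) (a b : ℝ) : AbsolutelyContinuousOnInterval (fun _ => c) a b :=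
  ContDiffOn.absolutelyContinuousOnInterval contDiffOn_const

/-- The real-valued result is applied to the real and imaginary parts, which are recombined with the
constants 1 and i. -/
theorem absolutelyContinuousOnInterval_integral_complex {g : ℝ → ℂ} {a b : ℝ}
    (hg : IntervalIntegrable g volume a b) :
    AbsolutelyContinuousOnInterval (fun x => ∫ t in a..x, g t) a b := by
  have hre : IntervalIntegrable (fun x => (g x).re) volume a b :=
    ⟨hg.1.re, hg.2.re⟩
  have him : IntervalIntegrable (fun x => (g x).im) volume a b :=
    ⟨hg.1.im, hg.2.im⟩
  have h1 := (hre.absolutelyContinuousOnInterval_intervalIntegral (left_mem_uIcc)).smul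
    (absolutelyContinuousOnInterval_const (1 : ℂ) a b)
  have h2 := (him.absolutelyContinuousOnInterval_intervalIntegral (left_mem_uIcc)).smul
    (absolutelyContinuousOnInterval_const Complex.I a b)
  have h3 := h1.add h2
  have key : ∀ x ∈ uIcc a b, (∫ t in a..x, g t) =
      (∫ t in a..x, (g t).re) • (1 : ℂ) + (∫ t in a..x, (g t).im) • Complex.I := by
    intro x hx
    have hgx : IntervalIntegrable g volume a x :=
      hg.mono_set (uIcc_subset_uIcc left_mem_uIcc hx)
    apply Complex.ext
    · have := (Complex.reCLM.intervalIntegral_comp_comm hgx).symm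
      simpa using this
    · have := (Complex.imCLM.intervalIntegral_comp_comm hgx).symm
      simpa using this
  rw [absolutelyContinuousOnInterval_iff] at h3 ⊢
  intro ε hε
  obtain ⟨δ, hδ, h⟩ := h3 ε hε
  refine ⟨δ, hδ, fun E hE hl => ?_⟩
  convert h E hE hl using 4 with i hi
  · exact key _ (hE.1 i hi).1
  · exact key _ (hE.1 i hi).2

theorem absolutelyContinuousOnInterval_congr {E : Type*} [NormedAddCommGroup E]
    {f g : ℝ → E} {a b : ℝ} (hf : AbsolutelyContinuousOnInterval f a b)
    (h : ∀ x ∈ uIcc a b, f x = g x) : AbsolutelyContinuousOnInterval g a b := by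
  rw [absolutelyContinuousOnInterval_iff] at hf ⊢
  intro ε hε
  obtain ⟨δ, hδ, hh⟩ := hf ε hε
  refine ⟨δ, hδ, fun E hE hl => ?_⟩
  convert hh E hE hl using 4 with i hi
  · exact (h _ (hE.1 i hi).1).symm
  · exact (h _ (hE.1 i hi).2).symm

/-- The fundamental theorem of calculus for an absolutely continuous complex function with a known
integrable derivative. -/
theorem sub_eq_integral_of_ae_hasDerivAt {F g : ℝ → ℂ} {a b : ℝ}
    (hF : AbsolutelyContinuousOnInterval F a b) (hg : IntervalIntegrable g volume a b)
    (h : ∀ᵐ x, x ∈ uIoo a b → HasDerivAt F (g x) x) : F b - F a = ∫ x in a..b, g x := by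
  -- The difference of F and the integral of g is absolutely continuous with derivative zero almost
  -- everywhere, hence constant.
  have hP := hF.fun_sub (absolutelyContinuousOnInterval_integral_complex hg)
  have hend : ∀ c : ℝ, ∀ᵐ x : ℝ, x ≠ c := fun c => by simp [ae_iff, measure_singleton]
  obtain ⟨C, hC⟩ := hP.const_of_ae_hasDerivAt_zero (by
    filter_upwards [h, hg.ae_hasDerivAt_integral, hend a, hend b] with x h1 h2 h3 h4 hx
    have hx' : x ∈ uIoo a b := by
      rw [uIoo]
      rw [uIcc, mem_Icc] at hx
      refine ⟨lt_of_le_of_ne hx.1 ?_, lt_of_le_of_ne hx.2 ?_⟩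
      · rcases min_choice a b with e | e <;> rw [e] <;> exact Ne.symm ‹_›
      · rcases max_choice a b with e | e <;> rw [e] <;> assumption
    simpa using (h1 hx').fun_sub (h2 hx a left_mem_uIcc))
  have e1 := hC a left_mem_uIcc
  have e2 := hC b right_mem_uIcc
  simp only [intervalIntegral.integral_same, sub_zero] at e1
  rw [e1, ← e2]; ring

namespace IsPrim

variable {F g G h : ℝ → ℂ} {I : Set ℝ}

theorem absolutelyContinuous (hI : OrdConnected I) (hF : IsPrim F g I) {a b : ℝ} (ha : a ∈ I)
    (hb : b ∈ I) : AbsolutelyContinuousOnInterval F a b := by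
  refine absolutelyContinuousOnInterval_congr
    ((absolutelyContinuousOnInterval_integral_complex
      (intervalIntegrable_of_locallyIntegrableOn hI hF.1 ha hb)).fun_add
      (absolutelyContinuousOnInterval_const (F a) a b)) fun x hx => ?_
  rw [← hF.2 a ha x (hI.uIcc_subset ha hb hx)]
  ring

theorem ae_hasDerivAt (hI : OrdConnected I) (hF : IsPrim F g I) {a b : ℝ} (ha : a ∈ I)
    (hb : b ∈ I) : ∀ᵐ x, x ∈ uIoo a b → HasDerivAt F (g x) x := by
  filter_upwards [(intervalIntegrable_of_locallyIntegrableOn hI hF.1 ha hb).ae_hasDerivAt_integral]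
    with x h1 hx
  have h2 := (h1 (Ioo_subset_Icc_self hx) a left_mem_uIcc).add_const (F a)
  refine h2.congr_of_eventuallyEq ?_
  filter_upwards [isOpen_Ioo.mem_nhds hx] with y hy
  rw [← hF.2 a ha y (hI.uIcc_subset ha hb (Ioo_subset_Icc_self hy))]
  ring

theorem continuousOn (hI : OrdConnected I) (hI' : IsOpen I) (hF : IsPrim F g I) :
    ContinuousOn F I := by
  intro x hx
  obtain ⟨ε, hε, hb⟩ := Metric.isOpen_iff.mp hI' x hx
  have h1 : x - ε / 2 ∈ I := hb (by simp [abs_of_pos hε, hε])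
  have h2 : x + ε / 2 ∈ I := hb (by simp [abs_of_pos hε, hε])
  have h3 := (hF.absolutelyContinuous hI h1 h2).continuousOn
  rw [uIcc_of_le (by linarith)] at h3
  exact (h3.continuousAt (Icc_mem_nhds (by linarith) (by linarith))).continuousWithinAt

theorem locallyIntegrableOn (hI : OrdConnected I) (hI' : IsOpen I) (hF : IsPrim F g I) :
    LocallyIntegrableOn F I :=
  (hF.continuousOn hI hI').locallyIntegrableOn hI'.measurableSet

/-- A product of absolutely continuous functions is absolutely continuous, so the product rule,
valid almost everywhere, can be integrated. -/
theorem mul (hI : OrdConnected I) (hI' : IsOpen I) (hF : IsPrim F g I) (hG : IsPrim G h I) :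
    IsPrim (fun x => F x * G x) (fun x => F x * h x + g x * G x) I := by
  refine ⟨?_, fun a ha b hb => ?_⟩
  · refine LocallyIntegrableOn.add ?_ ?_
    · exact hG.1.continuousOn_mul (hF.continuousOn hI hI') hI'.isLocallyClosed
    · exact hF.1.mul_continuousOn (hG.continuousOn hI hI') hI'.isLocallyClosed
  · have cF := (hF.continuousOn hI hI').mono (hI.uIcc_subset ha hb)
    have cG := (hG.continuousOn hI hI').mono (hI.uIcc_subset ha hb)
    refine sub_eq_integral_of_ae_hasDerivAt (F := fun x => F x * G x)
      ((hF.absolutelyContinuous hI ha hb).fun_smul (hG.absolutelyContinuous hI ha hb)) ?_ ?_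
    · exact ((intervalIntegrable_of_locallyIntegrableOn hI hG.1 ha hb).continuousOn_mul cF).add
        ((intervalIntegrable_of_locallyIntegrableOn hI hF.1 ha hb).mul_continuousOn cG)
    · filter_upwards [hF.ae_hasDerivAt hI ha hb, hG.ae_hasDerivAt hI ha hb] with x h1 h2 hx
      convert! (h1 hx).mul (h2 hx) using 1
      ring

end IsPrim

/-- Lipschitz functions are absolutely continuous and, by Rademacher's theorem, differentiable
almost everywhere. -/
theorem _root_.LipschitzWith.isPrim {K : NNReal} {F : ℝ → ℂ} (hF : LipschitzWith K F)
    (I : Set ℝ) : IsPrim F (deriv F) I := by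
  have hl : LocallyIntegrable (deriv F) volume := by
    refine (memLp_top_of_bound (C := K) (measurable_deriv F).aestronglyMeasurable
      (Eventually.of_forall fun x => norm_deriv_le_of_lipschitz hF)).locallyIntegrable
      (by simp)
  refine ⟨hl.locallyIntegrableOn I, fun a _ b _ => ?_⟩
  refine sub_eq_integral_of_ae_hasDerivAt
    (hF.lipschitzOnWith.absolutelyContinuousOnInterval) ((intervalIntegrable_iff' (by simp)).2 (hl.integrableOn_isCompact isCompact_uIcc)) ?_
  filter_upwards [hF.ae_differentiableAt] with x hx _
  exact hx.hasDerivAt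

/-! ### Weak derivatives and primitives -/

theorem HasWeakDerivOn.congr_on {E : Type*} [NormedAddCommGroup E] [NormedSpace ℝ E]
    {f₁ f₂ g₁ g₂ : ℝ → E} {I : Set ℝ} (hI : MeasurableSet I) (h : HasWeakDerivOn f₁ g₁ I)
    (hf : ∀ᵐ x, x ∈ I → f₁ x = f₂ x) (hg : ∀ᵐ x, x ∈ I → g₁ x = g₂ x) :
    HasWeakDerivOn f₂ g₂ I := by
  obtain ⟨a, b, d⟩ := h
  have aux : ∀ {p q : ℝ → E}, (∀ᵐ x, x ∈ I → p x = q x) → LocallyIntegrableOn p I →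
      LocallyIntegrableOn q I := by
    intro p q hpq hp x hx
    obtain ⟨s, hs, hi⟩ := hp x hx
    refine ⟨s ∩ I, inter_mem hs self_mem_nhdsWithin, ?_⟩
    refine (hi.mono_set inter_subset_left).congr_fun_ae ?_
    have : ∀ᵐ x ∂(volume.restrict I), p x = q x := (ae_restrict_iff' hI).2 hpq
    exact ae_mono (Measure.restrict_mono inter_subset_right le_rfl) this
  refine ⟨aux hf a, aux hg b, fun η h1 h2 h3 => ?_⟩
  have hz : ∀ {θ : ℝ → ℝ}, tsupport θ ⊆ I → ∀ x, x ∉ I → θ x = 0 := fun hθ x hx =>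
    image_eq_zero_of_notMem_tsupport fun hh => hx (hθ hh)
  have e1 : ∫ x, deriv η x • f₂ x = ∫ x, deriv η x • f₁ x :=
    integral_congr_ae (hf.mono fun x hx => by
      by_cases hxI : x ∈ I
      · simp [hx hxI]
      · simp [hz ((closure_minimal (support_deriv_subset) (isClosed_tsupport η)).trans h3) x hxI])
  have e2 : ∫ x, η x • g₂ x = ∫ x, η x • g₁ x :=
    integral_congr_ae (hg.mono fun x hx => by
      by_cases hxI : x ∈ I
      · simp [hx hxI]
      · simp [hz h3 x hxI])
  rw [e1, e2]
  exact d η h1 h2 h3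

/-- A compact subset of a nonempty open interval lies in a compact subinterval. -/
theorem exists_subset_Ioo_of_isCompact {I s : Set ℝ} (hI' : IsOpen I)
    (hs : IsCompact s) (hsI : s ⊆ I) (hne : I.Nonempty) :
    ∃ a ∈ I, ∃ b ∈ I, a < b ∧ s ⊆ Ioo a b := by
  have key : ∀ x ∈ I, ∃ ε > 0, x - ε ∈ I ∧ x + ε ∈ I := by
    intro x hx
    obtain ⟨ε, hε, hb⟩ := Metric.isOpen_iff.mp hI' x hx
    exact ⟨ε / 2, by positivity, hb (by simp [abs_of_pos hε, hε]),
      hb (by simp [abs_of_pos hε, hε])⟩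
  rcases s.eq_empty_or_nonempty with rfl | hn
  · obtain ⟨x, hx⟩ := hne
    obtain ⟨ε, hε, h1, h2⟩ := key x hx
    exact ⟨x - ε, h1, x + ε, h2, by linarith, empty_subset _⟩
  · obtain ⟨p, hp, hp'⟩ := hs.exists_isLeast hn
    obtain ⟨q, hq, hq'⟩ := hs.exists_isGreatest hn
    obtain ⟨ε, hε, h1, _⟩ := key p (hsI hp)
    obtain ⟨ε', hε', _, h2⟩ := key q (hsI hq)
    refine ⟨p - ε, h1, q + ε', h2, by linarith [hp' hq], fun x hx => ⟨?_, ?_⟩⟩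
    · linarith [hp' hx]
    · linarith [hq' hx]

theorem integral_eq_intervalIntegral {E : Type*} [NormedAddCommGroup E] [NormedSpace ℝ E]
    {f : ℝ → E} {a b : ℝ} (h : ∀ x, x ∉ Ioo a b → f x = 0) :
    ∫ x, f x = ∫ x in a..b, f x := by
  rw [intervalIntegral.integral_eq_integral_of_support_subset]
  intro x hx
  by_contra hh
  exact hx (h x fun h' => hh (Ioo_subset_Ioc_self h'))

open scoped ContDiff in
theorem isPrim_ofReal_contDiff {η : ℝ → ℝ} (hη : ContDiff ℝ ∞ η) (I : Set ℝ) :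
    IsPrim (fun x => (η x : ℂ)) (fun x => ((deriv η x : ℝ) : ℂ)) I := by
  have hc : Continuous (fun x => ((deriv η x : ℝ) : ℂ)) :=
    Complex.continuous_ofReal.comp (hη.continuous_deriv (by simp))
  refine ⟨hc.locallyIntegrable.locallyIntegrableOn I, fun a _ b _ => ?_⟩
  rw [intervalIntegral.integral_eq_sub_of_hasDerivAt (f := fun x => (η x : ℂ))]
  · intro x _
    exact ((hη.differentiable (by simp)) x).hasDerivAt.ofReal_comp
  · exact hc.intervalIntegrable _ _

/-- Integration by parts: η F has primitive structure and vanishes at both ends of a compact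
subinterval whose interior contains the support of η. -/
theorem IsPrim.hasWeakDerivOn {F g : ℝ → ℂ} {I : Set ℝ} (hI : OrdConnected I) (hI' : IsOpen I)
    (hF : IsPrim F g I) : HasWeakDerivOn F g I := by
  refine ⟨hF.locallyIntegrableOn hI hI', hF.1, fun η h1 h2 h3 => ?_⟩
  rcases I.eq_empty_or_nonempty with rfl | hne
  · have h4 : tsupport η = ∅ := subset_empty_iff.mp h3
    have h5 : η = 0 := tsupport_eq_empty_iff.mp h4
    simp [h5]
  · obtain ⟨a, ha, b, hb, _, hs⟩ := exists_subset_Ioo_of_isCompact hI' h2 h3 hne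
    have hz : ∀ x, x ∉ Ioo a b → η x = 0 := fun x hx =>
      image_eq_zero_of_notMem_tsupport fun hh => hx (hs hh)
    have hz' : ∀ x, x ∉ Ioo a b → deriv η x = 0 := fun x hx => by
      by_contra hh
      exact hx (hs (support_deriv_subset hh))
    rw [integral_eq_intervalIntegral fun x hx => by simp [hz' x hx],
      integral_eq_intervalIntegral fun x hx => by simp [hz x hx], eq_neg_iff_add_eq_zero,
      ← intervalIntegral.integral_add]
    · have h5 := ((isPrim_ofReal_contDiff h1 I).mul hI hI' hF).2 a ha b hb
      simp only [hz a (by simp), hz b (by simp), Complex.ofReal_zero, zero_mul, sub_zero] at h5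
      rw [h5]
      refine intervalIntegral.integral_congr fun x _ => ?_
      simp only [Complex.real_smul]
      ring
    · exact (intervalIntegrable_of_locallyIntegrableOn hI (hF.locallyIntegrableOn hI hI') ha
        hb).continuousOn_smul (h1.continuous_deriv (by simp)).continuousOn
    · exact (intervalIntegrable_of_locallyIntegrableOn hI hF.1 ha hb).continuousOn_smul
        h1.continuous.continuousOn

open scoped ContDiff in
/-- A test function with zero mean is the derivative of a test function. -/
theorem exists_deriv_eq_of_integral_eq_zero {I : Set ℝ} (hI : OrdConnected I) (hI' : IsOpen I)
    (hne : I.Nonempty) {θ : ℝ → ℝ} (h1 : ContDiff ℝ ∞ θ) (h2 : HasCompactSupport θ)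
    (h3 : tsupport θ ⊆ I) (h0 : ∫ x, θ x = 0) :
    ∃ ζ : ℝ → ℝ, ContDiff ℝ ∞ ζ ∧ HasCompactSupport ζ ∧ tsupport ζ ⊆ I ∧ deriv ζ = θ := by
  obtain ⟨a, ha, b, hb, hab, hs⟩ := exists_subset_Ioo_of_isCompact hI' h2 h3 hne
  have hz : ∀ x, x ∉ Ioo a b → θ x = 0 := fun x hx =>
    image_eq_zero_of_notMem_tsupport fun hh => hx (hs hh)
  set ζ : ℝ → ℝ := fun x => ∫ t in a..x, θ t with hζ
  have hd : ∀ x, HasDerivAt ζ (θ x) x := fun x =>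
    intervalIntegral.integral_hasDerivAt_right (h1.continuous.intervalIntegrable _ _)
      h1.continuous.stronglyMeasurable.stronglyMeasurableAtFilter h1.continuous.continuousAt
  have hd' : deriv ζ = θ := funext fun x => (hd x).deriv
  have hout : ∀ x, x ∉ Icc a b → ζ x = 0 := by
    intro x hx
    rw [mem_Icc, not_and_or, not_le, not_le] at hx
    rcases hx with hx | hx
    · rw [hζ]
      refine intervalIntegral.integral_zero_ae (Eventually.of_forall fun y hy => hz y fun h => ?_)
      rw [uIoc_of_ge hx.le] at hy
      exact absurd h.1 (not_lt.2 hy.2)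
    · have e : ∫ t in a..b, θ t = 0 := by rw [← integral_eq_intervalIntegral hz, h0]
      have e2 : ∫ t in b..x, θ t = 0 := by
        refine intervalIntegral.integral_zero_ae
          (Eventually.of_forall fun y hy => hz y fun h => ?_)
        rw [uIoc_of_le hx.le] at hy
        exact absurd h.2 (not_lt.2 hy.1.le)
      rw [hζ]
      simp only
      rw [← intervalIntegral.integral_add_adjacent_intervals
        (h1.continuous.intervalIntegrable a b) (h1.continuous.intervalIntegrable b x), e, e2,
        add_zero]
  have hsub : tsupport ζ ⊆ Icc a b := by
    refine closure_minimal (fun x hx => ?_) isClosed_Icc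
    by_contra hh
    exact hx (hout x hh)
  refine ⟨ζ, ?_, HasCompactSupport.of_support_subset_isCompact isCompact_Icc
    (subset_closure.trans hsub), hsub.trans (hI.out ha hb), hd'⟩
  rw [contDiff_infty_iff_deriv, hd']
  exact ⟨fun x => (hd x).differentiableAt, h1⟩

theorem integrable_smul_of_tsupport_subset {E : Type*} [NormedAddCommGroup E] [NormedSpace ℝ E]
    {p : ℝ → E} {I : Set ℝ} (hp : LocallyIntegrableOn p I) {η : ℝ → ℝ} (hc : Continuous η)
    (hs : HasCompactSupport η) (hsI : tsupport η ⊆ I) : Integrable (fun x => η x • p x) := by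
  rw [← integrableOn_iff_integrable_of_support_subset (s := tsupport η)]
  · exact (hp.integrableOn_compact_subset hsI hs).continuousOn_smul hc.continuousOn hs
  · intro x hx
    refine subset_tsupport η fun h0 => hx ?_
    simp [h0]

/-- The lemma of du Bois-Reymond. -/
theorem HasWeakDerivOn.ae_eq_const {f : ℝ → ℂ} {I : Set ℝ} (hI : OrdConnected I) (hI' : IsOpen I)
    (h : HasWeakDerivOn f (fun _ => 0) I) : ∃ c : ℂ, ∀ᵐ x, x ∈ I → f x = c := by
  rcases I.eq_empty_or_nonempty with rfl | hne
  · exact ⟨0, by simp⟩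
  obtain ⟨x₀, hx₀⟩ := hne
  obtain ⟨r, hr, hb⟩ := Metric.isOpen_iff.mp hI' x₀ hx₀
  let B : ContDiffBump x₀ := ⟨r / 4, r / 2, by positivity, by linarith⟩
  set η₀ : ℝ → ℝ := B.normed volume with hη₀
  have n1 := B.contDiff_normed (μ := volume) (n := (⊤ : ℕ∞))
  have n2 : HasCompactSupport η₀ := B.hasCompactSupport_normed
  have n3 : tsupport η₀ ⊆ I := by
    rw [hη₀, B.tsupport_normed_eq]
    exact (Metric.closedBall_subset_ball (by change r / 2 < r; linarith)).trans hb
  have n4 : ∫ x, η₀ x = 1 := B.integral_normed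
  set c : ℂ := ∫ x, η₀ x • f x with hc
  refine ⟨c, ?_⟩
  have key : ∀ᵐ x, x ∈ I → f x - c = 0 := by
    refine hI'.ae_eq_zero_of_integral_contDiff_smul_eq_zero
      (h.1.sub (continuous_const.locallyIntegrable.locallyIntegrableOn I)) fun η h1 h2 h3 => ?_
    set m : ℝ := ∫ x, η x with hm
    have i1 : Integrable η := h1.continuous.integrable_of_hasCompactSupport h2
    have i2 : Integrable η₀ := n1.continuous.integrable_of_hasCompactSupport n2
    have hts : tsupport (fun x => η x - m * η₀ x) ⊆ tsupport η ∪ tsupport η₀ := by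
      refine closure_minimal (fun x hx => ?_) ((isClosed_tsupport _).union (isClosed_tsupport _))
      by_contra hh
      rw [mem_union, not_or] at hh
      refine hx ?_
      simp [image_eq_zero_of_notMem_tsupport hh.1, image_eq_zero_of_notMem_tsupport hh.2]
    -- Subtracting m η₀ gives zero mean, so η - m η₀ is itself the derivative of a test function and
    -- f integrates to zero against it. Rearranged, this says that η integrates to zero against f -
    -- c.
    obtain ⟨ζ, z1, z2, z3, z4⟩ := exists_deriv_eq_of_integral_eq_zero hI hI' ⟨x₀, hx₀⟩
      (θ := fun x => η x - m * η₀ x) (h1.sub (contDiff_const.mul n1))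
      (HasCompactSupport.of_support_subset_isCompact (h2.isCompact.union n2.isCompact)
        (subset_closure.trans hts))
      (hts.trans (union_subset h3 n3))
      (by rw [integral_sub i1 (i2.const_mul m), integral_const_mul, n4]; simp [hm])
    have := h.2.2 ζ z1 z2 z3
    rw [z4] at this
    simp only [smul_zero, integral_zero, neg_zero, sub_smul, mul_smul] at this
    have i3 : Integrable (fun x => m • η₀ x • f x) := (integrable_smul_of_tsupport_subset h.1 n1.continuous n2 n3).smul m
    rw [integral_sub (integrable_smul_of_tsupport_subset h.1 h1.continuous h2 h3) i3, integral_smul, ← hc] at this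
    simp only [smul_sub]
    rw [integral_sub (integrable_smul_of_tsupport_subset h.1 h1.continuous h2 h3) (i1.smul_const c), integral_smul_const, ← hm]
    exact this
  filter_upwards [key] with x hx hxI
  exact sub_eq_zero.mp (hx hxI)

namespace HasWeakDerivOn

variable {f f₁ f₂ g g₁ g₂ : ℝ → ℂ} {I : Set ℝ}

theorem sub_on (h₁ : HasWeakDerivOn f₁ g₁ I)
    (h₂ : HasWeakDerivOn f₂ g₂ I) :
    HasWeakDerivOn (fun x => f₁ x - f₂ x) (fun x => g₁ x - g₂ x) I := by
  refine ⟨h₁.1.sub h₂.1, h₁.2.1.sub h₂.2.1, fun η h1 h2 h3 => ?_⟩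
  have hd : Continuous (deriv η) := h1.continuous_deriv (by simp)
  have hds : tsupport (deriv η) ⊆ I :=
    (closure_minimal support_deriv_subset (isClosed_tsupport η)).trans h3
  simp only [smul_sub]
  rw [integral_sub (integrable_smul_of_tsupport_subset h₁.1 hd h2.deriv hds) (integrable_smul_of_tsupport_subset h₂.1 hd h2.deriv hds),
    integral_sub (integrable_smul_of_tsupport_subset h₁.2.1 h1.continuous h2 h3) (integrable_smul_of_tsupport_subset h₂.2.1 h1.continuous h2 h3),
    h₁.2.2 η h1 h2 h3, h₂.2.2 η h1 h2 h3]
  ring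

/-- A function with a weak derivative on an open interval has an absolutely continuous
representative. -/
theorem exists_isPrim (hI : OrdConnected I) (hI' : IsOpen I) (h : HasWeakDerivOn f g I) :
    ∃ F, IsPrim F g I ∧ ∀ᵐ x, x ∈ I → f x = F x := by
  rcases I.eq_empty_or_nonempty with rfl | ⟨a, ha⟩
  · exact ⟨f, ⟨h.2.1, by simp⟩, by simp⟩
  have hP : ∀ c : ℂ, IsPrim (fun x => c + ∫ t in a..x, g t) g I := by
    intro c
    refine ⟨h.2.1, fun p hp q hq => ?_⟩
    have := intervalIntegral.integral_interval_sub_left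
      (intervalIntegrable_of_locallyIntegrableOn hI h.2.1 ha hq)
      (intervalIntegrable_of_locallyIntegrableOn hI h.2.1 ha hp)
    rw [← this]; ring
  -- The difference of f and the integral of its weak derivative has weak derivative zero, hence is
  -- a constant, which is absorbed into the primitive.
  have h1 := h.sub_on ((hP 0).hasWeakDerivOn hI hI')
  simp only [sub_self, zero_add] at h1
  obtain ⟨c, hc⟩ := h1.ae_eq_const hI hI'
  refine ⟨_, hP c, hc.mono fun x hx hxI => ?_⟩
  rw [← hx hxI]; ring

theorem mul_on (hI : OrdConnected I) (hI' : IsOpen I) (h₁ : HasWeakDerivOn f₁ g₁ I)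
    (h₂ : HasWeakDerivOn f₂ g₂ I) :
    HasWeakDerivOn (fun x => f₁ x * f₂ x) (fun x => f₁ x * g₂ x + g₁ x * f₂ x) I := by
  obtain ⟨F₁, p₁, e₁⟩ := h₁.exists_isPrim hI hI'
  obtain ⟨F₂, p₂, e₂⟩ := h₂.exists_isPrim hI hI'
  refine ((p₁.mul hI hI' p₂).hasWeakDerivOn hI hI').congr_on hI'.measurableSet ?_ ?_
  · filter_upwards [e₁, e₂] with x a b hx
    rw [a hx, b hx]
  · filter_upwards [e₁, e₂] with x a b hx
    rw [a hx, b hx]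

theorem map_clm {E E' : Type*} [NormedAddCommGroup E] [NormedSpace ℝ E] [CompleteSpace E]
    [NormedAddCommGroup E'] [NormedSpace ℝ E'] [CompleteSpace E'] {f g : ℝ → E} {I : Set ℝ}
    (h : HasWeakDerivOn f g I) (A : E →L[ℝ] E') :
    HasWeakDerivOn (fun x => A (f x)) (fun x => A (g x)) I := by
  have hA : ∀ {p : ℝ → E}, LocallyIntegrableOn p I → LocallyIntegrableOn (fun x => A (p x)) I := by
    intro p hp x hx
    obtain ⟨s, hs, hi⟩ := hp x hx
    exact ⟨s, hs, A.integrable_comp hi⟩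
  refine ⟨hA h.1, hA h.2.1, fun η h1 h2 h3 => ?_⟩
  have hd : Continuous (deriv η) := h1.continuous_deriv (by simp)
  have hds : tsupport (deriv η) ⊆ I :=
    (closure_minimal support_deriv_subset (isClosed_tsupport η)).trans h3
  simp only [← map_smul]
  rw [A.integral_comp_comm (integrable_smul_of_tsupport_subset h.1 hd h2.deriv hds),
    A.integral_comp_comm (integrable_smul_of_tsupport_subset h.2.1 h1.continuous h2 h3), h.2.2 η h1 h2 h3, map_neg]

theorem ae_unique (hI' : IsOpen I) (h₁ : HasWeakDerivOn f g₁ I)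
    (h₂ : HasWeakDerivOn f g₂ I) : ∀ᵐ x, x ∈ I → g₁ x = g₂ x := by
  have h := h₁.sub_on h₂
  have := hI'.ae_eq_zero_of_integral_contDiff_smul_eq_zero h.2.1 fun η h1 h2 h3 => by
    have := h.2.2 η h1 h2 h3
    simp only [sub_self, smul_zero, integral_zero] at this
    exact neg_eq_zero.mp this.symm
  filter_upwards [this] with x hx hxI
  exact sub_eq_zero.mp (hx hxI)

theorem mono_on {E : Type*} [NormedAddCommGroup E] [NormedSpace ℝ E] {f g : ℝ → E} {I J : Set ℝ}
    (h : HasWeakDerivOn f g I) (hJ : J ⊆ I) : HasWeakDerivOn f g J :=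
  ⟨h.1.mono_set hJ, h.2.1.mono_set hJ, fun η h1 h2 h3 => h.2.2 η h1 h2 (h3.trans hJ)⟩

end HasWeakDerivOn

/-! ### The Sobolev inequality on an interval -/

/-- An open interval contains, around each of its points, intervals of a uniform length. -/
theorem exists_uniform_Icc_subset {I : Set ℝ} (hI : OrdConnected I) (hI' : IsOpen I) :
    ∃ ℓ : ℝ, 0 < ℓ ∧ ℓ ≤ 1 ∧ ∀ x ∈ I, ∃ a, x ∈ Icc a (a + ℓ) ∧ Icc a (a + ℓ) ⊆ I := by
  rcases I.eq_empty_or_nonempty with rfl | ⟨p, hp⟩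
  · exact ⟨1, one_pos, le_rfl, by simp⟩
  obtain ⟨ε, hε, hb⟩ := Metric.isOpen_iff.mp hI' p hp
  set ℓ := min 1 (ε / 4) with hℓ
  have h0 : 0 < ℓ := by positivity
  have h2 : p + 2 * ℓ ∈ I := hb (by
    have : ℓ ≤ ε / 4 := min_le_right _ _
    rw [Metric.mem_ball, Real.dist_eq, add_sub_cancel_left, abs_of_pos (by positivity)]
    linarith)
  -- Points to the right of p + ℓ use an interval extending to the left, towards p; the others use
  -- one extending to the right, which stays below p + 2ℓ. This covers bounded and unbounded
  -- intervals alike.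
  refine ⟨ℓ, h0, min_le_left _ _, fun x hx => ?_⟩
  rcases le_total (p + ℓ) x with h | h
  · exact ⟨x - ℓ, ⟨by linarith, by linarith⟩, fun y hy =>
      hI.out hp hx ⟨by linarith [hy.1], by linarith [hy.2]⟩⟩
  · exact ⟨x, ⟨le_rfl, by linarith⟩, fun y hy =>
      hI.out hx h2 ⟨hy.1, by linarith [hy.2]⟩⟩

theorem setLIntegral_enorm_le_eLpNorm_two {g : ℝ → ℂ} {J : Set ℝ} (hJ : volume J ≤ 1)
    (hg : AEStronglyMeasurable g (volume.restrict J)) :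
    ∫⁻ y in J, ‖g y‖ₑ ≤ eLpNorm g 2 (volume.restrict J) := by
  rw [← eLpNorm_one_eq_lintegral_enorm]
  refine (eLpNorm_le_eLpNorm_mul_rpow_measure_univ (p := 1) (q := 2) (by norm_num) hg).trans ?_
  rw [Measure.restrict_apply_univ]
  calc _ ≤ eLpNorm g 2 (volume.restrict J) * 1 := by
        gcongr
        exact ENNReal.rpow_le_one hJ (by norm_num)
    _ = _ := mul_one _

/-- The bound |F(x)| ≤ |F(y)| + ∫_J |g| is averaged over y in an interval J ∋ x of fixed length ℓ ≤
1. On J the L¹ norms are at most the L² norms, which gives the constant 1/ℓ + 1. -/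
theorem exists_ae_enorm_le_of_hasWeakDerivOn {I : Set ℝ} (hI : OrdConnected I) (hI' : IsOpen I) :
    ∃ C : NNReal, ∀ f g : ℝ → ℂ, HasWeakDerivOn f g I → ∀ᵐ x, x ∈ I →
      ‖f x‖ₑ ≤ C * (eLpNorm f 2 (volume.restrict I) + eLpNorm g 2 (volume.restrict I)) := by
  obtain ⟨ℓ, h0, h1, hℓ⟩ := exists_uniform_Icc_subset hI hI'
  refine ⟨Real.toNNReal ℓ⁻¹ + 1, fun f g h => ?_⟩
  obtain ⟨F, hF, hfF⟩ := h.exists_isPrim hI hI'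
  have hfF' : f =ᵐ[volume.restrict I] F := (ae_restrict_iff' hI'.measurableSet).2 hfF
  filter_upwards [hfF] with x hx hxI
  rw [hx hxI, eLpNorm_congr_ae hfF']
  obtain ⟨a, hxa, haI⟩ := hℓ x hxI
  set J := Icc a (a + ℓ) with hJ
  have vJ : volume J = ENNReal.ofReal ℓ := by simp [hJ]
  have vJ1 : volume J ≤ 1 := by rw [vJ]; exact ENNReal.ofReal_le_one.2 h1
  have mF : AEStronglyMeasurable F (volume.restrict J) :=
    ((hF.continuousOn hI hI').mono haI).aestronglyMeasurable measurableSet_Icc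
  have mg : AEStronglyMeasurable g (volume.restrict J) :=
    (hF.1.integrableOn_compact_subset haI isCompact_Icc).aestronglyMeasurable
  have key : ∀ y ∈ J, ‖F x‖ₑ ≤ ‖F y‖ₑ + ∫⁻ t in J, ‖g t‖ₑ := by
    intro y hy
    have e : F x = F y + ∫ t in y..x, g t := by
      rw [← hF.2 y (haI hy) x hxI]; ring
    rw [e]
    refine (enorm_add_le _ _).trans ?_
    gcongr
    have e' : ‖∫ t in y..x, g t‖ₑ = ‖∫ t in uIoc y x, g t‖ₑ := by
      rw [← ofReal_norm, ← ofReal_norm, intervalIntegral.norm_intervalIntegral_eq]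
    rw [e']
    refine (enorm_integral_le_lintegral_enorm _).trans ?_
    exact lintegral_mono_set (uIoc_subset_uIcc.trans
      ((ordConnected_Icc (a := a) (b := a + ℓ)).uIcc_subset hy hxa))
  have hint : ∫⁻ _ in J, ‖F x‖ₑ ≤ ∫⁻ y in J, (‖F y‖ₑ + ∫⁻ t in J, ‖g t‖ₑ) :=
    setLIntegral_mono' measurableSet_Icc key
  rw [lintegral_add_left' mF.enorm, setLIntegral_const, setLIntegral_const, vJ] at hint
  have hl0 : ENNReal.ofReal ℓ ≠ 0 := by simpa using h0
  have hlt : ENNReal.ofReal ℓ ≠ ⊤ := ENNReal.ofReal_ne_top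
  have e3 : ((Real.toNNReal ℓ⁻¹ : NNReal) : ℝ≥0∞) = (ENNReal.ofReal ℓ)⁻¹ := by
    rw [← ENNReal.ofReal_inv_of_pos h0, ENNReal.ofReal]
  set m := ENNReal.ofReal ℓ with hm
  calc ‖F x‖ₑ = m⁻¹ * (‖F x‖ₑ * m) := by
        rw [mul_comm (‖F x‖ₑ), ← mul_assoc, ENNReal.inv_mul_cancel hl0 hlt, one_mul]
    _ ≤ m⁻¹ * ((∫⁻ t in J, ‖F t‖ₑ) + (∫⁻ t in J, ‖g t‖ₑ) * m) := by gcongr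
    _ = m⁻¹ * (∫⁻ t in J, ‖F t‖ₑ) + ∫⁻ t in J, ‖g t‖ₑ := by
        rw [mul_add, mul_comm _ m, ← mul_assoc, ENNReal.inv_mul_cancel hl0 hlt, one_mul]
    _ ≤ m⁻¹ * eLpNorm F 2 (volume.restrict I) + eLpNorm g 2 (volume.restrict I) := by
        gcongr
        · exact (setLIntegral_enorm_le_eLpNorm_two vJ1 mF).trans
            (eLpNorm_mono_measure _ (Measure.restrict_mono haI le_rfl))
        · exact (setLIntegral_enorm_le_eLpNorm_two vJ1 mg).trans
            (eLpNorm_mono_measure _ (Measure.restrict_mono haI le_rfl))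
    _ ≤ _ := by
        rw [ENNReal.coe_add, e3, ENNReal.coe_one, add_mul, one_mul, mul_add]
        gcongr
        · exact le_self_add
        · exact le_add_self

/-! ### The layers -/

namespace Medium

variable (M : Medium)

theorem isOpen_layer (i : Fin (M.n + 1)) : IsOpen (M.layer i) := by
  have : M.layer i = ⋂ j : Fin M.n, {y | ((j : ℕ) < i → M.interface j < y) ∧
      ((i : ℕ) ≤ j → y < M.interface j)} := by
    ext y; simp [layer]
  rw [this]
  refine isOpen_iInter_of_finite fun j => ?_
  by_cases h : (j : ℕ) < i
  · simp only [h, true_implies, not_le.2 h, false_implies, and_true]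
    exact isOpen_Ioi
  · simp only [h, false_implies, not_lt.1 h, true_implies, true_and]
    exact isOpen_Iio

theorem ordConnected_layer (i : Fin (M.n + 1)) : OrdConnected (M.layer i) :=
  ⟨fun _ hx _ hy _ hz j => ⟨fun h => ((hx j).1 h).trans_le hz.1,
    fun h => hz.2.trans_lt ((hy j).2 h)⟩⟩

theorem measurableSet_layer (i : Fin (M.n + 1)) : MeasurableSet (M.layer i) :=
  (M.isOpen_layer i).measurableSet

theorem layer_unique {i j : Fin (M.n + 1)} {x : ℝ} (hi : x ∈ M.layer i) (hj : x ∈ M.layer j) :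
    i = j := by
  by_contra hne
  wlog h : i < j generalizing i j
  · exact this hj hi (Ne.symm hne) (lt_of_le_of_ne (not_lt.1 h) (Ne.symm hne))
  have hl : (i : ℕ) < M.n := by omega
  exact lt_asymm ((hi ⟨i, hl⟩).2 le_rfl) ((hj ⟨i, hl⟩).1 h)

theorem exists_mem_layer {x : ℝ} (hx : ∀ j, x ≠ M.interface j) : ∃ i, x ∈ M.layer i := by
  classical
  -- The index of the layer is the least i such that all interfaces from the i-th on lie to the
  -- right of x; minimality places the previous interfaces to the left.
  have hex : ∃ i : ℕ, ∀ j : Fin M.n, i ≤ j → x < M.interface j :=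
    ⟨M.n, fun j hj => absurd j.2 (not_lt.2 hj)⟩
  have hle : Nat.find hex ≤ M.n := Nat.find_min' hex fun j hj => absurd j.2 (not_lt.2 hj)
  refine ⟨⟨Nat.find hex, by omega⟩, fun j => ⟨fun hj => ?_, Nat.find_spec hex j⟩⟩
  have hj : (j : ℕ) < Nat.find hex := hj
  have h1 := Nat.find_min hex (m := Nat.find hex - 1) (by omega)
  push Not at h1
  obtain ⟨j', h2, h3⟩ := h1
  have h4 : (j' : ℕ) < Nat.find hex := by
    by_contra h
    exact absurd (Nat.find_spec hex j' (not_lt.1 h)) (not_lt.2 h3)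
  exact (M.interface_strictMono.monotone (by rw [Fin.le_def]; omega)).trans_lt
    (lt_of_le_of_ne h3 (hx j').symm)

theorem ae_exists_mem_layer : ∀ᵐ x : ℝ, ∃ i, x ∈ M.layer i := by
  have : ∀ᵐ x : ℝ, ∀ j, x ≠ M.interface j :=
    ae_all_iff.2 fun j => by simp [ae_iff, measure_singleton]
  filter_upwards [this] with x hx
  exact M.exists_mem_layer hx

/-- The function equal to `G i` on the `i`-th layer. -/
def glue (G : Fin (M.n + 1) → ℝ → ℂ) (x : ℝ) : ℂ := ∑ i, (M.layer i).indicator (G i) x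

theorem glue_apply (G : Fin (M.n + 1) → ℝ → ℂ) {i : Fin (M.n + 1)} {x : ℝ} (hx : x ∈ M.layer i) :
    M.glue G x = G i x := by
  rw [glue, Finset.sum_eq_single i, indicator_of_mem hx]
  · intro j _ hj
    exact indicator_of_notMem (fun h => hj (M.layer_unique h hx)) _
  · simp

theorem aestronglyMeasurable_glue {G : Fin (M.n + 1) → ℝ → ℂ}
    (hG : ∀ i, AEStronglyMeasurable (G i) (volume.restrict (M.layer i))) :
    AEStronglyMeasurable (M.glue G) volume := by
  unfold glue
  exact Finset.aestronglyMeasurable_fun_sum _ fun i _ =>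
    (aestronglyMeasurable_indicator_iff (M.measurableSet_layer i)).2 (hG i)

theorem eLpNorm_le_sum (f : ℝ → ℂ) {p : ℝ≥0∞} (hp : 1 ≤ p)
    (hf : ∀ i, AEStronglyMeasurable f (volume.restrict (M.layer i))) :
    eLpNorm f p volume ≤ ∑ i, eLpNorm f p (volume.restrict (M.layer i)) := by
  have h1 : f =ᵐ[volume] ∑ i, (M.layer i).indicator f := by
    filter_upwards [M.ae_exists_mem_layer] with x hx
    obtain ⟨i, hi⟩ := hx
    rw [Finset.sum_apply]
    exact (M.glue_apply (fun _ => f) hi).symm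
  rw [eLpNorm_congr_ae h1]
  refine (eLpNorm_sum_le (fun i _ =>
    (aestronglyMeasurable_indicator_iff (M.measurableSet_layer i)).2 (hf i)) hp).trans ?_
  refine Finset.sum_le_sum fun i _ => ?_
  rw [eLpNorm_indicator_eq_eLpNorm_restrict (M.measurableSet_layer i)]

/-! ### Lipschitz multipliers -/

/-- Off a null set, `a` is bounded by `K` and Lipschitz with constant `K` on each layer. -/
def MulBound (a : ℝ → ℂ) (K : ℝ) : Prop :=
  ∃ s : Set ℝ, (∀ᵐ x, x ∈ s) ∧ ∀ i, ∀ x ∈ s, x ∈ M.layer i →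
    ‖a x‖ ≤ K ∧ ∀ y ∈ s, y ∈ M.layer i → ‖a x - a y‖ ≤ K * |x - y|

variable {M}

theorem MulBound.ae_norm_le {a : ℝ → ℂ} {K : ℝ} (h : M.MulBound a K) : ∀ᵐ x, ‖a x‖ ≤ K := by
  obtain ⟨s, hs, h⟩ := h
  filter_upwards [hs, M.ae_exists_mem_layer] with x hx hi
  obtain ⟨i, hi⟩ := hi
  exact (h i x hx hi).1

theorem MulBound.nonneg {a : ℝ → ℂ} {K : ℝ} (h : M.MulBound a K) : 0 ≤ K := by
  obtain ⟨x, hx⟩ := h.ae_norm_le.exists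
  exact (norm_nonneg _).trans hx

theorem MulBound.mono {a : ℝ → ℂ} {K K' : ℝ} (h : M.MulBound a K) (hK : K ≤ K') :
    M.MulBound a K' := by
  obtain ⟨s, hs, h⟩ := h
  refine ⟨s, hs, fun i x hx hi => ⟨(h i x hx hi).1.trans hK, fun y hy hyi =>
    ((h i x hx hi).2 y hy hyi).trans ?_⟩⟩
  gcongr

/-- A constant relating the norm of the weak derivative of a multiplier to its Lipschitz
constant. -/
def lipConst : ℝ := lipschitzExtensionConstant ℂ

theorem lipConst_pos : 0 < lipConst := lipschitzExtensionConstant_pos ℂ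

/-- The Lipschitz bound is available only on a set of full measure in each layer. A Lipschitz
extension to the line, at the price of `lipConst`, is differentiable almost everywhere, and its
derivative is the weak derivative sought. -/
theorem MulBound.exists_weakDeriv {a : ℝ → ℂ} {K : ℝ} (h : M.MulBound a K) :
    AEStronglyMeasurable a volume ∧ ∃ a' : ℝ → ℂ, AEStronglyMeasurable a' volume ∧
      (∀ i, HasWeakDerivOn a a' (M.layer i)) ∧ ∀ x, ‖a' x‖ ≤ lipConst * K := by
  have hK := h.nonneg
  obtain ⟨s, hs, h⟩ := h
  have hex : ∀ i, ∃ F : ℝ → ℂ, LipschitzWith (lipschitzExtensionConstant ℂ * K.toNNReal) F ∧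
      EqOn a F (s ∩ M.layer i) := by
    intro i
    refine LipschitzOnWith.extend_finite_dimension (LipschitzOnWith.of_dist_le_mul ?_)
    intro x hx y hy
    rw [dist_eq_norm, Real.dist_eq, Real.coe_toNNReal _ hK]
    exact (h i x hx.1 hx.2).2 y hy.1 hy.2
  choose F hF hFa using hex
  have hbd : ∀ i x, ‖deriv (F i) x‖ ≤ lipConst * K := fun i x => by
    refine (norm_deriv_le_of_lipschitz (hF i)).trans ?_
    rw [NNReal.coe_mul, Real.coe_toNNReal _ hK, lipConst]
  have h1 : a =ᵐ[volume] M.glue F := by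
    filter_upwards [hs, M.ae_exists_mem_layer] with x hx hi
    obtain ⟨i, hi⟩ := hi
    rw [M.glue_apply F hi]
    exact hFa i ⟨hx, hi⟩
  refine ⟨(M.aestronglyMeasurable_glue fun i =>
    (hF i).continuous.aestronglyMeasurable).congr h1.symm, M.glue fun i => deriv (F i),
    M.aestronglyMeasurable_glue fun i => (measurable_deriv (F i)).aestronglyMeasurable,
    fun i => ?_, fun x => ?_⟩
  · refine (((hF i).isPrim (M.layer i)).hasWeakDerivOn (M.ordConnected_layer i)
      (M.isOpen_layer i)).congr_on (M.measurableSet_layer i) ?_ ?_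
    · filter_upwards [hs] with x hx hi
      exact (hFa i ⟨hx, hi⟩).symm
    · exact Eventually.of_forall fun x hi => (M.glue_apply (fun i => deriv (F i)) hi).symm
  · by_cases hx : ∃ i, x ∈ M.layer i
    · obtain ⟨i, hi⟩ := hx
      rw [M.glue_apply (fun i => deriv (F i)) hi]
      exact hbd i x
    · have : M.glue (fun i => deriv (F i)) x = 0 :=
        Finset.sum_eq_zero fun i _ => indicator_of_notMem (fun hi => hx ⟨i, hi⟩) _
      rw [this, norm_zero]
      exact mul_nonneg lipConst_pos.le hK

/-- The passage from W^{1,∞} norms to pointwise bounds off a null set. Such bounds are stable under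
operations performed for each x separately, for instance divided differences in ω. The strict
inequality extracts an actual weak derivative from the infimum. -/
theorem mulBound_of_sobolevNorm_lt {a : ℝ → ℂ} {K : ℝ}
    (h : ∀ i, sobolevNorm ⊤ a (M.layer i) < ENNReal.ofReal K) : M.MulBound a K := by
  have hK : 0 < K := ENNReal.ofReal_pos.1 (zero_le.trans_lt (h 0))
  have key : ∀ i, ∃ F : ℝ → ℂ, (∀ᵐ x, x ∈ M.layer i → a x = F x ∧ ‖a x‖ ≤ K) ∧
      ∀ x ∈ M.layer i, ∀ y ∈ M.layer i, ‖F x - F y‖ ≤ K * |x - y| := by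
    intro i
    have h1 := h i
    simp only [sobolevNorm, iInf_lt_iff] at h1
    obtain ⟨g, hg, h2⟩ := h1
    obtain ⟨F, hF, e⟩ := hg.exists_isPrim (M.ordConnected_layer i) (M.isOpen_layer i)
    have bound : ∀ {p : ℝ → ℂ}, eLpNorm p ⊤ (volume.restrict (M.layer i)) ≤ ENNReal.ofReal K →
        ∀ᵐ x, x ∈ M.layer i → ‖p x‖ ≤ K := by
      intro p hp
      rw [← ae_restrict_iff' (M.measurableSet_layer i)]
      filter_upwards [enorm_ae_le_eLpNormEssSup p (volume.restrict (M.layer i))] with x hx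
      rw [eLpNorm_exponent_top] at hp
      have := hx.trans hp
      rw [← ofReal_norm] at this
      exact (ENNReal.ofReal_le_ofReal_iff hK.le).1 this
    have ba := bound (le_self_add.trans h2.le)
    have bg := bound (le_add_self.trans h2.le)
    refine ⟨F, by filter_upwards [e, ba] with x h1 h2 hx using ⟨h1 hx, h2 hx⟩, ?_⟩
    intro x hx y hy
    rw [hF.2 y hy x hx]
    refine intervalIntegral.norm_integral_le_of_norm_le_const_ae ?_
    filter_upwards [bg] with t ht htm
    exact ht ((M.ordConnected_layer i).uIcc_subset hy hx (uIoc_subset_uIcc htm))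
  choose F hF hFl using key
  refine ⟨{x | ∀ i, x ∈ M.layer i → a x = F i x ∧ ‖a x‖ ≤ K}, ae_all_iff.2 hF,
    fun i x hx hi => ⟨(hx i hi).2, fun y hy hyi => ?_⟩⟩
  rw [(hx i hi).1, (hy i hyi).1]
  exact hFl i x hi y hyi

theorem exists_mulBound {a : ℝ → ℂ} (h : ∀ i, sobolevNorm ⊤ a (M.layer i) < ⊤) :
    ∃ K, M.MulBound a K := by
  have hs : ∑ i, sobolevNorm ⊤ a (M.layer i) < ⊤ := ENNReal.sum_lt_top.2 fun i _ => h i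
  refine ⟨(∑ i, sobolevNorm ⊤ a (M.layer i)).toReal + 1, mulBound_of_sobolevNorm_lt fun i => ?_⟩
  refine (Finset.single_le_sum (f := fun i => sobolevNorm ⊤ a (M.layer i))
    (fun _ _ => zero_le) (Finset.mem_univ i)).trans_lt ?_
  rw [ENNReal.lt_ofReal_iff_toReal_lt hs.ne]
  linarith

end Medium

/-! ### The scalar broken Sobolev space as a Banach space -/

/-- The scalar space `L²(ℝ, ℂ)`. -/
abbrev L2s : Type := Lp ℂ 2 (volume : Measure ℝ)

theorem locallyIntegrable_L2s (f : L2s) : LocallyIntegrable (fun x => f x) volume :=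
  (Lp.memLp f).locallyIntegrable (by norm_num)

theorem memLp_ofReal_of_hasCompactSupport {θ : ℝ → ℝ} (hθ : Continuous θ)
    (hs : HasCompactSupport θ) : MemLp (fun x => (θ x : ℂ)) 2 volume :=
  (Complex.continuous_ofReal.comp hθ).memLp_of_hasCompactSupport
    (hs.comp_left Complex.ofReal_zero)

open scoped ContDiff in
/-- A smooth compactly supported real function, as an element of `L²`. -/
def testLp (θ : {θ : ℝ → ℝ // Continuous θ ∧ HasCompactSupport θ}) : L2s :=
  (memLp_ofReal_of_hasCompactSupport θ.2.1 θ.2.2).toLp _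

theorem inner_testLp (θ : {θ : ℝ → ℝ // Continuous θ ∧ HasCompactSupport θ}) (f : L2s) :
    inner ℂ (testLp θ) f = ∫ x, θ.1 x • f x := by
  rw [L2.inner_def]
  refine integral_congr_ae ?_
  filter_upwards [(memLp_ofReal_of_hasCompactSupport θ.2.1 θ.2.2).coeFn_toLp] with x hx
  rw [testLp, hx]
  simp [mul_comm]

namespace Medium

variable (M : Medium)

open scoped ContDiff in
/-- The pairs of a test function supported in a layer, and its derivative. -/
def TestFun : Type :=
  {η : ℝ → ℝ // ContDiff ℝ ∞ η ∧ HasCompactSupport η ∧ ∃ i, tsupport η ⊆ M.layer i}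

/-- The functional that vanishes on pairs `(f, f')`. -/
def testFunctional (η : M.TestFun) : (L2s × L2s) →L[ℂ] ℂ :=
  (innerSL ℂ (testLp ⟨deriv η.1, η.2.1.continuous_deriv (by simp), η.2.2.1.deriv⟩)).comp
      (ContinuousLinearMap.fst ℂ L2s L2s) +
    (innerSL ℂ (testLp ⟨η.1, η.2.1.continuous, η.2.2.1⟩)).comp
      (ContinuousLinearMap.snd ℂ L2s L2s)

/-- The pairs `(f, g)` of functions in `L²` such that `g` is the weak derivative of `f` on each
layer. -/
def brokenH1 : Submodule ℂ (L2s × L2s) := ⨅ η : M.TestFun, (M.testFunctional η).ker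

/-- The scalar broken Sobolev space. -/
abbrev Y : Type := M.brokenH1

/-- Elements of L² are locally integrable, so only the testing identities remain. Each is the
vanishing of a continuous functional, and the space is closed as an intersection of kernels. -/
theorem mem_brokenH1 (p : L2s × L2s) :
    p ∈ M.brokenH1 ↔ ∀ i, HasWeakDerivOn (fun x => p.1 x) (fun x => p.2 x) (M.layer i) := by
  have h : ∀ η : M.TestFun, p ∈ (M.testFunctional η).ker ↔
      ∫ x, deriv η.1 x • p.1 x = -∫ x, η.1 x • p.2 x := by
    intro η
    rw [LinearMap.mem_ker, ← add_eq_zero_iff_eq_neg]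
    simp [testFunctional, inner_testLp]
  simp only [brokenH1, Submodule.mem_iInf, h]
  constructor
  · intro H i
    exact ⟨(locallyIntegrable_L2s p.1).locallyIntegrableOn _,
      (locallyIntegrable_L2s p.2).locallyIntegrableOn _,
      fun η h1 h2 h3 => H ⟨η, h1, h2, i, h3⟩⟩
  · rintro H ⟨η, h1, h2, i, h3⟩
    exact (H i).2.2 η h1 h2 h3

theorem isClosed_brokenH1 : IsClosed (M.brokenH1 : Set (L2s × L2s)) := by
  rw [brokenH1, Submodule.coe_iInf]
  exact isClosed_iInter fun η => (M.testFunctional η).isClosed_ker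

instance : CompleteSpace M.Y := M.isClosed_brokenH1.completeSpace_coe

variable {M}

namespace Y

theorem hasWeakDerivOn (p : M.Y) (i : Fin (M.n + 1)) :
    HasWeakDerivOn (fun x => p.1.1 x) (fun x => p.1.2 x) (M.layer i) :=
  (M.mem_brokenH1 p.1).1 p.2 i

/-- The derivative component is determined by the function on each layer, and the interfaces form a
null set. Identities in `Y` can therefore be checked on values alone. -/
theorem ext_of_ae {p q : M.Y} (h : ∀ᵐ x, p.1.1 x = q.1.1 x) : p = q := by
  have h1 : p.1.1 = q.1.1 := Lp.ext h
  refine Subtype.ext (Prod.ext h1 (Lp.ext ?_))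
  have h2 : ∀ i, ∀ᵐ x, x ∈ M.layer i → p.1.2 x = q.1.2 x := fun i => by
    have := hasWeakDerivOn q i
    rw [← h1] at this
    exact (hasWeakDerivOn p i).ae_unique (M.isOpen_layer i) this
  filter_upwards [ae_all_iff.2 h2, M.ae_exists_mem_layer] with x hx hi
  obtain ⟨i, hi⟩ := hi
  exact hx i hi

theorem coe_add (p q : M.Y) : ∀ᵐ x, (p + q).1.1 x = p.1.1 x + q.1.1 x :=
  Lp.coeFn_add p.1.1 q.1.1

theorem coe_smul (c : ℂ) (p : M.Y) : ∀ᵐ x, (c • p).1.1 x = c * p.1.1 x :=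
  Lp.coeFn_smul c p.1.1

theorem coe_rsmul (c : ℝ) (p : M.Y) : ∀ᵐ x, (c • p).1.1 x = c * p.1.1 x :=
  (Lp.coeFn_smul c p.1.1).mono fun x hx => by
    rw [← Complex.real_smul]; exact hx

theorem coe_zero : ∀ᵐ x, (0 : M.Y).1.1 x = 0 := Lp.coeFn_zero ℂ 2 volume

theorem norm_fst_le (p : M.Y) : ‖p.1.1‖ ≤ ‖p‖ := _root_.norm_fst_le p.1

theorem norm_snd_le (p : M.Y) : ‖p.1.2‖ ≤ ‖p‖ := _root_.norm_snd_le p.1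

theorem norm_le_iff {p : M.Y} {C : ℝ} : ‖p‖ ≤ C ↔ ‖p.1.1‖ ≤ C ∧ ‖p.1.2‖ ≤ C :=
  norm_prod_le_iff

/-- Elements of the broken Sobolev space from functions. -/
theorem exists_of_memLp {f g : ℝ → ℂ} (hf : MemLp f 2 volume) (hg : MemLp g 2 volume)
    (h : ∀ i, HasWeakDerivOn f g (M.layer i)) :
    ∃ p : M.Y, (∀ᵐ x, p.1.1 x = f x) ∧ ∀ᵐ x, p.1.2 x = g x := by
  refine ⟨⟨(hf.toLp f, hg.toLp g), (M.mem_brokenH1 _).2 fun i => ?_⟩, hf.coeFn_toLp,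
    hg.coeFn_toLp⟩
  refine (h i).congr_on (M.measurableSet_layer i) ?_ ?_
  · filter_upwards [hf.coeFn_toLp] with x hx _ using hx.symm
  · filter_upwards [hg.coeFn_toLp] with x hx _ using hx.symm

/-- Elements of the broken Sobolev space from functions with values and derivatives dominated by
functions in `L²`. -/
theorem exists_of_le {f g : ℝ → ℂ} {φ ψ : L2s} {K : ℝ} (hf : AEStronglyMeasurable f volume)
    (hg : AEStronglyMeasurable g volume) (h : ∀ i, HasWeakDerivOn f g (M.layer i))
    (hfφ : ∀ᵐ x, ‖f x‖ ≤ K * ‖φ x‖) (hgψ : ∀ᵐ x, ‖g x‖ ≤ K * ‖ψ x‖) :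
    ∃ p : M.Y, (∀ᵐ x, p.1.1 x = f x) ∧ (∀ᵐ x, p.1.2 x = g x) ∧
      ‖p‖ ≤ max (K * ‖φ‖) (K * ‖ψ‖) := by
  obtain ⟨p, h1, h2⟩ := exists_of_memLp ((Lp.memLp φ).of_le_mul hf hfφ)
    ((Lp.memLp ψ).of_le_mul hg hgψ) h
  refine ⟨p, h1, h2, norm_le_iff.2 ⟨le_max_of_le_left ?_, le_max_of_le_right ?_⟩⟩
  · refine Lp.norm_le_mul_norm_of_ae_le_mul ?_
    filter_upwards [h1, hfφ] with x a b
    rw [a]; exact b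
  · refine Lp.norm_le_mul_norm_of_ae_le_mul ?_
    filter_upwards [h2, hgψ] with x a b
    rw [a]; exact b

end Y

variable (M) in
/-- The Sobolev inequality. -/
theorem exists_sobolev_bound :
    ∃ C : ℝ, 0 ≤ C ∧ ∀ p : M.Y, ∀ᵐ x, ‖p.1.1 x‖ ≤ C * ‖p‖ := by
  choose C hC using fun i => exists_ae_enorm_le_of_hasWeakDerivOn (M.ordConnected_layer i)
    (M.isOpen_layer i)
  refine ⟨2 * ∑ i, (C i : ℝ), by positivity, fun p => ?_⟩
  have h := fun i => hC i _ _ (p.hasWeakDerivOn i)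
  filter_upwards [ae_all_iff.2 h, M.ae_exists_mem_layer] with x hx hi
  obtain ⟨i, hi⟩ := hi
  have e : ∀ f : L2s, ‖f‖ ≤ ‖p‖ →
      eLpNorm f 2 (volume.restrict (M.layer i)) ≤ ENNReal.ofReal ‖p‖ := by
    intro f hf
    refine (eLpNorm_mono_measure _ Measure.restrict_le_self).trans ?_
    rw [← Lp.enorm_def, ← ofReal_norm]
    exact ENNReal.ofReal_le_ofReal hf
  have h1 := (hx i hi).trans (mul_le_mul_right (add_le_add (e _ p.norm_fst_le)
    (e _ p.norm_snd_le)) _)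
  rw [← ENNReal.ofReal_add (norm_nonneg _) (norm_nonneg _), ← ofReal_norm,
    ← ENNReal.ofReal_coe_nnreal, ← ENNReal.ofReal_mul (by positivity),
    ENNReal.ofReal_le_ofReal_iff (by positivity)] at h1
  refine h1.trans ?_
  have h2 : (C i : ℝ) ≤ ∑ i, (C i : ℝ) :=
    Finset.single_le_sum (f := fun i => (C i : ℝ)) (fun _ _ => by positivity) (Finset.mem_univ i)
  calc (C i : ℝ) * (‖p‖ + ‖p‖) ≤ (∑ i, (C i : ℝ)) * (‖p‖ + ‖p‖) := by gcongr
    _ = _ := by ring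

/-! ### Multiplication operators on the broken Sobolev space -/

/-- In the product rule (ap)' = a p' + a' p the two terms are bounded by K and `lipConst` * K times
the norm of p. -/
theorem MulBound.exists_mul {a : ℝ → ℂ} {K : ℝ} (h : M.MulBound a K) :
    ∃ T : M.Y →L[ℂ] M.Y, (∀ p, ∀ᵐ x, (T p).1.1 x = a x * p.1.1 x) ∧
      ‖T‖ ≤ (1 + lipConst) * K := by
  obtain ⟨ma, a', ma', hw, hb⟩ := h.exists_weakDeriv
  have hK := h.nonneg
  have hex : ∀ p : M.Y, ∃ q : M.Y, (∀ᵐ x, q.1.1 x = a x * p.1.1 x) ∧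
      ‖q‖ ≤ (1 + lipConst) * K * ‖p‖ := by
    intro p
    have m1 : AEStronglyMeasurable (fun x => p.1.1 x) volume := (Lp.memLp p.1.1).1
    have m2 : AEStronglyMeasurable (fun x => p.1.2 x) volume := (Lp.memLp p.1.2).1
    have f1 : MemLp (fun x => a x * p.1.1 x) 2 volume := by
      refine (Lp.memLp p.1.1).of_le_mul (c := K) (ma.mul m1) ?_
      filter_upwards [h.ae_norm_le] with x hx
      rw [norm_mul]; gcongr
    have f2 : MemLp (fun x => a x * p.1.2 x) 2 volume := by
      refine (Lp.memLp p.1.2).of_le_mul (c := K) (ma.mul m2) ?_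
      filter_upwards [h.ae_norm_le] with x hx
      rw [norm_mul]; gcongr
    have f3 : MemLp (fun x => a' x * p.1.1 x) 2 volume := by
      refine (Lp.memLp p.1.1).of_le_mul (c := lipConst * K) (ma'.mul m1) ?_
      refine Eventually.of_forall fun x => ?_
      rw [norm_mul]; gcongr; exact hb x
    have b2 : ‖f2.toLp _‖ ≤ K * ‖p.1.2‖ := by
      refine Lp.norm_le_mul_norm_of_ae_le_mul ?_
      filter_upwards [f2.coeFn_toLp, h.ae_norm_le] with x hx h2
      rw [hx, norm_mul]; gcongr
    have b3 : ‖f3.toLp _‖ ≤ lipConst * K * ‖p.1.1‖ := by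
      refine Lp.norm_le_mul_norm_of_ae_le_mul ?_
      filter_upwards [f3.coeFn_toLp] with x hx
      rw [hx, norm_mul]; gcongr; exact hb x
    obtain ⟨q, q1, q2⟩ := Y.exists_of_memLp f1 (f2.add f3) fun i =>
      (hw i).mul_on (M.ordConnected_layer i) (M.isOpen_layer i) (p.hasWeakDerivOn i)
    refine ⟨q, q1, Y.norm_le_iff.2 ⟨?_, ?_⟩⟩
    · refine (Lp.norm_le_mul_norm_of_ae_le_mul (c := K) (g := p.1.1) ?_).trans ?_
      · filter_upwards [q1, h.ae_norm_le] with x hx h2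
        rw [hx, norm_mul]; gcongr
      · have := lipConst_pos
        gcongr
        · nlinarith
        · exact p.norm_fst_le
    · have e : q.1.2 = f2.toLp _ + f3.toLp _ := by
        refine Lp.ext ?_
        filter_upwards [q2, f2.coeFn_toLp, f3.coeFn_toLp, Lp.coeFn_add (f2.toLp _) (f3.toLp _)]
          with x h1 h2 h3 h4
        rw [h1, h4, Pi.add_apply, Pi.add_apply, h2, h3]
      rw [e]
      have := lipConst_pos
      calc _ ≤ K * ‖p.1.2‖ + lipConst * K * ‖p.1.1‖ := (norm_add_le _ _).trans (add_le_add b2 b3)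
        _ ≤ K * ‖p‖ + lipConst * K * ‖p‖ := by
          gcongr
          · exact p.norm_snd_le
          · exact p.norm_fst_le
        _ = _ := by ring
  choose T hT hTn using hex
  refine ⟨LinearMap.mkContinuous ⟨⟨T, fun p q => ?_⟩, fun c p => ?_⟩ ((1 + lipConst) * K) hTn,
    hT, LinearMap.mkContinuous_norm_le _ (by have := lipConst_pos; positivity) _⟩
  · refine Y.ext_of_ae ?_
    filter_upwards [hT (p + q), hT p, hT q, Y.coe_add (T p) (T q), Y.coe_add p q]
      with x h1 h2 h3 h4 h5
    rw [h1, h4, h2, h3, h5]; ring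
  · refine Y.ext_of_ae ?_
    filter_upwards [hT (c • p), hT p, Y.coe_smul c (T p), Y.coe_smul c p] with x h1 h2 h4 h5
    change (T (c • p)).1.1 x = (c • T p).1.1 x
    rw [h1, h4, h2, h5]; ring

variable (M) in
open Classical in
/-- Multiplication by `a` on the broken Sobolev space. -/
def mulH1 (a : ℝ → ℂ) : M.Y →L[ℂ] M.Y :=
  if h : ∃ K, M.MulBound a K then h.choose_spec.exists_mul.choose else 0

theorem MulBound.coe_mulH1 {a : ℝ → ℂ} {K : ℝ} (h : M.MulBound a K) (p : M.Y) :
    ∀ᵐ x, (M.mulH1 a p).1.1 x = a x * p.1.1 x := by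
  have h' : ∃ K, M.MulBound a K := ⟨K, h⟩
  rw [mulH1, dif_pos h']
  exact h'.choose_spec.exists_mul.choose_spec.1 p

theorem MulBound.norm_mulH1_le {a : ℝ → ℂ} {K : ℝ} (h : M.MulBound a K) :
    ‖M.mulH1 a‖ ≤ (1 + lipConst) * K := by
  obtain ⟨T, hT, hn⟩ := h.exists_mul
  have : M.mulH1 a = T := by
    ext1 p
    refine Y.ext_of_ae ?_
    filter_upwards [h.coe_mulH1 p, hT p] with x h1 h2
    rw [h1, h2]
  rwa [this]

/-- Used to turn Lipschitz dependence of a coefficient on ω into Lipschitz dependence of a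
multiplication operator in operator norm. -/
theorem MulBound.norm_mulH1_sub_le {a b : ℝ → ℂ} {K K₁ K₂ : ℝ} (ha : M.MulBound a K₁)
    (hb : M.MulBound b K₂) (h : M.MulBound (fun x => a x - b x) K) :
    ‖M.mulH1 a - M.mulH1 b‖ ≤ (1 + lipConst) * K := by
  have : M.mulH1 a - M.mulH1 b = M.mulH1 (fun x => a x - b x) := by
    ext1 p
    refine Y.ext_of_ae ?_
    rw [sub_apply]
    filter_upwards [ha.coe_mulH1 p, hb.coe_mulH1 p, h.coe_mulH1 p,
      Lp.coeFn_sub (M.mulH1 a p).1.1 (M.mulH1 b p).1.1] with x h1 h2 h3 h4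
    change ((M.mulH1 a p).1.1 - (M.mulH1 b p).1.1) x = _
    rw [h4, Pi.sub_apply, h1, h2, h3]; ring
  rw [this]
  exact h.norm_mulH1_le

variable (M) in
-- The algebra property: in each of p q, p q' and p' q one factor is bounded by the Sobolev
-- inequality and the other is in L². Real bilinearity suffices, because conjugation enters the
-- cubic term anyway.
theorem exists_mulY : ∃ T : M.Y →L[ℝ] M.Y →L[ℝ] M.Y,
    ∀ p q, ∀ᵐ x, (T p q).1.1 x = p.1.1 x * q.1.1 x := by
  obtain ⟨C, hC, hs⟩ := M.exists_sobolev_bound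
  have hex : ∀ p q : M.Y, ∃ r : M.Y, (∀ᵐ x, r.1.1 x = p.1.1 x * q.1.1 x) ∧
      ‖r‖ ≤ 2 * C * ‖p‖ * ‖q‖ := by
    intro p q
    have aux : ∀ f g : L2s, (∀ᵐ x, ‖f x‖ ≤ C * ‖p‖) → ∃ r : L2s, (∀ᵐ x, r x = f x * g x) ∧
        ‖r‖ ≤ C * ‖p‖ * ‖g‖ := by
      intro f g hf
      have hb : ∀ᵐ x, ‖f x * g x‖ ≤ C * ‖p‖ * ‖g x‖ := by
        filter_upwards [hf] with x hx
        rw [norm_mul]; gcongr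
      have hm : MemLp (fun x => f x * g x) 2 volume :=
        (Lp.memLp g).of_le_mul ((Lp.memLp f).1.mul (Lp.memLp g).1) hb
      refine ⟨hm.toLp _, hm.coeFn_toLp, Lp.norm_le_mul_norm_of_ae_le_mul ?_⟩
      filter_upwards [hb, hm.coeFn_toLp] with x h1 h2
      rw [h2]; exact h1
    have aux' : ∀ f g : L2s, (∀ᵐ x, ‖f x‖ ≤ C * ‖q‖) → ∃ r : L2s, (∀ᵐ x, r x = g x * f x) ∧
        ‖r‖ ≤ C * ‖q‖ * ‖g‖ := by
      intro f g hf
      have hb : ∀ᵐ x, ‖g x * f x‖ ≤ C * ‖q‖ * ‖g x‖ := by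
        filter_upwards [hf] with x hx
        rw [norm_mul, mul_comm]; gcongr
      have hm : MemLp (fun x => g x * f x) 2 volume :=
        (Lp.memLp g).of_le_mul ((Lp.memLp g).1.mul (Lp.memLp f).1) hb
      refine ⟨hm.toLp _, hm.coeFn_toLp, Lp.norm_le_mul_norm_of_ae_le_mul ?_⟩
      filter_upwards [hb, hm.coeFn_toLp] with x h1 h2
      rw [h2]; exact h1
    obtain ⟨r, r1, r2⟩ := aux p.1.1 q.1.1 (hs p)
    obtain ⟨s, s1, s2⟩ := aux p.1.1 q.1.2 (hs p)
    obtain ⟨t, t1, t2⟩ := aux' q.1.1 p.1.2 (hs q)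
    refine ⟨⟨(r, s + t), (M.mem_brokenH1 _).2 fun i => ?_⟩, r1, Y.norm_le_iff.2 ⟨?_, ?_⟩⟩
    · refine ((p.hasWeakDerivOn i).mul_on (M.ordConnected_layer i) (M.isOpen_layer i)
        (q.hasWeakDerivOn i)).congr_on (M.measurableSet_layer i) ?_ ?_
      · filter_upwards [r1] with x hx _ using hx.symm
      · filter_upwards [s1, t1, Lp.coeFn_add s t] with x h1 h2 h3 _
        rw [h3, Pi.add_apply, h1, h2]
    · refine r2.trans ?_
      have := q.norm_fst_le
      have := norm_nonneg p
      have := norm_nonneg q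
      calc C * ‖p‖ * ‖q.1.1‖ ≤ C * ‖p‖ * ‖q‖ := by gcongr
        _ ≤ _ := by nlinarith [mul_nonneg (mul_nonneg hC (norm_nonneg p)) (norm_nonneg q)]
    · refine (norm_add_le _ _).trans ?_
      have h1 := q.norm_snd_le
      have h2 := p.norm_snd_le
      calc ‖s‖ + ‖t‖ ≤ C * ‖p‖ * ‖q.1.2‖ + C * ‖q‖ * ‖p.1.2‖ := add_le_add s2 t2
        _ ≤ C * ‖p‖ * ‖q‖ + C * ‖q‖ * ‖p‖ := by gcongr
        _ = _ := by ring
  choose T hT hTn using hex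
  refine ⟨LinearMap.mkContinuous₂ (LinearMap.mk₂ ℝ T ?_ ?_ ?_ ?_) (2 * C) hTn, hT⟩
  · intro p p' q
    refine Y.ext_of_ae ?_
    filter_upwards [hT (p + p') q, hT p q, hT p' q, Y.coe_add (T p q) (T p' q), Y.coe_add p p']
      with x h1 h2 h3 h4 h5
    rw [h1, h4, h2, h3, h5]; ring
  · intro c p q
    refine Y.ext_of_ae ?_
    filter_upwards [hT (c • p) q, hT p q, Y.coe_rsmul c (T p q), Y.coe_rsmul c p] with x h1 h2 h4 h5
    rw [h1, h4, h2, h5]; ring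
  · intro p q q'
    refine Y.ext_of_ae ?_
    filter_upwards [hT p (q + q'), hT p q, hT p q', Y.coe_add (T p q) (T p q'), Y.coe_add q q']
      with x h1 h2 h3 h4 h5
    rw [h1, h4, h2, h3, h5]; ring
  · intro c p q
    refine Y.ext_of_ae ?_
    filter_upwards [hT p (c • q), hT p q, Y.coe_rsmul c (T p q), Y.coe_rsmul c q] with x h1 h2 h4 h5
    rw [h1, h4, h2, h5]; ring

variable (M) in
/-- The product of functions in the broken Sobolev space. -/
def mulY : M.Y →L[ℝ] M.Y →L[ℝ] M.Y := M.exists_mulY.choose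

theorem coe_mulY (p q : M.Y) : ∀ᵐ x, (M.mulY p q).1.1 x = p.1.1 x * q.1.1 x :=
  M.exists_mulY.choose_spec p q

variable (M) in
theorem exists_conjY : ∃ T : M.Y →L[ℝ] M.Y, ∀ p, ∀ᵐ x, (T p).1.1 x = conj (p.1.1 x) := by
  have hex : ∀ p : M.Y, ∃ q : M.Y, (∀ᵐ x, q.1.1 x = conj (p.1.1 x)) ∧ ‖q‖ ≤ 1 * ‖p‖ := by
    intro p
    obtain ⟨q, q1, _, q3⟩ := Y.exists_of_le (M := M) (f := fun x => conj (p.1.1 x))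
      (g := fun x => conj (p.1.2 x)) (φ := p.1.1) (ψ := p.1.2) (K := 1)
      (Complex.continuous_conj.comp_aestronglyMeasurable (Lp.memLp p.1.1).1)
      (Complex.continuous_conj.comp_aestronglyMeasurable (Lp.memLp p.1.2).1)
      (fun i => (p.hasWeakDerivOn i).map_clm (Complex.conjCLE : ℂ →L[ℝ] ℂ))
      (Eventually.of_forall fun x => by simp) (Eventually.of_forall fun x => by simp)
    refine ⟨q, q1, q3.trans ?_⟩
    simp only [one_mul]
    exact max_le p.norm_fst_le p.norm_snd_le
  choose T hT hTn using hex
  refine ⟨LinearMap.mkContinuous ⟨⟨T, fun p q => ?_⟩, fun c p => ?_⟩ 1 hTn, hT⟩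
  · refine Y.ext_of_ae ?_
    filter_upwards [hT (p + q), hT p, hT q, Y.coe_add (T p) (T q), Y.coe_add p q]
      with x h1 h2 h3 h4 h5
    rw [h1, h4, h2, h3, h5, map_add]
  · refine Y.ext_of_ae ?_
    filter_upwards [hT (c • p), hT p, Y.coe_rsmul c (T p), Y.coe_rsmul c p] with x h1 h2 h4 h5
    change (T (c • p)).1.1 x = (c • T p).1.1 x
    rw [h1, h4, h2, h5]; simp

variable (M) in
/-- Complex conjugation in the broken Sobolev space. -/
def conjY : M.Y →L[ℝ] M.Y := M.exists_conjY.choose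

theorem coe_conjY (p : M.Y) : ∀ᵐ x, (M.conjY p).1.1 x = conj (p.1.1 x) :=
  M.exists_conjY.choose_spec p

end Medium

/-! ### Vector-valued functions -/

/-- The `j`-th component of a function in `L²(ℝ, ℂ³)`. -/
def compL (j : Fin 3) : L2 →L[ℂ] L2s := (EuclideanSpace.proj (𝕜 := ℂ) j : C3 →L[ℂ] ℂ).compLpL 2 volume

theorem coe_compL (j : Fin 3) (u : L2) : ∀ᵐ x, compL j u x = u x j :=
  (EuclideanSpace.proj (𝕜 := ℂ) j : C3 →L[ℂ] ℂ).coeFn_compLpL u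

/-- The function in `L²(ℝ, ℂ³)` with given components. -/
def assemble : (Fin 3 → L2s) →L[ℂ] L2 :=
  ∑ j, ((ContinuousLinearMap.toSpanSingleton ℂ (EuclideanSpace.single j (1 : ℂ) : C3)).compLpL 2
    volume).comp (ContinuousLinearMap.proj j)

theorem coe_assemble (f : Fin 3 → L2s) : ∀ᵐ x, ∀ j, assemble f x j = f j x := by
  have h : ∀ i, ∀ᵐ x, (ContinuousLinearMap.toSpanSingleton ℂ
      (EuclideanSpace.single i (1 : ℂ) : C3)).compLpL 2 volume (f i) x =
      f i x • (EuclideanSpace.single i (1 : ℂ) : C3) := fun i =>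
    ((ContinuousLinearMap.toSpanSingleton ℂ
      (EuclideanSpace.single i (1 : ℂ) : C3)).coeFn_compLpL (f i)).mono fun x hx => by
        rw [hx]; rfl
  have e : assemble f = ∑ i, (ContinuousLinearMap.toSpanSingleton ℂ
      (EuclideanSpace.single i (1 : ℂ) : C3)).compLpL 2 volume (f i) := by
    simp [assemble]
  rw [e]
  filter_upwards [ae_all_iff.2 h, Lp.coeFn_finsetSum (p := 2) (μ := volume) Finset.univ
    (fun i => (ContinuousLinearMap.toSpanSingleton ℂ
      (EuclideanSpace.single i (1 : ℂ) : C3)).compLpL 2 volume (f i))] with x hx hs j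
  rw [hs, Finset.sum_apply]
  simp only [hx]
  fin_cases j <;> simp [Fin.sum_univ_three]

theorem L2.ext_of_ae {u v : L2} (h : ∀ᵐ x, ∀ j, u x j = v x j) : u = v := by
  refine Lp.ext ?_
  filter_upwards [h] with x hx
  ext j
  exact hx j

theorem hasWeakDerivOn_of_components {f g : ℝ → C3} {I : Set ℝ}
    (hf : LocallyIntegrableOn f I) (hg : LocallyIntegrableOn g I)
    (h : ∀ j, HasWeakDerivOn (fun x => f x j) (fun x => g x j) I) : HasWeakDerivOn f g I := by
  refine ⟨hf, hg, fun η h1 h2 h3 => ?_⟩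
  have hd : Continuous (deriv η) := h1.continuous_deriv (by simp)
  have hds : tsupport (deriv η) ⊆ I :=
    (closure_minimal support_deriv_subset (isClosed_tsupport η)).trans h3
  ext j
  have e : ∀ {F : ℝ → C3}, Integrable F → (∫ x, F x) j = ∫ x, F x j := fun hF =>
    ((EuclideanSpace.proj (𝕜 := ℂ) j : C3 →L[ℂ] ℂ).integral_comp_comm hF).symm
  rw [PiLp.neg_apply, e (integrable_smul_of_tsupport_subset hf hd h2.deriv hds),
    e (integrable_smul_of_tsupport_subset hg h1.continuous h2 h3)]
  exact (h j).2.2 η h1 h2 h3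

theorem HasWeakDerivOn.component {f g : ℝ → C3} {I : Set ℝ} (h : HasWeakDerivOn f g I)
    (j : Fin 3) : HasWeakDerivOn (fun x => f x j) (fun x => g x j) I :=
  h.map_clm ((EuclideanSpace.proj (𝕜 := ℂ) j : C3 →L[ℂ] ℂ).restrictScalars ℝ)

theorem sobolevNorm_eq {f g : ℝ → C3} {I : Set ℝ} (hI' : IsOpen I) (p : ℝ≥0∞)
    (h : HasWeakDerivOn f g I) :
    sobolevNorm p f I = eLpNorm f p (volume.restrict I) + eLpNorm g p (volume.restrict I) := by
  refine le_antisymm (iInf₂_le g h) (le_iInf₂ fun g' h' => ?_)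
  have e : g =ᵐ[volume.restrict I] g' := by
    refine (ae_restrict_iff' hI'.measurableSet).2 ?_
    have := fun j => (h.component j).ae_unique hI' (h'.component j)
    filter_upwards [ae_all_iff.2 this] with x hx hxI
    ext j
    exact hx j hxI
  rw [eLpNorm_congr_ae e]

/-! ### The vector-valued broken Sobolev space and its norm -/

namespace Medium

variable (M : Medium)

/-- The broken Sobolev space of functions with values in `ℂ³`. -/
abbrev X : Type := Fin 3 → M.Y

/-- The embedding of the broken Sobolev space into `L²(ℝ, ℂ³)`. -/
def J : M.X →L[ℂ] L2 :=
  assemble.comp (ContinuousLinearMap.pi fun j => (ContinuousLinearMap.fst ℂ L2s L2s).comp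
    (M.brokenH1.subtypeL.comp (ContinuousLinearMap.proj j)))

/-- The derivative on the layers, as a function in `L²(ℝ, ℂ³)`. -/
def J' : M.X →L[ℂ] L2 :=
  assemble.comp (ContinuousLinearMap.pi fun j => (ContinuousLinearMap.snd ℂ L2s L2s).comp
    (M.brokenH1.subtypeL.comp (ContinuousLinearMap.proj j)))

variable {M}

theorem coe_J (u : M.X) : ∀ᵐ x, ∀ j, M.J u x j = (u j).1.1 x :=
  coe_assemble fun j => (u j).1.1

theorem coe_J' (u : M.X) : ∀ᵐ x, ∀ j, M.J' u x j = (u j).1.2 x :=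
  coe_assemble fun j => (u j).1.2

theorem J_injective : Function.Injective M.J := by
  intro u v h
  ext1 j
  refine Y.ext_of_ae ?_
  filter_upwards [coe_J u, coe_J v] with x h1 h2
  rw [← h1 j, ← h2 j, h]

theorem hasWeakDerivOn_J (u : M.X) (i : Fin (M.n + 1)) :
    HasWeakDerivOn (fun x => M.J u x) (fun x => M.J' u x) (M.layer i) := by
  have hl : ∀ v : L2, LocallyIntegrableOn (fun x => v x) (M.layer i) := fun v =>
    ((Lp.memLp v).locallyIntegrable (by norm_num)).locallyIntegrableOn _
  refine hasWeakDerivOn_of_components (hl _) (hl _) fun j => ?_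
  refine ((u j).hasWeakDerivOn i).congr_on (M.measurableSet_layer i) ?_ ?_
  · filter_upwards [coe_J u] with x hx _ using (hx j).symm
  · filter_upwards [coe_J' u] with x hx _ using (hx j).symm

/-- One half of the equivalence of ‖·‖ on `X` with the broken norm; `exists_J_eq` is the other half.
The factor n + 1 counts the layers. -/
theorem brokenNorm_J_le : ∃ C : ℝ, 0 ≤ C ∧ ∀ u : M.X,
    M.brokenNorm (M.J u) ≤ ENNReal.ofReal (C * ‖u‖) := by
  refine ⟨(M.n + 1) * (‖M.J‖ + ‖M.J'‖), by positivity, fun u => ?_⟩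
  have h : ∀ i, sobolevNorm 2 (fun x => M.J u x) (M.layer i) ≤
      ENNReal.ofReal ((‖M.J‖ + ‖M.J'‖) * ‖u‖) := by
    intro i
    rw [sobolevNorm_eq (M.isOpen_layer i) 2 (hasWeakDerivOn_J u i), add_mul,
      ENNReal.ofReal_add (by positivity) (by positivity)]
    have e : ∀ v : L2, eLpNorm (fun x => v x) 2 (volume.restrict (M.layer i)) ≤
        ENNReal.ofReal ‖v‖ := fun v => by
      refine (eLpNorm_mono_measure _ Measure.restrict_le_self).trans ?_
      rw [ofReal_norm, Lp.enorm_def]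
    exact add_le_add ((e _).trans (ENNReal.ofReal_le_ofReal (M.J.le_opNorm u)))
      ((e _).trans (ENNReal.ofReal_le_ofReal (M.J'.le_opNorm u)))
  refine (Finset.sum_le_sum fun i _ => h i).trans ?_
  rw [Finset.sum_const, Finset.card_univ, Fintype.card_fin, mul_assoc,
    ENNReal.ofReal_mul (p := (M.n : ℝ) + 1) (by positivity), nsmul_eq_mul]
  refine le_of_eq (congrArg (· * _) ?_)
  rw [ENNReal.ofReal_add (by positivity) (by positivity)]
  simp

/-- Functions of finite broken Sobolev norm belong to the Banach space `X`. -/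
theorem exists_J_eq {u : L2} (hu : M.brokenNorm u < ⊤) :
    ∃ v : M.X, M.J v = u ∧ ENNReal.ofReal ‖v‖ ≤ M.brokenNorm u := by
  have h1 : ∀ i, ∃ g : ℝ → C3, HasWeakDerivOn (fun x => u x) g (M.layer i) := by
    intro i
    have h := (ENNReal.sum_lt_top.1 hu) i (Finset.mem_univ i)
    simp only [sobolevNorm, iInf_lt_iff] at h
    obtain ⟨g, hg, _⟩ := h
    exact ⟨g, hg⟩
  choose g hg using h1
  have e : M.brokenNorm u = ∑ i, (eLpNorm (fun x => u x) 2 (volume.restrict (M.layer i)) +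
      eLpNorm (g i) 2 (volume.restrict (M.layer i))) :=
    Finset.sum_congr rfl fun i _ => sobolevNorm_eq (M.isOpen_layer i) 2 (hg i)
  have mg : ∀ i, AEStronglyMeasurable (g i) (volume.restrict (M.layer i)) := fun i =>
    (hg i).2.1.aestronglyMeasurable
  have mgj : ∀ j i, AEStronglyMeasurable (fun x => g i x j) (volume.restrict (M.layer i)) :=
    fun j i => (EuclideanSpace.proj (𝕜 := ℂ) j : C3 →L[ℂ] ℂ).continuous.comp_aestronglyMeasurable
      (mg i)
  have mu : AEStronglyMeasurable (fun x => u x) volume := (Lp.memLp u).1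
  have muj : ∀ j, AEStronglyMeasurable (fun x => u x j) volume :=
    fun j => (EuclideanSpace.proj (𝕜 := ℂ) j : C3 →L[ℂ] ℂ).continuous.comp_aestronglyMeasurable mu
  have hcomp : ∀ (w : ℝ → C3) (j : Fin 3) (μ : Measure ℝ),
      eLpNorm (fun x => w x j) 2 μ ≤ eLpNorm w 2 μ := fun w j μ =>
    eLpNorm_mono fun x => PiLp.norm_apply_le (w x) j
  have bu : ∀ j, eLpNorm (fun x => u x j) 2 volume ≤ M.brokenNorm u := fun j => by
    -- The global L² norm is at most the sum of the norms on the layers, which is how the broken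
    -- norm with constant 1 dominates the norm of `X`.
    refine (M.eLpNorm_le_sum _ (by norm_num) fun i => (muj j).restrict).trans ?_
    rw [e]
    exact Finset.sum_le_sum fun i _ => (hcomp _ j _).trans le_self_add
  have bg : ∀ j, eLpNorm (M.glue fun i x => g i x j) 2 volume ≤ M.brokenNorm u := fun j => by
    have hm := M.aestronglyMeasurable_glue (mgj j)
    refine (M.eLpNorm_le_sum _ (by norm_num) fun i => hm.restrict).trans ?_
    rw [e]
    refine Finset.sum_le_sum fun i _ => ?_
    refine le_trans (le_of_eq_of_le ?_ (hcomp (g i) j _)) le_add_self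
    refine eLpNorm_congr_ae ((ae_restrict_iff' (M.measurableSet_layer i)).2 ?_)
    exact Eventually.of_forall fun x hx => M.glue_apply (fun i x => g i x j) hx
  have hex : ∀ j, ∃ p : M.Y, (∀ᵐ x, p.1.1 x = u x j) ∧
      (∀ᵐ x, p.1.2 x = M.glue (fun i x => g i x j) x) := fun j =>
    Y.exists_of_memLp ⟨muj j, (bu j).trans_lt hu⟩
      ⟨M.aestronglyMeasurable_glue (mgj j), (bg j).trans_lt hu⟩ fun i =>
      ((hg i).component j).congr_on (M.measurableSet_layer i) (Eventually.of_forall fun x _ => rfl)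
        (Eventually.of_forall fun x hx => (M.glue_apply (fun i x => g i x j) hx).symm)
  choose v v1 v2 using hex
  refine ⟨v, L2.ext_of_ae ?_, ?_⟩
  · filter_upwards [coe_J v, ae_all_iff.2 v1] with x h1 h2 j
    rw [h1, h2]
  · rw [← ENNReal.ofReal_toReal hu.ne]
    refine ENNReal.ofReal_le_ofReal ((pi_norm_le_iff_of_nonneg ENNReal.toReal_nonneg).2
      fun j => Y.norm_le_iff.2 ⟨?_, ?_⟩)
    · rw [Lp.norm_def, eLpNorm_congr_ae (v1 j)]
      exact ENNReal.toReal_mono hu.ne (bu j)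
    · rw [Lp.norm_def, eLpNorm_congr_ae (v2 j)]
      exact ENNReal.toReal_mono hu.ne (bg j)

theorem brokenNorm_J_lt_top (u : M.X) : M.brokenNorm (M.J u) < ⊤ := by
  obtain ⟨C, _, h⟩ := brokenNorm_J_le (M := M)
  exact (h u).trans_lt ENNReal.ofReal_lt_top

end Medium

/-! ### Resolvents and the Riesz projection -/

section Riesz

variable {H : Type*} [NormedAddCommGroup H] [InnerProductSpace ℂ H]
variable {T : H →ₗ.[ℂ] H}

/-- Membership in the graph of an unbounded operator becomes an identity between values of a bounded
one, through which contour integrals can be pulled. It replaces the use of closedness of T. -/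
theorem IsResolventAt.mem_graph_iff {z : ℂ} {R : H →L[ℂ] H} (hR : IsResolventAt T z R) {u f : H} :
    (u, f) ∈ T.graph ↔ u = R (f - z • u) := by
  rw [LinearPMap.mem_graph_iff]
  constructor
  · rintro ⟨y, rfl, rfl⟩
    exact (hR.2 y).symm
  · intro h
    obtain ⟨y, h1, h2⟩ := hR.1 (f - z • u)
    rw [← h] at h1
    refine ⟨y, h1, ?_⟩
    rw [h1] at h2
    exact sub_left_injective h2

theorem isResolventAt_resolventOp {z : ℂ} (hz : z ∈ resolventSet T) :
    IsResolventAt T z (resolventOp T z) := by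
  rw [resolventOp, dif_pos hz]
  exact Exists.choose_spec (p := fun R => IsResolventAt T z R) hz

theorem resolventOp_mem_graph {z : ℂ} (hz : z ∈ resolventSet T) (f : H) :
    (resolventOp T z f, f + z • resolventOp T z f) ∈ T.graph := by
  rw [(isResolventAt_resolventOp hz).mem_graph_iff, add_sub_cancel_right]

/-- The resolvent identity, in the form needed for continuity of the resolvent. -/
theorem resolventOp_eq {z w : ℂ} (hz : z ∈ resolventSet T) (hw : w ∈ resolventSet T) (f : H) :
    resolventOp T z f = resolventOp T w f + (z - w) • resolventOp T w (resolventOp T z f) := by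
  have h := (isResolventAt_resolventOp hw).mem_graph_iff.1 (resolventOp_mem_graph hz f)
  rw [← map_smul, ← map_add, sub_smul]
  nth_rewrite 1 [h]
  congr 1
  abel

theorem continuousOn_resolventOp : ContinuousOn (resolventOp T) (resolventSet T) := by
  intro w hw
  set m := ‖resolventOp T w‖ with hm
  have hsub : ∀ z ∈ resolventSet T,
      ‖resolventOp T z - resolventOp T w‖ ≤ ‖z - w‖ * m * ‖resolventOp T z‖ := by
    intro z hz
    refine ContinuousLinearMap.opNorm_le_bound _ (by positivity) fun f => ?_
    rw [sub_apply, resolventOp_eq hz hw f, add_sub_cancel_left, norm_smul, mul_assoc, mul_assoc]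
    gcongr
    refine ((resolventOp T w).le_opNorm _).trans ?_
    gcongr
    exact (resolventOp T z).le_opNorm f
  have hev : ∀ᶠ z in 𝓝[resolventSet T] w, ‖z - w‖ * m ≤ 1 / 2 := by
    have : Tendsto (fun z => ‖z - w‖ * m) (𝓝[resolventSet T] w) (𝓝 (‖w - w‖ * m)) :=
      (Continuous.tendsto (by fun_prop) w).mono_left nhdsWithin_le_nhds
    rw [sub_self, norm_zero, zero_mul] at this
    exact this.eventually (ge_mem_nhds (by norm_num))
  rw [ContinuousWithinAt, tendsto_iff_norm_sub_tendsto_zero]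
  have hlim : Tendsto (fun z => ‖z - w‖ * m * (2 * m)) (𝓝[resolventSet T] w) (𝓝 0) := by
    have : Tendsto (fun z => ‖z - w‖ * m * (2 * m)) (𝓝[resolventSet T] w)
        (𝓝 (‖w - w‖ * m * (2 * m))) :=
      (Continuous.tendsto (by fun_prop) w).mono_left nhdsWithin_le_nhds
    simpa using this
  refine squeeze_zero' (Eventually.of_forall fun _ => norm_nonneg _) ?_ hlim
  filter_upwards [hev, self_mem_nhdsWithin] with z hz hzr
  have h1 := hsub z hzr
  -- The resolvent identity bounds the difference by ‖z - w‖ m ‖R(z)‖, which still contains R(z).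
  -- Once ‖z - w‖ m ≤ 1/2, that norm is absorbed and is at most 2m.
  have h2 : ‖resolventOp T z‖ ≤ 2 * m := by
    have h3 := norm_sub_norm_le (resolventOp T z) (resolventOp T w)
    nlinarith [norm_nonneg (resolventOp T z)]
  calc _ ≤ ‖z - w‖ * m * ‖resolventOp T z‖ := h1
    _ ≤ _ := by gcongr

theorem _root_.ContinuousLinearMap.circleIntegral_comp_comm {E F : Type*} [NormedAddCommGroup E]
    [NormedSpace ℂ E] [CompleteSpace E] [NormedAddCommGroup F] [NormedSpace ℂ F] [CompleteSpace F]
    (A : E →L[ℂ] F) {f : ℂ → E} {c : ℂ} {ρ : ℝ} (hf : CircleIntegrable f c ρ) :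
    A (∮ z in C(c, ρ), f z) = ∮ z in C(c, ρ), A (f z) := by
  simp only [circleIntegral, ← map_smul]
  exact (A.intervalIntegral_comp_comm hf.out).symm

/-- The mean `(2πi)⁻¹ ∮ F(z) dz` over a circle centred at the origin. -/
def circMean (ρ : ℝ) (F : ℂ → H) : H := (2 * (Real.pi : ℂ) * Complex.I)⁻¹ • ∮ z in C(0, ρ), F z

theorem circMean_add {ρ : ℝ} (hρ : 0 < ρ) {F G : ℂ → H} (hF : ContinuousOn F (Metric.sphere 0 ρ))
    (hG : ContinuousOn G (Metric.sphere 0 ρ)) :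
    circMean ρ (fun z => F z + G z) = circMean ρ F + circMean ρ G := by
  rw [circMean, circleIntegral.integral_add (hF.circleIntegrable hρ.le) (hG.circleIntegrable hρ.le),
    smul_add]
  rfl

theorem circMean_smul (ρ : ℝ) (c : ℂ) (F : ℂ → H) :
    circMean ρ (fun z => c • F z) = c • circMean ρ F := by
  rw [circMean, circleIntegral.integral_smul, smul_comm]
  rfl

theorem circMean_map [CompleteSpace H] {ρ : ℝ} (hρ : 0 < ρ) (A : H →L[ℂ] H) {F : ℂ → H}
    (hF : ContinuousOn F (Metric.sphere 0 ρ)) :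
    circMean ρ (fun z => A (F z)) = A (circMean ρ F) := by
  rw [circMean, ← A.circleIntegral_comp_comm (hF.circleIntegrable hρ.le), ← map_smul]
  rfl

theorem circMean_const [CompleteSpace H] {ρ : ℝ} (f : H) : circMean ρ (fun _ => f) = 0 := by
  have h := circleIntegral.integral_smul_const (fun _ => (1 : ℂ)) f 0 ρ
  simp only [one_smul] at h
  have h2 : (∮ _ in C(0, ρ), (1 : ℂ)) = 0 := by
    have := circleIntegral.integral_sub_zpow_of_ne (n := 0) (by norm_num) 0 0 ρ
    simpa using this
  rw [circMean, h, h2, zero_smul, smul_zero]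

theorem circMean_inv [CompleteSpace H] {ρ : ℝ} (hρ : 0 < ρ) (f : H) : circMean ρ (fun z => z⁻¹ • f) = f := by
  have h := circleIntegral.integral_sub_center_inv (0 : ℂ) hρ.ne'
  simp only [sub_zero] at h
  rw [circMean, circleIntegral.integral_smul_const, h, smul_smul, inv_mul_cancel₀, one_smul]
  simp [Real.pi_ne_zero]

theorem circMean_congr {ρ : ℝ} (hρ : 0 < ρ) {F G : ℂ → H}
    (h : ∀ z ∈ Metric.sphere (0 : ℂ) ρ, F z = G z) : circMean ρ F = circMean ρ G := by
  rw [circMean, circleIntegral.integral_congr hρ.le h]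
  rfl

/-- The decomposition provided by the Riesz projection `P`: the reduced resolvent `S`, and the part
`N` of `T` in the range of `P`. -/
theorem exists_riesz_decomposition [CompleteSpace H] (h : IsIsolatedOfFiniteMultiplicity T 0) :
    ∃ S P N : H →L[ℂ] H, (∀ f, (S f, f - P f) ∈ T.graph) ∧ (∀ f, (P f, N f) ∈ T.graph) ∧
      (∀ u f, (u, f) ∈ T.graph → S f = u - P u ∧ P f = N u) ∧
      FiniteDimensional ℂ (LinearMap.range (P : H →ₗ[ℂ] H)) := by
  obtain ⟨ρ, hρ, hres, hfin⟩ := h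
  have hsph : ∀ z ∈ Metric.sphere (0 : ℂ) ρ, z ≠ 0 ∧ z ∈ resolventSet T := by
    intro z hz
    rw [mem_sphere_iff_norm, sub_zero] at hz
    have h0 : z ≠ 0 := by
      rintro rfl
      rw [norm_zero] at hz
      exact hρ.ne hz
    exact ⟨h0, hres z h0 (by rw [sub_zero, hz])⟩
  have cR : ContinuousOn (resolventOp T) (Metric.sphere 0 ρ) :=
    continuousOn_resolventOp.mono fun z hz => (hsph z hz).2
  have cinv : ContinuousOn (fun z : ℂ => z⁻¹) (Metric.sphere 0 ρ) :=
    continuousOn_inv₀.mono fun z hz => (hsph z hz).1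
  set κ := (2 * (Real.pi : ℂ) * Complex.I)⁻¹ with hκ
  have apply_mean : ∀ {c : ℂ → ℂ}, ContinuousOn c (Metric.sphere 0 ρ) → ∀ f,
      (κ • ∮ z in C(0, ρ), c z • resolventOp T z) f =
        circMean ρ (fun z => c z • resolventOp T z f) := by
    intro c hc f
    have := (ContinuousLinearMap.apply ℂ H f).circleIntegral_comp_comm
      (f := fun z => c z • resolventOp T z) ((hc.smul cR).circleIntegrable hρ.le)
    simp only [ContinuousLinearMap.apply_apply, smul_apply] at this
    rw [smul_apply, this]
    rfl
  -- With R(z) the resolvent, S is the mean of R(z)/z, P is minus the mean of R(z), and N is minus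
  -- the mean of z R(z).
  set S : H →L[ℂ] H := κ • ∮ z in C(0, ρ), z⁻¹ • resolventOp T z with hS
  set N : H →L[ℂ] H := -(κ • ∮ z in C(0, ρ), z • resolventOp T z) with hN
  set P : H →L[ℂ] H := rieszProjection T 0 ρ with hP
  have S_apply : ∀ f, S f = circMean ρ (fun z => z⁻¹ • resolventOp T z f) := apply_mean cinv
  have N_apply : ∀ f, N f = -circMean ρ (fun z => z • resolventOp T z f) := fun f => by
    rw [hN, neg_apply]
    exact congrArg Neg.neg (apply_mean (c := fun z => z) continuousOn_id f)
  have P_apply : ∀ f, P f = -circMean ρ (fun z => resolventOp T z f) := fun f => by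
    have := apply_mean (c := fun _ => 1) continuousOn_const f
    simp only [one_smul] at this
    rw [← this, ← neg_apply, ← neg_smul]
    rfl
  have cRf : ∀ f, ContinuousOn (fun z => resolventOp T z f) (Metric.sphere 0 ρ) := fun f =>
    cR.clm_apply continuousOn_const
  -- One fixed resolvent R₁, at a point of the circle, describes the graph of T in all the
  -- computations below.
  obtain ⟨z₁, hz₁⟩ : (Metric.sphere (0 : ℂ) ρ).Nonempty := ⟨(ρ : ℂ), by simp [hρ.le]⟩
  have hR₁ := isResolventAt_resolventOp (hsph z₁ hz₁).2
  set R₁ := resolventOp T z₁ with hR₁'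
  have hu : ∀ f, ∀ z ∈ Metric.sphere (0 : ℂ) ρ, resolventOp T z f =
      R₁ (f + z • resolventOp T z f - z₁ • resolventOp T z f) := fun f z hz =>
    hR₁.mem_graph_iff.1 (resolventOp_mem_graph (hsph z hz).2 f)
  have czR : ∀ f, ContinuousOn (fun z => z • resolventOp T z f) (Metric.sphere 0 ρ) := fun f =>
    continuousOn_id.smul (cRf f)
  have ciR : ∀ f, ContinuousOn (fun z => z⁻¹ • resolventOp T z f) (Metric.sphere 0 ρ) := fun f =>
    cinv.smul (cRf f)
  have cif : ∀ f : H, ContinuousOn (fun z : ℂ => z⁻¹ • f) (Metric.sphere 0 ρ) := fun f =>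
    cinv.smul continuousOn_const
  refine ⟨S, P, N, fun f => ?_, fun f => ?_, fun u f huf => ⟨?_, ?_⟩, hfin⟩
  · rw [hR₁.mem_graph_iff]
    -- Since T R(z)f = f + z R(z)f, the function R(z)f / z is mapped by T to f/z + R(z)f, whose mean
    -- is f - P f.
    have e : f - P f - z₁ • S f = circMean ρ (fun z => z⁻¹ • f + resolventOp T z f +
        (-z₁) • z⁻¹ • resolventOp T z f) := by
      rw [circMean_add hρ ((cif f).fun_add (cRf f)) ((ciR f).fun_const_smul _),
        circMean_add hρ (cif f) (cRf f), circMean_smul, circMean_inv hρ, ← S_apply, P_apply,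
        neg_smul, sub_neg_eq_add, sub_eq_add_neg]
    rw [e, ← circMean_map hρ, S_apply]
    · refine circMean_congr hρ fun z hz => ?_
      nth_rewrite 1 [hu f z hz]
      rw [← map_smul]
      congr 1
      rw [smul_sub, smul_add, smul_smul, inv_mul_cancel₀ (hsph z hz).1, one_smul, neg_smul,
        smul_comm z⁻¹ z₁, sub_eq_add_neg]
    · exact ((cif f).add (cRf f)).add ((ciR f).const_smul _)
  · rw [hR₁.mem_graph_iff]
    have e : N f - z₁ • P f = -circMean ρ (fun z => f + z • resolventOp T z f +
        (-z₁) • resolventOp T z f) := by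
      rw [circMean_add hρ (continuousOn_const.fun_add (czR f)) ((cRf f).fun_const_smul _),
        circMean_add hρ continuousOn_const (czR f), circMean_smul, circMean_const, N_apply, P_apply]
      simp only [smul_neg, neg_smul, zero_add]
      abel
    rw [e, map_neg, ← circMean_map hρ, P_apply]
    · congr 1
      refine circMean_congr hρ fun z hz => ?_
      nth_rewrite 1 [hu f z hz]
      rw [neg_smul, sub_eq_add_neg]
    · exact (continuousOn_const.add (czR f)).add ((cRf f).const_smul _)
  -- For T u = f the resolvent satisfies R(z)f = u + z R(z)u. Dividing by z and taking means gives S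
  -- f = u - P u; taking means directly gives P f = N u.
  · have h1 : ∀ z ∈ Metric.sphere (0 : ℂ) ρ, resolventOp T z f = u + z • resolventOp T z u := by
      intro z hz
      have h2 := (isResolventAt_resolventOp (hsph z hz).2).mem_graph_iff.1 huf
      rw [map_sub, map_smul] at h2
      nth_rewrite 1 [h2]
      abel
    rw [S_apply, P_apply, sub_neg_eq_add]
    have e : circMean ρ (fun z => z⁻¹ • u + resolventOp T z u) =
        u + circMean ρ (fun z => resolventOp T z u) := by
      rw [circMean_add hρ (cif u) (cRf u), circMean_inv hρ]
    rw [← e]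
    refine circMean_congr hρ fun z hz => ?_
    rw [h1 z hz, smul_add, smul_smul, inv_mul_cancel₀ (hsph z hz).1, one_smul]
  · have h1 : ∀ z ∈ Metric.sphere (0 : ℂ) ρ, resolventOp T z f = u + z • resolventOp T z u := by
      intro z hz
      have h2 := (isResolventAt_resolventOp (hsph z hz).2).mem_graph_iff.1 huf
      rw [map_sub, map_smul] at h2
      nth_rewrite 1 [h2]
      abel
    rw [P_apply, N_apply, circMean_congr hρ h1, circMean_add hρ continuousOn_const (czR u),
      circMean_const, zero_add]

/-- The generalized inverse of `T` at an isolated simple eigenvalue `0`, with values in the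
complement of the eigenvector given by the eigenvector of the adjoint. -/
theorem exists_generalized_inverse [CompleteSpace H] (h : IsIsolatedOfFiniteMultiplicity T 0)
    (hd : Dense (T.domain : Set H)) {φ₀ φs : H} (h₀ : (φ₀, (0 : H)) ∈ T.graph)
    (hker : ∀ u, (u, (0 : H)) ∈ T.graph → ∃ c : ℂ, u = c • φ₀)
    (hsimple : ∀ u, (u, φ₀) ∉ T.graph)
    (hs : ∀ u f, (u, f) ∈ T.graph → inner ℂ φs f = 0) (hn : inner ℂ φs φ₀ = 1) :
    ∃ K : H →L[ℂ] H, (∀ f, (K f, f - inner ℂ φs f • φ₀) ∈ T.graph ∧ inner ℂ φs (K f) = 0) ∧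
      ∀ u f, (u, f) ∈ T.graph → inner ℂ φs u = 0 → u = K f := by
  obtain ⟨S, P, N, hS, hPN, hcomm, hfin⟩ := exists_riesz_decomposition h
  set F := LinearMap.range (P : H →ₗ[ℂ] H) with hF
  -- The image of the dense domain under P is dense in the range of P and, being finite-dimensional,
  -- closed. Hence it is the whole range, and T maps F to itself because T P d = N d = P T d for d
  -- in the domain.
  have hFD : F = T.domain.map (P : H →ₗ[ℂ] H) := by
    refine le_antisymm ?_ (LinearMap.map_le_range)
    have : FiniteDimensional ℂ (T.domain.map (P : H →ₗ[ℂ] H)) :=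
      Submodule.finiteDimensional_of_le (LinearMap.map_le_range (f := (P : H →ₗ[ℂ] H)))
    have hc : IsClosed ((T.domain.map (P : H →ₗ[ℂ] H) : Submodule ℂ H) : Set H) :=
      Submodule.closed_of_finiteDimensional _
    rintro _ ⟨g, rfl⟩
    have h1 : P g ∈ closure (P '' (T.domain : Set H)) :=
      image_closure_subset_closure_image P.continuous ⟨g, hd g, rfl⟩
    have h2 : closure (P '' (T.domain : Set H)) ⊆
        ((T.domain.map (P : H →ₗ[ℂ] H) : Submodule ℂ H) : Set H) :=
      closure_minimal (fun x hx => hx) hc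
    exact h2 h1
  have hFT : ∀ u ∈ F, ∃ f ∈ F, (u, f) ∈ T.graph := by
    intro u hu
    rw [hFD] at hu
    obtain ⟨d, hd', rfl⟩ := hu
    obtain ⟨f, hf⟩ := LinearPMap.mem_domain_iff.1 hd'
    refine ⟨P f, ⟨f, rfl⟩, ?_⟩
    rw [(hcomm d f hf).2]
    exact hPN d
  have hFle : F ≤ T.domain := fun u hu => by
    obtain ⟨f, _, hf⟩ := hFT u hu
    exact LinearPMap.mem_domain_of_mem_graph hf
  have hφ₀F : φ₀ ∈ F := by
    have h1 := (hcomm φ₀ 0 h₀).1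
    rw [map_zero] at h1
    exact ⟨φ₀, (sub_eq_zero.1 h1.symm).symm⟩
  -- The rank-one term ⟨·, φs⟩φ₀ removes the kernel of T on F, so that T becomes invertible on this
  -- finite-dimensional space up to a multiple of φ₀.
  let A : F →ₗ[ℂ] H := T.toFun.comp (Submodule.inclusion hFle) +
    ((innerSL ℂ φs : H →ₗ[ℂ] ℂ).smulRight φ₀).comp F.subtype
  have hA : ∀ u : F, A u = T ⟨u, hFle u.2⟩ + inner ℂ φs (u : H) • φ₀ := fun u => rfl
  have hAF : ∀ u : F, A u ∈ F := by
    intro u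
    rw [hA]
    refine F.add_mem ?_ (F.smul_mem _ hφ₀F)
    obtain ⟨f, hf, hg⟩ := hFT u u.2
    obtain ⟨y, h1, h2⟩ := (LinearPMap.mem_graph_iff _).1 hg
    have : y = ⟨u, hFle u.2⟩ := Subtype.ext h1
    rw [← this, h2]
    exact hf
  let A' : F →ₗ[ℂ] F := A.codRestrict F hAF
  have hinj : Function.Injective A' := by
    rw [injective_iff_map_eq_zero]
    intro u hu
    have h1 : T ⟨u, hFle u.2⟩ + inner ℂ φs (u : H) • φ₀ = 0 := by
      rw [← hA]; exact congrArg Subtype.val hu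
    have hg := LinearPMap.mem_graph T ⟨(u : H), hFle u.2⟩
    have hc : inner ℂ φs (u : H) = 0 := by
      -- If A u = 0 with ⟨u, φs⟩ ≠ 0, then a multiple of u would be mapped to φ₀ by T, against
      -- algebraic simplicity. Otherwise T u = 0, and u is a multiple of φ₀ with zero pairing.
      by_contra hne
      refine hsimple ((-(inner ℂ φs (u : H))⁻¹) • (u : H)) ?_
      have h2 := T.graph.smul_mem (-(inner ℂ φs (u : H))⁻¹) hg
      rw [eq_neg_of_add_eq_zero_left h1, Prod.smul_mk, smul_neg, neg_smul, neg_smul, neg_neg,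
        smul_smul, inv_mul_cancel₀ hne, one_smul] at h2
      rw [neg_smul]
      exact h2
    rw [hc, zero_smul, add_zero] at h1
    rw [h1] at hg
    obtain ⟨c, hc'⟩ := hker _ hg
    simp only at hc'
    rw [hc', inner_smul_right, hn, mul_one] at hc
    rw [hc, zero_smul] at hc'
    exact Subtype.ext hc'
  let e : F ≃ₗ[ℂ] F := LinearEquiv.ofInjectiveEndo A' hinj
  let W : F →L[ℂ] F := LinearMap.toContinuousLinearMap (e.symm : F →ₗ[ℂ] F)
  have hW : ∀ f : F, ((W f : H), (f : H) - inner ℂ φs (W f : H) • φ₀) ∈ T.graph := by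
    intro f
    have h1 : A' (W f) = f := e.apply_symm_apply f
    have h2 : T ⟨W f, hFle (W f).2⟩ + inner ℂ φs (W f : H) • φ₀ = f := by
      rw [← hA]; exact congrArg Subtype.val h1
    rw [← h2, add_sub_cancel_right]
    exact LinearPMap.mem_graph T ⟨(W f : H), hFle (W f).2⟩
  let P' : H →L[ℂ] F := P.codRestrict F fun f => ⟨f, rfl⟩
  -- S inverts T on f - P f, and W inverts it on P f modulo φ₀. K then subtracts the component of B
  -- f along φ₀.
  let B : H →L[ℂ] H := S + F.subtypeL.comp (W.comp P')
  let K : H →L[ℂ] H := B - ((innerSL ℂ φs).smulRight φ₀).comp B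
  have hB : ∀ f, ∃ c : ℂ, (B f, f - c • φ₀) ∈ T.graph := by
    intro f
    refine ⟨inner ℂ φs (W (P' f) : H), ?_⟩
    have h1 := T.graph.add_mem (hS f) (hW (P' f))
    rw [Prod.mk_add_mk] at h1
    have h2 : f - P f + ((P' f : H) - inner ℂ φs (W (P' f) : H) • φ₀) =
        f - inner ℂ φs (W (P' f) : H) • φ₀ := by
      change f - P f + (P f - _) = _
      abel
    rw [h2] at h1
    exact h1
  have hK : ∀ f, (K f, f - inner ℂ φs f • φ₀) ∈ T.graph ∧ inner ℂ φs (K f) = 0 := by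
    intro f
    have e1 : K f = B f + (-inner ℂ φs (B f)) • φ₀ := by
      simp [K, sub_eq_add_neg]
    obtain ⟨c, hc⟩ := hB f
    -- Pairing T B f = f - c φ₀ with φs annihilates the left side and identifies c as ⟨f, φs⟩.
    have h1 := hs _ _ hc
    rw [inner_sub_right, inner_smul_right, hn, mul_one, sub_eq_zero] at h1
    rw [← h1] at hc
    constructor
    · have := T.graph.add_mem hc (T.graph.smul_mem (-inner ℂ φs (B f)) h₀)
      rw [Prod.smul_mk, Prod.mk_add_mk, smul_zero, add_zero, ← e1] at this
      exact this
    · rw [e1, inner_add_right, inner_smul_right, hn]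
      ring
  refine ⟨K, hK, fun u f huf hu => ?_⟩
  have h1 := (hK f).1
  rw [hs u f huf, zero_smul, sub_zero] at h1
  have h2 := T.graph.sub_mem huf h1
  rw [Prod.mk_sub_mk, sub_self] at h2
  obtain ⟨c, hc⟩ := hker _ h2
  have h3 : inner ℂ φs (u - K f) = 0 := by rw [inner_sub_right, hu, (hK f).2, sub_zero]
  rw [hc, inner_smul_right, hn, mul_one] at h3
  rw [h3, zero_smul] at hc
  exact sub_eq_zero.1 hc

end Riesz

/-! ### Local Lipschitz continuity at a point -/

/-- `f` is Lipschitz continuous in a neighbourhood of `x`. -/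
def LipAt {E F : Type*} [PseudoEMetricSpace E] [PseudoEMetricSpace F] (f : E → F) (x : E) : Prop :=
  ∃ K : NNReal, ∃ s ∈ 𝓝 x, LipschitzOnWith K f s

namespace LipAt

variable {E F G : Type*} [PseudoEMetricSpace E] [PseudoEMetricSpace F] [PseudoEMetricSpace G]

theorem continuousAt {f : E → F} {x : E} (h : LipAt f x) : ContinuousAt f x := by
  obtain ⟨K, s, hs, h⟩ := h
  exact h.continuousOn.continuousAt hs

theorem comp {g : F → G} {f : E → F} {x : E} (hg : LipAt g (f x)) (hf : LipAt f x) :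
    LipAt (fun y => g (f y)) x := by
  have hc := hf.continuousAt
  obtain ⟨K, s, hs, hf⟩ := hf
  obtain ⟨K', t, ht, hg⟩ := hg
  refine ⟨K' * K, s ∩ f ⁻¹' t, inter_mem hs (hc ht), ?_⟩
  exact hg.comp (hf.mono inter_subset_left) fun y hy => hy.2

theorem prodMk {f : E → F} {g : E → G} {x : E} (hf : LipAt f x) (hg : LipAt g x) :
    LipAt (fun y => (f y, g y)) x := by
  obtain ⟨K, s, hs, hf⟩ := hf
  obtain ⟨K', t, ht, hg⟩ := hg
  exact ⟨max K K', s ∩ t, inter_mem hs ht,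
    (hf.mono inter_subset_left).prodMk (hg.mono inter_subset_right)⟩

theorem const' (c : F) (x : E) : LipAt (fun _ : E => c) x :=
  ⟨0, univ, univ_mem, (LipschitzWith.const c).lipschitzOnWith⟩

theorem fst' (x : E × F) : LipAt (fun y : E × F => y.1) x :=
  ⟨1, univ, univ_mem, LipschitzWith.prod_fst.lipschitzOnWith⟩

theorem snd' (x : E × F) : LipAt (fun y : E × F => y.2) x :=
  ⟨1, univ, univ_mem, LipschitzWith.prod_snd.lipschitzOnWith⟩

end LipAt

theorem LipAt.of_contDiffAt {𝕜 E F : Type*} [RCLike 𝕜] [NormedAddCommGroup E] [NormedSpace 𝕜 E]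
    [NormedAddCommGroup F] [NormedSpace 𝕜 F] {f : E → F} {x : E} (h : ContDiffAt 𝕜 1 f x) :
    LipAt f x := h.exists_lipschitzOnWith

namespace LipAt

variable {E X X' : Type*} [PseudoEMetricSpace E] [NormedAddCommGroup X] [NormedSpace ℂ X]
  [NormedAddCommGroup X'] [NormedSpace ℂ X'] {x : E}

theorem add {f g : E → X} (hf : LipAt f x) (hg : LipAt g x) : LipAt (fun y => f y + g y) x :=
  LipAt.comp (g := fun r : X × X => r.1 + r.2) (f := fun y => (f y, g y))
    (LipAt.of_contDiffAt (𝕜 := ℂ) (contDiff_add.contDiffAt)) (hf.prodMk hg)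

theorem clm_apply {f : E → X →L[ℂ] X'} {g : E → X} (hf : LipAt f x) (hg : LipAt g x) :
    LipAt (fun y => f y (g y)) x :=
  LipAt.comp (g := fun r : (X →L[ℂ] X') × X => r.1 r.2) (f := fun y => (f y, g y))
    (LipAt.of_contDiffAt (𝕜 := ℂ) (contDiff_fst.clm_apply contDiff_snd).contDiffAt)
    (hf.prodMk hg)

theorem smul {f : E → ℂ} {g : E → X} (hf : LipAt f x) (hg : LipAt g x) :
    LipAt (fun y => f y • g y) x :=
  LipAt.comp (g := fun r : ℂ × X => r.1 • r.2) (f := fun y => (f y, g y))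
    (LipAt.of_contDiffAt (𝕜 := ℂ) (contDiff_fst.smul contDiff_snd).contDiffAt) (hf.prodMk hg)

theorem div {f g : E → ℂ} (hf : LipAt f x) (hg : LipAt g x) (h : g x ≠ 0) :
    LipAt (fun y => f y / g y) x :=
  LipAt.comp (g := fun r : ℂ × ℂ => r.1 / r.2) (f := fun y => (f y, g y))
    (LipAt.of_contDiffAt (𝕜 := ℂ) (contDiffAt_fst.div contDiffAt_snd h)) (hf.prodMk hg)

end LipAt

/-! ### The branch of small fixed points of `ε F` -/

/-- Banach's fixed point theorem for ε F. The last clause holds because the fixed point is the limit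
of the iterates of 0; it later transfers symmetries of F to the branch. -/
theorem exists_fixedPoint_branch {E : Type*} [NormedAddCommGroup E] [NormedSpace ℂ E]
    [CompleteSpace E] {F : E → E} {ρ : ℝ} {Λ : NNReal} (hρ : 0 < ρ)
    (hF : LipschitzOnWith Λ F (Metric.closedBall 0 ρ)) :
    ∃ ε₁ C : ℝ, 0 < ε₁ ∧ 0 ≤ C ∧ ∃ p : ℝ → E, ∀ ε ∈ Ioo 0 ε₁,
      p ε = (ε : ℂ) • F (p ε) ∧ ‖p ε‖ ≤ ρ ∧ ‖p ε‖ ≤ C * ε ∧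
      (∀ q, ‖q‖ ≤ ρ → q = (ε : ℂ) • F q → q = p ε) ∧ ‖p ε - (ε : ℂ) • F 0‖ ≤ C * ε ^ 2 ∧
      (∀ t ∈ Ioo 0 ε₁, ‖p t - p ε‖ ≤ C * |t - ε|) ∧
      ∀ S : Set E, IsClosed S → 0 ∈ S → (∀ q ∈ S, ‖q‖ ≤ ρ → (ε : ℂ) • F q ∈ S) → p ε ∈ S := by
  have hlip : ∀ q q', ‖q‖ ≤ ρ → ‖q'‖ ≤ ρ → ‖F q - F q'‖ ≤ Λ * ‖q - q'‖ := fun q q' h h' => by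
    have := hF.dist_le_mul q (by simpa using h) q' (by simpa using h')
    rwa [dist_eq_norm, dist_eq_norm] at this
  set m : ℝ := ‖F 0‖ + Λ * ρ with hm
  have hm0 : 0 ≤ m := by positivity
  have hbd : ∀ q, ‖q‖ ≤ ρ → ‖F q‖ ≤ m := fun q hq => by
    have h1 := hlip q 0 hq (by simpa using hρ.le)
    rw [sub_zero] at h1
    have h2 := norm_sub_norm_le (F q) (F 0)
    have h3 : (Λ : ℝ) * ‖q‖ ≤ Λ * ρ := by gcongr
    linarith
  -- The first bound makes ε F map the ball to itself, the second makes its Lipschitz constant at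
  -- most 1/2.
  set ε₁ : ℝ := min (ρ / (m + 1)) (1 / (2 * (Λ + 1))) with hε₁
  have hε₁0 : 0 < ε₁ := by positivity
  have small : ∀ ε ∈ Ioo 0 ε₁, ε * m ≤ ρ ∧ ε * Λ ≤ 1 / 2 := by
    intro ε hε
    have h1 : ε ≤ ρ / (m + 1) := hε.2.le.trans (min_le_left _ _)
    have h2 : ε ≤ 1 / (2 * (Λ + 1)) := hε.2.le.trans (min_le_right _ _)
    rw [le_div_iff₀ (by positivity)] at h1 h2
    have := hε.1
    constructor <;> nlinarith [Λ.2]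
  have norm_ε : ∀ ε ∈ Ioo 0 ε₁, ‖(ε : ℂ)‖ = ε := fun ε hε => by
    rw [Complex.norm_real, Real.norm_of_nonneg hε.1.le]
  have hex : ∀ ε ∈ Ioo 0 ε₁, ∃ p : E, p = (ε : ℂ) • F p ∧ ‖p‖ ≤ ρ ∧
      ∀ S : Set E, IsClosed S → 0 ∈ S → (∀ q ∈ S, ‖q‖ ≤ ρ → (ε : ℂ) • F q ∈ S) → p ∈ S := by
    intro ε hε
    obtain ⟨s1, s2⟩ := small ε hε
    set f : E → E := fun q => (ε : ℂ) • F q with hf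
    have hmaps : MapsTo f (Metric.closedBall 0 ρ) (Metric.closedBall 0 ρ) := by
      intro q hq
      rw [mem_closedBall_zero_iff] at hq ⊢
      rw [hf, norm_smul, norm_ε ε hε]
      exact (mul_le_mul_of_nonneg_left (hbd q hq) hε.1.le).trans s1
    have hcontr : ContractingWith (1 / 2) (hmaps.restrict f _ _) := by
      refine ⟨by norm_num, LipschitzWith.of_dist_le_mul fun q q' => ?_⟩
      rw [Subtype.dist_eq, Subtype.dist_eq, dist_eq_norm, dist_eq_norm]
      have h1 := hlip q q' (mem_closedBall_zero_iff.1 q.2) (mem_closedBall_zero_iff.1 q'.2)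
      change ‖(ε : ℂ) • F q - (ε : ℂ) • F q'‖ ≤ _
      rw [← smul_sub, norm_smul, norm_ε ε hε]
      calc ε * ‖F q - F q'‖ ≤ ε * (Λ * ‖(q : E) - q'‖) := by gcongr; exact hε.1.le
        _ = (ε * Λ) * ‖(q : E) - q'‖ := by ring
        _ ≤ 1 / 2 * ‖(q : E) - q'‖ := by gcongr
        _ = _ := by simp
    obtain ⟨p, hp, hfix, htend, _⟩ := hcontr.exists_fixedPoint'
      Metric.isClosed_closedBall.isComplete hmaps (x := 0) (by simpa using hρ.le) (edist_ne_top _ _)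
    refine ⟨p, hfix.symm, by simpa using hp, fun S hS h0 hSF => ?_⟩
    refine hS.mem_of_tendsto htend (Eventually.of_forall fun n => ?_)
    have : f^[n] 0 ∈ S ∧ ‖f^[n] 0‖ ≤ ρ := by
      induction n with
      | zero => exact ⟨h0, by simpa using hρ.le⟩
      | succ n ih =>
        rw [Function.iterate_succ_apply']
        exact ⟨hSF _ ih.1 ih.2, by simpa using hmaps (by simpa using ih.2)⟩
    exact this.1
  choose! p hp hpρ hpS using hex
  have hpm : ∀ ε ∈ Ioo 0 ε₁, ‖p ε‖ ≤ ε * m := fun ε hε => by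
    rw [hp ε hε, norm_smul, norm_ε ε hε]
    exact mul_le_mul_of_nonneg_left (hbd _ (hpρ ε hε)) hε.1.le
  -- Here 2m is the Lipschitz constant of the branch in ε, after absorbing half of the difference; Λ
  -- m comes from ε‖F(p) - F(0)‖ ≤ ε Λ‖p‖ with ‖p‖ ≤ ε m.
  refine ⟨ε₁, 2 * m + Λ * m, hε₁0, by positivity, p, fun ε hε => ⟨hp ε hε, hpρ ε hε, ?_, ?_, ?_,
    ?_, hpS ε hε⟩⟩
  · have := hpm ε hε
    have h2 : 0 ≤ (Λ : ℝ) * m := by positivity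
    nlinarith [hε.1]
  · intro q hq hfix
    obtain ⟨_, s2⟩ := small ε hε
    have h1 : ‖q - p ε‖ ≤ 1 / 2 * ‖q - p ε‖ := by
      nth_rewrite 1 [hfix, hp ε hε]
      rw [← smul_sub, norm_smul, norm_ε ε hε]
      calc ε * ‖F q - F (p ε)‖ ≤ ε * (Λ * ‖q - p ε‖) :=
            mul_le_mul_of_nonneg_left (hlip _ _ hq (hpρ ε hε)) hε.1.le
        _ = (ε * Λ) * ‖q - p ε‖ := by ring
        _ ≤ _ := by gcongr
    have h2 : ‖q - p ε‖ ≤ 0 := by linarith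
    exact sub_eq_zero.1 (norm_le_zero_iff.1 h2)
  · nth_rewrite 1 [hp ε hε]
    rw [← smul_sub, norm_smul, norm_ε ε hε]
    have h1 := hlip (p ε) 0 (hpρ ε hε) (by simpa using hρ.le)
    rw [sub_zero] at h1
    have h2 : (Λ : ℝ) * ‖p ε‖ ≤ Λ * (ε * m) := by gcongr; exact hpm ε hε
    have h3 : ε * ‖F (p ε) - F 0‖ ≤ ε * (Λ * (ε * m)) :=
      mul_le_mul_of_nonneg_left (h1.trans h2) hε.1.le
    have h4 : 0 ≤ m * ε ^ 2 := by positivity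
    nlinarith
  · intro t ht
    obtain ⟨_, s2⟩ := small ε hε
    have e : p t - p ε = ((t - ε : ℝ) : ℂ) • F (p t) + (ε : ℂ) • (F (p t) - F (p ε)) := by
      nth_rewrite 1 [hp t ht, hp ε hε]
      rw [Complex.ofReal_sub, sub_smul, smul_sub]
      abel
    have h1 : ‖p t - p ε‖ ≤ |t - ε| * m + 1 / 2 * ‖p t - p ε‖ := by
      nth_rewrite 1 [e]
      refine (norm_add_le _ _).trans (add_le_add ?_ ?_)
      · rw [norm_smul, Complex.norm_real, Real.norm_eq_abs]
        gcongr
        exact hbd _ (hpρ t ht)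
      · rw [norm_smul, norm_ε ε hε]
        calc ε * ‖F (p t) - F (p ε)‖ ≤ ε * (Λ * ‖p t - p ε‖) :=
              mul_le_mul_of_nonneg_left (hlip _ _ (hpρ t ht) (hpρ ε hε)) hε.1.le
          _ = (ε * Λ) * ‖p t - p ε‖ := by ring
          _ ≤ _ := by gcongr
    have h2 : 0 ≤ (Λ : ℝ) * m * |t - ε| := by positivity
    nlinarith

/-! ### Bifurcation from a simple eigenvalue with a cubic nonlinearity -/

section Bifurcation

variable {X : Type*} [NormedAddCommGroup X] [NormedSpace ℂ X]

/-- The Lyapunov–Schmidt form of the equation for `x`, at distance `z` of the frequency from the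
eigenvalue. -/
def ReducedSolution (ℓ : X →L[ℂ] ℂ) (K : X →L[ℂ] X) (Φ : X) (D : ℂ → X →L[ℂ] X) (h : ℂ → X → X)
    (z : ℂ) (x : X) : Prop :=
  ℓ (h z x + z • D z x) = 0 ∧ x = ℓ x • Φ + K (h z x + z • D z x)

/-- The map of which the small solutions are the fixed points, after scaling. -/
def reducedMap (ℓ : X →L[ℂ] ℂ) (K : X →L[ℂ] X) (Φ : X) (D : ℂ → X →L[ℂ] X) (h : ℂ → X → X)
    (q : ℂ × X) : ℂ × X :=
  (-ℓ (h q.1 (Φ + q.2)) / ℓ (D q.1 (Φ + q.2)),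
    K ((-ℓ (h q.1 (Φ + q.2)) / ℓ (D q.1 (Φ + q.2))) • D q.1 (Φ + q.2) + h q.1 (Φ + q.2)))

variable {ℓ : X →L[ℂ] ℂ} {K : X →L[ℂ] X} {Φ : X} {D : ℂ → X →L[ℂ] X} {h : ℂ → X → X}

theorem lipAt_reducedMap (hD : LipAt D 0) (hh : LipAt (fun q : ℂ × X => h q.1 q.2) (0, Φ))
    (hDΦ : ℓ (D 0 Φ) ≠ 0) : LipAt (reducedMap ℓ K Φ D h) 0 := by
  have l1 : LipAt (fun q : ℂ × X => q.1) 0 := LipAt.fst' _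
  have l2 : LipAt (fun q : ℂ × X => Φ + q.2) 0 := (LipAt.const' _ _).add (LipAt.snd' _)
  have l3 : LipAt (fun q : ℂ × X => h q.1 (Φ + q.2)) 0 :=
    LipAt.comp (g := fun q : ℂ × X => h q.1 q.2) (f := fun q : ℂ × X => (q.1, Φ + q.2))
      (by simpa using hh) (l1.prodMk l2)
  have l4 : LipAt (fun q : ℂ × X => D q.1) 0 :=
    LipAt.comp (g := D) (f := fun q : ℂ × X => q.1) (by simpa using hD) l1
  have l5 : LipAt (fun q : ℂ × X => D q.1 (Φ + q.2)) 0 := l4.clm_apply l2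
  have l6 : LipAt (fun q : ℂ × X => -ℓ (h q.1 (Φ + q.2)) / ℓ (D q.1 (Φ + q.2))) 0 :=
    ((LipAt.const' (-ℓ) _).clm_apply l3).div ((LipAt.const' ℓ _).clm_apply l5) (by simpa using hDΦ)
  exact l6.prodMk ((LipAt.const' K _).clm_apply ((l6.smul l5).add l3))

/-- Gauge invariance: |c|²c = c on the unit circle, so both terms of the equation are multiplied by
c. -/
theorem ReducedSolution.smul (hom : ∀ (c : ℂ) z x, h z (c • x) = (((‖c‖ ^ 2 : ℝ) : ℂ) * c) • h z x)
    {z : ℂ} {x : X} (hs : ReducedSolution ℓ K Φ D h z x) {c : ℂ} (hc : ‖c‖ = 1) :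
    ReducedSolution ℓ K Φ D h z (c • x) := by
  have e : h z (c • x) + z • D z (c • x) = c • (h z x + z • D z x) := by
    rw [hom, hc, map_smul, smul_add, smul_comm z c]
    simp
  refine ⟨by rw [e, map_smul, hs.1, smul_zero], ?_⟩
  rw [e, map_smul, map_smul, smul_assoc, ← smul_add, ← hs.2]

/-- The Lipschitz bound holds on a fixed ball only. Homogeneity carries it over: x is rescaled to
norm η/2 and the factor t³ is divided out. -/
theorem exists_bound_cubic (hom : ∀ (c : ℂ) z x, h z (c • x) = (((‖c‖ ^ 2 : ℝ) : ℂ) * c) • h z x)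
    (hh : LipAt (fun q : ℂ × X => h q.1 q.2) (0, 0)) :
    ∃ C η : ℝ, 0 ≤ C ∧ 0 < η ∧ ∀ z x, ‖z‖ < η → ‖h z x‖ ≤ C * ‖x‖ ^ 3 := by
  obtain ⟨L, s, hs, hL⟩ := hh
  obtain ⟨η, hη, hb⟩ := Metric.mem_nhds_iff.1 hs
  have h0 : ∀ z, h z 0 = 0 := fun z => by
    have := hom 0 z 0
    simpa using this
  refine ⟨4 * L / η ^ 2, η, by positivity, hη, fun z x hz => ?_⟩
  rcases eq_or_ne x 0 with rfl | hx
  · simp [h0]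
  have hx' : 0 < ‖x‖ := norm_pos_iff.2 hx
  set t : ℝ := η / (2 * ‖x‖) with ht
  have ht0 : 0 < t := by positivity
  have htn : ‖(t : ℂ)‖ = t := by rw [Complex.norm_real, Real.norm_of_nonneg ht0.le]
  have htx : ‖(t : ℂ) • x‖ = η / 2 := by
    rw [norm_smul, htn, ht]; field_simp
  have hmem : ∀ w : X, ‖w‖ < η → ((z, w) : ℂ × X) ∈ s := fun w hw => hb (by
    rw [Metric.mem_ball, dist_eq_norm, Prod.norm_def]
    simpa using ⟨hz, hw⟩)
  have h1 := hL.dist_le_mul (z, (t : ℂ) • x) (hmem _ (by rw [htx]; linarith)) (z, 0)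
    (hmem _ (by simpa using hη))
  have h2 : dist ((z, (t : ℂ) • x) : ℂ × X) (z, 0) = η / 2 := by
    rw [dist_eq_norm, Prod.mk_sub_mk, sub_self, sub_zero, Prod.norm_def, norm_zero, htx]
    exact max_eq_right (by positivity)
  rw [h2] at h1
  simp only [h0, dist_zero_right, hom, norm_smul, norm_mul, htn, Complex.norm_real] at h1
  rw [Real.norm_of_nonneg (by positivity)] at h1
  have h3 : ‖h z x‖ ≤ (L * (η / 2)) / (t ^ 2 * t) := by
    rw [le_div_iff₀ (by positivity)]
    linarith
  refine h3.trans (le_of_eq ?_)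
  rw [ht]; field_simp; ring

/-- With x = s(Φ + y), the term h gains a factor s³ and the linear term a factor s. After division
by s only ε = s² remains; the scalar equation determines z, and the other one then determines y. -/
theorem reducedSolution_iff (hom : ∀ (c : ℂ) z x, h z (c • x) = (((‖c‖ ^ 2 : ℝ) : ℂ) * c) • h z x)
    (hΦ : ℓ Φ = 1) {s : ℝ} (hs : 0 < s) {z : ℂ} {y : X}
    (hne : ℓ (D z (Φ + y)) ≠ 0) (hy : ℓ y = 0) :
    ReducedSolution ℓ K Φ D h z ((s : ℂ) • (Φ + y)) ↔
      (z, y) = ((s ^ 2 : ℝ) : ℂ) • reducedMap ℓ K Φ D h (z, y) := by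
  set v := Φ + y with hv
  have hs' : (s : ℂ) ≠ 0 := by exact_mod_cast hs.ne'
  have hℓv : ℓ ((s : ℂ) • v) = s := by
    rw [map_smul, hv, map_add, hΦ, hy]; simp
  have e : h z ((s : ℂ) • v) + z • D z ((s : ℂ) • v) =
      (s : ℂ) • ((s ^ 2 : ℝ) • h z v + z • D z v) := by
    rw [hom, map_smul, smul_add, smul_comm z, Complex.norm_real, Real.norm_of_nonneg hs.le,
      mul_comm, mul_smul]
    rfl
  have e' : ((s ^ 2 : ℝ) • h z v : X) = ((s ^ 2 : ℝ) : ℂ) • h z v := rfl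
  have hm : reducedMap ℓ K Φ D h (z, y) = (-ℓ (h z v) / ℓ (D z v),
    K ((-ℓ (h z v) / ℓ (D z v)) • D z v + h z v)) := rfl
  rw [ReducedSolution, hℓv, e, e', hm, Prod.smul_mk, Prod.mk.injEq]
  set ε : ℂ := ((s ^ 2 : ℝ) : ℂ) with hε
  have a1 : ℓ ((s : ℂ) • (ε • h z v + z • D z v)) = 0 ↔
      z = ε • (-ℓ (h z v) / ℓ (D z v)) := by
    simp only [map_smul, map_add, smul_eq_mul, mul_eq_zero, hs', false_or]
    rw [← mul_div_assoc, eq_div_iff hne, mul_neg, eq_neg_iff_add_eq_zero, add_comm]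
  rw [a1]
  refine and_congr_right fun hz => ?_
  have e2 : ε • h z v + z • D z v = ε • ((-ℓ (h z v) / ℓ (D z v)) • D z v + h z v) := by
    nth_rewrite 2 [hz]
    rw [smul_add, smul_assoc, add_comm]
  rw [e2, map_smul, ← smul_add, smul_right_inj hs', hv, add_right_inj, map_smul]

end Bifurcation

/-! ### Existence and local uniqueness of the branch -/

section Bifurcation

variable {X : Type*} [NormedAddCommGroup X] [NormedSpace ℂ X]
variable {ℓ : X →L[ℂ] ℂ} {K : X →L[ℂ] X} {Φ : X} {D : ℂ → X →L[ℂ] X} {h : ℂ → X → X}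

/-- Small solutions are close to the line spanned by the eigenvector. -/
theorem exists_forall_norm_sub_le
    (hom : ∀ (c : ℂ) z x, h z (c • x) = (((‖c‖ ^ 2 : ℝ) : ℂ) * c) • h z x) (hD : LipAt D 0)
    (hh₀ : LipAt (fun q : ℂ × X => h q.1 q.2) (0, 0)) {θ : ℝ} (hθ : 0 < θ) :
    ∃ r : ℝ, 0 < r ∧ ∀ z x, ReducedSolution ℓ K Φ D h z x → ‖z‖ < r → ‖x‖ < r →
      ‖x - ℓ x • Φ‖ ≤ θ * ‖x‖ := by
  obtain ⟨C, η, hC, hη, hb⟩ := exists_bound_cubic hom hh₀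
  obtain ⟨η', hη', hbD⟩ := Metric.mem_nhds_iff.1
    (hD.continuousAt.norm.eventually (gt_mem_nhds (lt_add_one ‖D 0‖)))
  set d := ‖D 0‖ + 1 with hd
  have hd0 : 0 < d := by positivity
  -- The radii are chosen so that |z| ≤ θ/m and, using ‖x‖ < 1 as well, ‖x‖² ≤ θ/m. Both parts of
  -- the right side are then at most a multiple of (θ/m)‖x‖, and m absorbs ‖K‖(C + d).
  set m := ‖K‖ * (C + d) + 1 with hm
  have hm0 : 0 < m := by positivity
  refine ⟨min (min η η') (min 1 (θ / m)), by positivity, fun z x hs hz hx => ?_⟩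
  simp only [lt_min_iff] at hz hx
  obtain ⟨⟨z1, z2⟩, z3, z4⟩ := hz
  obtain ⟨_, x3, x4⟩ := hx
  have e : x - ℓ x • Φ = K (h z x + z • D z x) := by
    rw [sub_eq_iff_eq_add']; exact hs.2
  have b1 := hb z x z1
  have b2 : ‖D z‖ ≤ d := le_of_lt (hbD (by simpa using z2))
  have nx := norm_nonneg x
  have b3 : ‖h z x + z • D z x‖ ≤ (C + d) * (θ / m) * ‖x‖ := by
    refine (norm_add_le _ _).trans ?_
    have b4 : ‖z • D z x‖ ≤ θ / m * (d * ‖x‖) := by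
      rw [norm_smul]
      exact mul_le_mul z4.le (((D z).le_opNorm x).trans (by gcongr)) (norm_nonneg _)
        (by positivity)
    have b5 : ‖x‖ ^ 3 ≤ θ / m * ‖x‖ := by
      have : ‖x‖ ^ 2 ≤ θ / m := by nlinarith
      calc ‖x‖ ^ 3 = ‖x‖ ^ 2 * ‖x‖ := by ring
        _ ≤ _ := by gcongr
    calc _ ≤ C * (θ / m * ‖x‖) + θ / m * (d * ‖x‖) := by
          refine add_le_add (b1.trans ?_) b4
          gcongr
      _ = _ := by ring
  rw [e]
  refine (K.le_opNorm _).trans ?_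
  calc ‖K‖ * ‖h z x + z • D z x‖ ≤ ‖K‖ * ((C + d) * (θ / m) * ‖x‖) := by gcongr
    _ = (‖K‖ * (C + d)) / m * (θ * ‖x‖) := by ring
    _ ≤ 1 * (θ * ‖x‖) := by
      gcongr
      rw [div_le_one hm0]
      linarith
    _ = _ := one_mul _

/-- Bifurcation of a unique branch of solutions from a simple eigenvalue. -/
theorem exists_bifurcation_branch [CompleteSpace X]
    (hom : ∀ (c : ℂ) z x, h z (c • x) = (((‖c‖ ^ 2 : ℝ) : ℂ) * c) • h z x)
    (hΦ : ℓ Φ = 1) (hK : ∀ x, ℓ (K x) = 0) (hD : LipAt D 0)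
    (hh : LipAt (fun q : ℂ × X => h q.1 q.2) (0, Φ))
    (hh₀ : LipAt (fun q : ℂ × X => h q.1 q.2) (0, 0)) (hDΦ : ℓ (D 0 Φ) ≠ 0) {δ κ : ℝ}
    (hδ : 0 < δ) (hκ : 0 < κ) :
    ∃ (ε₀ r C : ℝ) (ζ : ℝ → ℂ) (y : ℝ → X), 0 < ε₀ ∧ 0 < r ∧ r ≤ δ ∧ 0 ≤ C ∧
      (∀ ε ∈ Ioo 0 ε₀,
        ReducedSolution ℓ K Φ D h (ζ ε) ((√ε : ℂ) • (Φ + y ε)) ∧ ℓ (y ε) = 0 ∧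
        y ε = (ε : ℂ) • (reducedMap ℓ K Φ D h (ζ ε, y ε)).2 ∧
        ‖ζ ε - ε * (reducedMap ℓ K Φ D h 0).1‖ ≤ C * ε ^ 2 ∧
        ‖y ε - (ε : ℂ) • (reducedMap ℓ K Φ D h 0).2‖ ≤ C * ε ^ 2 ∧
        ‖ζ ε‖ < r ∧ ‖(√ε : ℂ) • (Φ + y ε)‖ < κ * r ∧
        (∀ t ∈ Ioo 0 ε₀, ‖ζ t - ζ ε‖ ≤ C * |t - ε| ∧ ‖y t - y ε‖ ≤ C * |t - ε|) ∧
        ∀ z x, ReducedSolution ℓ K Φ D h z x → ‖z‖ < r → ‖x‖ < r → ℓ x = (√ε : ℂ) →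
          z = ζ ε ∧ x = (√ε : ℂ) • (Φ + y ε)) ∧
      (∃ r' : ℝ, 0 < r' ∧ r' ≤ δ ∧ ∀ z x, ReducedSolution ℓ K Φ D h z x → x ≠ 0 → ‖z‖ < r' →
        ‖x‖ < r' → ∃ ε ∈ Ioo 0 ε₀, ∃ c : ℂ, ‖c‖ = 1 ∧ z = ζ ε ∧
          x = c • ((√ε : ℂ) • (Φ + y ε))) ∧
      ∀ S : Set (ℂ × X), IsClosed S → 0 ∈ S → (∀ ε : ℝ, ∀ q ∈ S, (ε : ℂ) • q ∈ S) →
        (∀ q ∈ S, ‖q.1‖ < δ → ℓ (D q.1 (Φ + q.2)) ≠ 0 → reducedMap ℓ K Φ D h q ∈ S) →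
        ∀ ε ∈ Ioo 0 ε₀, (ζ ε, y ε) ∈ S := by
  obtain ⟨Λ, s, hs, hL⟩ := lipAt_reducedMap (K := K) hD hh hDΦ
  have hne : ∀ᶠ q : ℂ × X in 𝓝 0, ℓ (D q.1 (Φ + q.2)) ≠ 0 := by
    have l : LipAt (fun q : ℂ × X => D q.1 (Φ + q.2)) 0 :=
      (LipAt.comp (g := D) (f := fun q : ℂ × X => q.1) (by simpa using hD) (LipAt.fst' _)).clm_apply
        ((LipAt.const' _ _).add (LipAt.snd' _))
    have l' := ((LipAt.const' ℓ _).clm_apply l).continuousAt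
    exact l'.eventually_ne (by simpa using hDΦ)
  obtain ⟨ρ₀, hρ₀, hball⟩ := Metric.mem_nhds_iff.1 (inter_mem hs hne)
  set ρ := min (ρ₀ / 2) (δ / 2) with hρ
  have hρ0 : 0 < ρ := by positivity
  have hρδ : ρ < δ := (min_le_right _ _).trans_lt (by linarith)
  have hmem : ∀ q : ℂ × X, ‖q‖ ≤ ρ → q ∈ s ∧ ℓ (D q.1 (Φ + q.2)) ≠ 0 := fun q hq => hball (by
    rw [Metric.mem_ball, dist_zero_right]
    exact hq.trans_lt ((min_le_left _ _).trans_lt (by linarith)))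
  obtain ⟨ε₁, C, hε₁, hC, p, hp⟩ := exists_fixedPoint_branch (F := reducedMap ℓ K Φ D h) hρ0
    (hL.mono fun q hq => (hmem q (by simpa using hq)).1)
  -- The bound 1/2 gives ‖x‖ ≤ 2|ℓ x|‖Φ‖; the other one then places x/ℓ(x) - Φ in the ball of radius
  -- ρ, where fixed points are unique.
  set θ : ℝ := min (1 / 2) (ρ / (2 * ‖Φ‖ + 1)) with hθ
  obtain ⟨r₁, hr₁, hlin⟩ := exists_forall_norm_sub_le (ℓ := ℓ) (K := K) (Φ := Φ) hom hD hh₀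
    (θ := θ) (by positivity)
  set r := min r₁ ρ with hr
  have hr0 : 0 < r := by positivity
  -- Besides ε < ε₁: the bound 1 gives ‖y‖ ≤ C, the third entry gives ‖ζ‖ < r, and the last gives
  -- √ε(‖Φ‖ + C) < κ r.
  set ε₀ := min (min ε₁ 1) (min (r / (C + 1)) ((κ * r / (‖Φ‖ + C + 1)) ^ 2)) with hε₀
  have hε₀0 : 0 < ε₀ := by positivity
  have hsub : ∀ ε ∈ Ioo 0 ε₀, ε ∈ Ioo 0 ε₁ := fun ε hε =>
    ⟨hε.1, hε.2.trans_le ((min_le_left _ _).trans (min_le_left _ _))⟩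
  have hcs : ∀ ε : ℝ, 0 < ε → (((√ε ^ 2 : ℝ)) : ℂ) = ε := fun ε hε => by rw [Real.sq_sqrt hε.le]
  have hy0 : ∀ ε ∈ Ioo 0 ε₁, ℓ (p ε).2 = 0 := fun ε hε => by
    rw [(hp ε hε).1, Prod.smul_snd, map_smul]
    simp [reducedMap, hK]
  have small_y : ∀ z x, ReducedSolution ℓ K Φ D h z x → ‖z‖ < r → ‖x‖ < r → ∀ t : ℝ, 0 < t →
      ℓ x = t → ‖(t : ℂ)⁻¹ • x - Φ‖ ≤ ρ := by
    intro z x hsol hz hx t ht hℓ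
    have h1 := hlin z x hsol (hz.trans_le (min_le_left _ _)) (hx.trans_le (min_le_left _ _))
    have htn : ‖(t : ℂ)‖ = t := by rw [Complex.norm_real, Real.norm_of_nonneg ht.le]
    rw [hℓ] at h1
    have h2 : ‖x‖ ≤ 2 * (t * ‖Φ‖) := by
      have h3 := norm_sub_norm_le x ((t : ℂ) • Φ)
      rw [norm_smul, htn] at h3
      have h4 : θ * ‖x‖ ≤ 1 / 2 * ‖x‖ := by gcongr; exact min_le_left _ _
      linarith
    have e : (t : ℂ)⁻¹ • x - Φ = (t : ℂ)⁻¹ • (x - (t : ℂ) • Φ) := by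
      rw [smul_sub, smul_smul, inv_mul_cancel₀ (by exact_mod_cast ht.ne'), one_smul]
    rw [e, norm_smul, norm_inv, htn, inv_mul_le_iff₀ ht]
    calc _ ≤ θ * ‖x‖ := h1
      _ ≤ ρ / (2 * ‖Φ‖ + 1) * (2 * (t * ‖Φ‖)) := by
        gcongr
        exact min_le_right _ _
      _ = t * (ρ * (2 * ‖Φ‖ / (2 * ‖Φ‖ + 1))) := by ring
      _ ≤ t * (ρ * 1) := by
        gcongr
        rw [div_le_one (by positivity)]
        linarith
      _ = _ := by ring
  have uniq : ∀ ε ∈ Ioo 0 ε₁, ∀ z x, ReducedSolution ℓ K Φ D h z x → ‖z‖ < r → ‖x‖ < r →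
      ℓ x = (√ε : ℂ) → z = (p ε).1 ∧ x = (√ε : ℂ) • (Φ + (p ε).2) := by
    intro ε hε z x hsol hz hx hℓ
    have ht : 0 < √ε := Real.sqrt_pos.2 hε.1
    have ht' : (√ε : ℂ) ≠ 0 := by exact_mod_cast ht.ne'
    have h1 := small_y z x hsol hz hx _ ht hℓ
    set y := (√ε : ℂ)⁻¹ • x - Φ with hy
    have hx' : x = (√ε : ℂ) • (Φ + y) := by
      rw [hy, add_sub_cancel, smul_smul, mul_inv_cancel₀ ht', one_smul]
    have hq : ‖((z, y) : ℂ × X)‖ ≤ ρ :=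
      max_le (hz.le.trans (min_le_right _ _)) h1
    have hℓy : ℓ y = 0 := by
      rw [hy, map_sub, map_smul, hℓ, hΦ, smul_eq_mul, inv_mul_cancel₀ ht', sub_self]
    rw [hx'] at hsol
    have h2 := (reducedSolution_iff hom hΦ ht (hmem _ hq).2 hℓy).1 hsol
    rw [hcs ε hε.1] at h2
    have h3 := (hp ε hε).2.2.2.1 _ hq h2
    rw [← h3, hx']
    exact ⟨rfl, rfl⟩
  refine ⟨ε₀, r, C, fun ε => (p ε).1, fun ε => (p ε).2, hε₀0, hr0,
    (min_le_right _ _).trans hρδ.le, hC, fun ε hε => ?_, ?_, ?_⟩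
  · have hε' := hsub ε hε
    obtain ⟨p1, p2, p3, _, p5, p6, _⟩ := hp ε hε'
    have ht : 0 < √ε := Real.sqrt_pos.2 hε.1
    have ne := (hmem _ p2).2
    have nl : ‖(√ε : ℂ)‖ = √ε := by rw [Complex.norm_real, Real.norm_of_nonneg ht.le]
    have hε1 : ε ≤ 1 := hε.2.le.trans ((min_le_left _ _).trans (min_le_right _ _))
    refine ⟨?_, hy0 ε hε', congrArg Prod.snd p1, (norm_fst_le _).trans p5,
      (norm_snd_le _).trans p5, ?_, ?_, fun t ht => ?_, uniq ε hε'⟩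
    · rw [reducedSolution_iff hom hΦ ht ne (hy0 ε hε'), hcs ε hε.1]
      exact p1
    · have h1 : ε < r / (C + 1) := hε.2.trans_le ((min_le_right _ _).trans (min_le_left _ _))
      rw [lt_div_iff₀ (by positivity)] at h1
      have h2 := (norm_fst_le (p ε)).trans p3
      nlinarith [hε.1]
    · have h1 : √ε < κ * r / (‖Φ‖ + C + 1) := by
        rw [Real.sqrt_lt' (by positivity)]
        exact hε.2.trans_le ((min_le_right _ _).trans (min_le_right _ _))
      rw [lt_div_iff₀ (by positivity)] at h1
      rw [norm_smul, nl]
      have h2 : ‖Φ + (p ε).2‖ ≤ ‖Φ‖ + C := by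
        refine (norm_add_le _ _).trans ?_
        gcongr
        refine ((norm_snd_le (p ε)).trans p3).trans ?_
        nlinarith
      nlinarith
    · have := p6 t (hsub t ht)
      exact ⟨(norm_fst_le _).trans this, (norm_snd_le _).trans this⟩
  -- The second entry ensures |ℓ(x)|² < ε₀, so that ε = |ℓ(x)|² is an admissible parameter.
  · set r' := min r (√ε₀ / (‖ℓ‖ + 1)) with hr'
    have hsε₀ : 0 < √ε₀ := Real.sqrt_pos.2 hε₀0
    refine ⟨r', by positivity, (min_le_left _ _).trans ((min_le_right _ _).trans hρδ.le),
      fun z x hsol hx0 hz hx => ?_⟩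
    have hz' := hz.trans_le (min_le_left _ _)
    have hx' := hx.trans_le (min_le_left _ _)
    have hℓ0 : ℓ x ≠ 0 := by
      intro h0
      have h1 := hlin z x hsol (hz'.trans_le (min_le_left _ _)) (hx'.trans_le (min_le_left _ _))
      rw [h0, zero_smul, sub_zero] at h1
      have h2 : θ * ‖x‖ ≤ 1 / 2 * ‖x‖ := by gcongr; exact min_le_left _ _
      have h3 : 0 < ‖x‖ := norm_pos_iff.2 hx0
      linarith
    have hn : 0 < ‖ℓ x‖ := norm_pos_iff.2 hℓ0
    have hnC : (‖ℓ x‖ : ℂ) ≠ 0 := by exact_mod_cast hn.ne'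
    have hlt : ‖ℓ x‖ < √ε₀ := by
      have h1 : ‖x‖ < √ε₀ / (‖ℓ‖ + 1) := hx.trans_le (min_le_right _ _)
      rw [lt_div_iff₀ (by positivity)] at h1
      have h2 := ℓ.le_opNorm x
      nlinarith [norm_nonneg x]
    have hεm : ‖ℓ x‖ ^ 2 ∈ Ioo 0 ε₀ := ⟨by positivity, (Real.lt_sqrt hn.le).1 hlt⟩
    -- Dividing x by the phase of ℓ(x), which is nonzero since x is close to ℓ(x)Φ, makes the
    -- pairing equal to √ε, and the normalized uniqueness applies.
    set c : ℂ := ℓ x / ‖ℓ x‖ with hc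
    have hc1 : ‖c‖ = 1 := by
      rw [hc, norm_div, Complex.norm_real, norm_norm, div_self hn.ne']
    have hc0 : c ≠ 0 := fun h => by rw [h, norm_zero] at hc1; exact zero_ne_one hc1
    have hci : ‖c⁻¹‖ = 1 := by rw [norm_inv, hc1, inv_one]
    have hsq : √(‖ℓ x‖ ^ 2) = ‖ℓ x‖ := Real.sqrt_sq hn.le
    obtain ⟨u1, u2⟩ := uniq _ (hsub _ hεm) z (c⁻¹ • x) (hsol.smul hom hci) hz'
      (by rw [norm_smul, hci, one_mul]; exact hx') (by
        rw [hsq, map_smul, hc, smul_eq_mul, inv_div, div_mul_cancel₀ _ hℓ0])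
    refine ⟨_, hεm, c, hc1, u1, ?_⟩
    rw [← u2, smul_smul, mul_inv_cancel₀ hc0, one_smul]
  · intro S hS h0 hsc hinv ε hε
    refine (hp ε (hsub ε hε)).2.2.2.2.2.2 S hS h0 fun q hq hqρ => hsc _ _ (hinv q hq ?_ ?_)
    · exact ((norm_fst_le q).trans hqρ).trans_lt hρδ
    · exact (hmem q hqρ).2

end Bifurcation

/-! ### Divided differences of bounded holomorphic functions -/

theorem dslope_sub_of_differentiableAt {f g : ℂ → ℂ} {c w : ℂ} (hf : DifferentiableAt ℂ f c)
    (hg : DifferentiableAt ℂ g c) :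
    dslope (fun z => f z - g z) c w = dslope f c w - dslope g c w := by
  rcases eq_or_ne w c with rfl | h
  · simp only [dslope_same]
    exact deriv_fun_sub hf hg
  · simp only [dslope_of_ne _ h, slope_def_field]
    ring

/-- The Schwarz lemma: f maps the ball into the closed ball of radius 2m about f(c). -/
theorem norm_dslope_le {f : ℂ → ℂ} {c : ℂ} {δ m : ℝ}
    (hf : DifferentiableOn ℂ f (Metric.ball c δ)) (hm : ∀ w ∈ Metric.ball c δ, ‖f w‖ ≤ m) {w : ℂ}
    (hw : w ∈ Metric.ball c δ) : ‖dslope f c w‖ ≤ 2 * m / δ := by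
  have hδ : 0 < δ := Metric.pos_of_mem_ball hw
  refine Complex.norm_dslope_le_div_of_mapsTo_ball hf (fun v hv => ?_) hw
  rw [mem_closedBall_iff_norm]
  have h1 := hm v hv
  have h2 := hm c (Metric.mem_ball_self hδ)
  have h3 := norm_sub_le (f v) (f c)
  linarith

/-- The mean value inequality on the half ball. The derivative of the divided difference is at most
(2m/δ)/(δ/4) there, by Cauchy's estimate on circles of radius δ/4. -/
theorem norm_dslope_sub_le {f : ℂ → ℂ} {c : ℂ} {δ m : ℝ} (hδ : 0 < δ)
    (hf : DifferentiableOn ℂ f (Metric.ball c δ)) (hm : ∀ w ∈ Metric.ball c δ, ‖f w‖ ≤ m) {w w' : ℂ}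
    (hw : w ∈ Metric.ball c (δ / 2)) (hw' : w' ∈ Metric.ball c (δ / 2)) :
    ‖dslope f c w - dslope f c w'‖ ≤ 8 * m / δ ^ 2 * ‖w - w'‖ := by
  have hd : DifferentiableOn ℂ (dslope f c) (Metric.ball c δ) :=
    (Complex.differentiableOn_dslope (Metric.ball_mem_nhds c hδ)).2 hf
  refine (convex_ball c (δ / 2)).norm_image_sub_le_of_norm_deriv_le (𝕜 := ℂ) (f := dslope f c)
    (fun v hv => ?_) (fun v hv => ?_) hw' hw
  · exact hd.differentiableAt (Metric.isOpen_ball.mem_nhds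
      (Metric.ball_subset_ball (by linarith) hv))
  · have hsub : Metric.closedBall v (δ / 4) ⊆ Metric.ball c δ := by
      intro t ht
      rw [Metric.mem_closedBall] at ht
      rw [Metric.mem_ball] at hv ⊢
      linarith [dist_triangle t v c]
    have h1 : ‖deriv (dslope f c) v‖ ≤ (2 * m / δ) / (δ / 4) := by
      refine Complex.norm_deriv_le_of_forall_mem_sphere_norm_le (by positivity) ?_ fun t ht =>
        norm_dslope_le hf hm (hsub (Metric.sphere_subset_closedBall ht))
      exact (hd.mono (Metric.closure_ball_subset_closedBall.trans hsub)).diffContOnCl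
    refine h1.trans (le_of_eq ?_)
    field_simp
    ring

namespace Medium

variable {M : Medium}

/-- The bounds on `V` hold at almost all points simultaneously for all frequencies. -/
theorem RegularV.exists_uniform {ω₀ : ℂ} (hV : M.RegularV ω₀) :
    ∃ δ K : ℝ, 0 < δ ∧ ∃ s : Set ℝ, (∀ᵐ x, x ∈ s) ∧ ∀ i, ∀ x ∈ s, x ∈ M.layer i →
      DifferentiableOn ℂ (M.V x) (Metric.ball ω₀ δ) ∧ ∀ ω ∈ Metric.ball ω₀ δ, ‖M.V x ω‖ ≤ K ∧
        ∀ y ∈ s, y ∈ M.layer i → ‖M.V x ω - M.V y ω‖ ≤ K * |x - y| := by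
  obtain ⟨δ, hδ, h⟩ := hV
  choose h1 h2 _ using h
  choose K hK using h2
  set K' : ℝ := ∑ i, |K i| + 1 with hK'
  have hmul : ∀ ω ∈ Metric.ball ω₀ δ, M.MulBound (fun x => M.V x ω) K' := fun ω hω =>
    mulBound_of_sobolevNorm_lt fun i => (hK i ω hω).trans_lt
      ((ENNReal.ofReal_lt_ofReal_iff (by positivity)).2 (by
        have := Finset.single_le_sum (f := fun i => |K i|) (fun _ _ => abs_nonneg _)
          (Finset.mem_univ i)
        have := le_abs_self (K i)
        linarith))
  -- The exceptional null set depends on ω. Countably many frequencies from a dense set exclude only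
  -- one null set, and continuity in ω extends the bounds to the whole ball.
  obtain ⟨Q, hQc, hQd⟩ := TopologicalSpace.exists_countable_dense ℂ
  have hQ' : (Q ∩ Metric.ball ω₀ δ).Countable := hQc.mono inter_subset_left
  choose! s hs hsb using hmul
  have hcl : ∀ ω ∈ Metric.ball ω₀ δ, ω ∈ closure (Q ∩ Metric.ball ω₀ δ) := fun ω hω => by
    have := hQd.open_subset_closure_inter Metric.isOpen_ball hω
    rwa [inter_comm] at this
  have pass : ∀ (f : ℂ → ℂ) (m : ℝ), ContinuousOn f (Metric.ball ω₀ δ) →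
      (∀ ω ∈ Q ∩ Metric.ball ω₀ δ, ‖f ω‖ ≤ m) → ∀ ω ∈ Metric.ball ω₀ δ, ‖f ω‖ ≤ m := by
    intro f m hf hm ω hω
    have : (𝓝[Q ∩ Metric.ball ω₀ δ] ω).NeBot := mem_closure_iff_nhdsWithin_neBot.1 (hcl ω hω)
    exact le_of_tendsto ((hf ω hω).norm.mono inter_subset_right)
      (eventually_mem_nhdsWithin.mono hm)
  refine ⟨δ, K', hδ, {x | (∀ ω ∈ Q ∩ Metric.ball ω₀ δ, x ∈ s ω) ∧
    ∀ i, x ∈ M.layer i → DifferentiableOn ℂ (M.V x) (Metric.ball ω₀ δ)}, ?_, ?_⟩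
  · filter_upwards [(ae_ball_iff hQ').2 fun ω hω => hs ω hω.2, ae_all_iff.2 h1] with x a b
    exact ⟨a, b⟩
  · intro i x hx hi
    refine ⟨hx.2 i hi, fun ω hω => ⟨?_, fun y hy hyi => ?_⟩⟩
    · exact pass _ _ (hx.2 i hi).continuousOn (fun w hw => (hsb w hw.2 i x (hx.1 w hw) hi).1) ω hω
    · exact pass (fun w => M.V x w - M.V y w) _
        ((hx.2 i hi).continuousOn.sub (hy.2 i hyi).continuousOn)
        (fun w hw => (hsb w hw.2 i x (hx.1 w hw) hi).2 y (hy.1 w hw) hyi) ω hω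

variable (M) in
/-- The divided difference of `V(x, ·)` between `ω₀` and `ω₀ + z`. -/
def divV (ω₀ z : ℂ) (x : ℝ) : ℂ := dslope (M.V x) ω₀ (ω₀ + z)

/-- The divided difference is linear in the function. Estimates for V(x, ·) give the size, and the
same estimates for V(x, ·) - V(y, ·), bounded by K|x - y|, give the Lipschitz constant in x. -/
theorem RegularV.exists_divV {ω₀ : ℂ} (hV : M.RegularV ω₀) :
    ∃ δ K : ℝ, 0 < δ ∧ (∀ᵐ x, DifferentiableOn ℂ (M.V x) (Metric.ball ω₀ δ)) ∧
      M.MulBound (fun x => M.V x ω₀) K ∧ (∀ z, ‖z‖ < δ → M.MulBound (M.divV ω₀ z) K) ∧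
      ∀ z z', ‖z‖ < δ → ‖z'‖ < δ →
        M.MulBound (fun x => M.divV ω₀ z x - M.divV ω₀ z' x) (K * ‖z - z'‖) := by
  obtain ⟨δ, K, hδ, s, hs, h⟩ := hV.exists_uniform
  have hK : 0 ≤ K := by
    obtain ⟨x, hx, i, hi⟩ := (hs.and M.ae_exists_mem_layer).exists
    exact (norm_nonneg _).trans ((h i x hx hi).2 ω₀ (Metric.mem_ball_self hδ)).1
  set C : ℝ := 1 + 2 / δ + 8 / δ ^ 2 with hC
  have c1 : 1 ≤ C := by rw [hC]; have : 0 < 2 / δ + 8 / δ ^ 2 := by positivity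
                        linarith
  have c2 : 2 / δ ≤ C := by rw [hC]; have : 0 < 8 / δ ^ 2 := by positivity
                            linarith
  have c3 : 8 / δ ^ 2 ≤ C := by rw [hC]; have : 0 < 2 / δ := by positivity
                                linarith
  have hmem : ∀ z : ℂ, ‖z‖ < δ / 2 → ω₀ + z ∈ Metric.ball ω₀ (δ / 2) := fun z hz => by
    simpa [mem_ball_iff_norm] using hz
  have hmem' : ∀ z : ℂ, ‖z‖ < δ / 2 → ω₀ + z ∈ Metric.ball ω₀ δ := fun z hz =>
    Metric.ball_subset_ball (by linarith) (hmem z hz)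
  have h0 : ω₀ ∈ Metric.ball ω₀ δ := Metric.mem_ball_self hδ
  have hn : Metric.ball ω₀ δ ∈ 𝓝 ω₀ := Metric.ball_mem_nhds _ hδ
  have hdiff : ∀ i, ∀ x ∈ s, x ∈ M.layer i → ∀ y ∈ s, y ∈ M.layer i → ∀ w,
      dslope (M.V x) ω₀ w - dslope (M.V y) ω₀ w = dslope (fun v => M.V x v - M.V y v) ω₀ w :=
    fun i x hx hi y hy hyi w => (dslope_sub_of_differentiableAt
      ((h i x hx hi).1.differentiableAt hn) ((h i y hy hyi).1.differentiableAt hn)).symm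
  have b1 : ∀ m : ℝ, 0 ≤ m → 2 * m / δ ≤ C * m := fun m hm => by
    calc 2 * m / δ = 2 / δ * m := by ring
      _ ≤ _ := by gcongr
  have b2 : ∀ m t : ℝ, 0 ≤ m → 0 ≤ t → 8 * m / δ ^ 2 * t ≤ C * m * t := fun m t hm ht => by
    calc 8 * m / δ ^ 2 * t = 8 / δ ^ 2 * m * t := by ring
      _ ≤ _ := by gcongr
  refine ⟨δ / 2, C * K, by positivity, ?_, ?_, fun z hz => ?_, fun z z' hz hz' => ?_⟩
  · filter_upwards [hs, M.ae_exists_mem_layer] with x hx hi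
    obtain ⟨i, hi⟩ := hi
    exact (h i x hx hi).1.mono (Metric.ball_subset_ball (by linarith))
  · refine MulBound.mono (K := K) ⟨s, hs, fun i x hx hi => (h i x hx hi).2 ω₀ h0⟩ ?_
    nlinarith
  · refine ⟨s, hs, fun i x hx hi => ⟨?_, fun y hy hyi => ?_⟩⟩
    · exact (norm_dslope_le (h i x hx hi).1 (fun w hw => ((h i x hx hi).2 w hw).1)
        (hmem' z hz)).trans (b1 K hK)
    · rw [divV, divV, hdiff i x hx hi y hy hyi]
      refine (norm_dslope_le (m := K * |x - y|) ((h i x hx hi).1.sub (h i y hy hyi).1)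
        (fun w hw => ((h i x hx hi).2 w hw).2 y hy hyi) (hmem' z hz)).trans ?_
      rw [mul_assoc]
      exact b1 _ (by positivity)
  · refine ⟨s, hs, fun i x hx hi => ⟨?_, fun y hy hyi => ?_⟩⟩
    · have := norm_dslope_sub_le hδ (h i x hx hi).1 (fun w hw => ((h i x hx hi).2 w hw).1)
        (hmem z hz) (hmem z' hz')
      rw [add_sub_add_left_eq_sub] at this
      exact this.trans (b2 _ _ hK (norm_nonneg _))
    · have := norm_dslope_sub_le hδ (m := K * |x - y|) ((h i x hx hi).1.sub (h i y hy hyi).1)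
        (fun w hw => ((h i x hx hi).2 w hw).2 y hy hyi) (hmem z hz) (hmem z' hz')
      simp only [Pi.sub_def] at this
      rw [← hdiff i x hx hi y hy hyi, ← hdiff i x hx hi y hy hyi,
        add_sub_add_left_eq_sub] at this
      have e : M.divV ω₀ z x - M.divV ω₀ z' x - (M.divV ω₀ z y - M.divV ω₀ z' y) =
          dslope (M.V x) ω₀ (ω₀ + z) - dslope (M.V y) ω₀ (ω₀ + z) -
            (dslope (M.V x) ω₀ (ω₀ + z') - dslope (M.V y) ω₀ (ω₀ + z')) := by
        simp only [divV]; ring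
      rw [e]
      refine this.trans ((b2 _ _ (by positivity) (norm_nonneg _)).trans (le_of_eq ?_))
      ring

theorem RegularV.exists_mulBound_inv {ω₀ : ℂ} (hV : M.RegularV ω₀) :
    (∀ᵐ x, M.V x ω₀ ≠ 0) ∧ ∃ K, M.MulBound (fun x => (M.V x ω₀)⁻¹) K := by
  obtain ⟨δ, hδ, h⟩ := hV
  have h' := fun i => (h i).2.2 ω₀ (Metric.mem_ball_self hδ)
  refine ⟨?_, exists_mulBound fun i => (h' i).2.1⟩
  filter_upwards [ae_all_iff.2 fun i => (h' i).1, M.ae_exists_mem_layer] with x hx hi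
  obtain ⟨i, hi⟩ := hi
  exact hx i hi

/-! ### The graph of the pencil -/

/-- The relation is stated as A u = f + B u, so that no separate domain condition for B appears: B u
is in L² as the difference of A u and f. -/
theorem mem_graph_L (ω : ℂ) (u f : L2) : (u, f) ∈ (M.L ω).graph ↔
    ∃ v : L2, IsCurl M.k u v ∧ ∀ᵐ x, ∀ j, v x j = f x j + M.Bdiag ω x j * u x j := by
  constructor
  · intro h
    obtain ⟨y, h1, h2⟩ := (LinearPMap.mem_graph_iff _).1 h
    simp only at h1 h2
    subst h1
    have ha : (y : L2) ∈ (curlOp M.k).domain := y.2.1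
    have hb : (y : L2) ∈ (mulOp (M.Bdiag ω)).domain := y.2.2
    have e : M.L ω y = curlOp M.k ⟨y, ha⟩ - mulOp (M.Bdiag ω) ⟨y, hb⟩ := rfl
    have gc := (mem_graph_curlOp M.k _ _).1 (LinearPMap.mem_graph (curlOp M.k) ⟨y, ha⟩)
    have gm := (mem_graph_mulOp (M.Bdiag ω) _ _).1
      (LinearPMap.mem_graph (mulOp (M.Bdiag ω)) ⟨y, hb⟩)
    refine ⟨curlOp M.k ⟨y, ha⟩, gc, ?_⟩
    have hsub := Lp.coeFn_sub (curlOp M.k ⟨y, ha⟩) (mulOp (M.Bdiag ω) ⟨y, hb⟩)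
    rw [← e, h2] at hsub
    filter_upwards [gm, hsub] with x a b j
    rw [b, ← a j]
    simp
  · rintro ⟨v, hc, hv⟩
    have gc := (mem_graph_curlOp M.k u v).2 hc
    have gm := (mem_graph_mulOp (M.Bdiag ω) u (v - f)).2 (by
      filter_upwards [hv, Lp.coeFn_sub v f] with x a b j
      rw [b, Pi.sub_apply, PiLp.sub_apply, a j, add_sub_cancel_left])
    obtain ⟨y, y1, y2⟩ := (LinearPMap.mem_graph_iff _).1 gc
    obtain ⟨y', y1', y2'⟩ := (LinearPMap.mem_graph_iff _).1 gm
    simp only at y1 y2 y1' y2'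
    have hd : u ∈ (M.L ω).domain := ⟨y1 ▸ y.2, y1' ▸ y'.2⟩
    refine (LinearPMap.mem_graph_iff _).2 ⟨⟨u, hd⟩, rfl, ?_⟩
    have e : M.L ω ⟨u, hd⟩ = curlOp M.k ⟨u, hd.1⟩ - mulOp (M.Bdiag ω) ⟨u, hd.2⟩ := rfl
    have e1 : (⟨u, hd.1⟩ : (curlOp M.k).domain) = y := Subtype.ext y1.symm
    have e2 : (⟨u, hd.2⟩ : (mulOp (M.Bdiag ω)).domain) = y' := Subtype.ext y1'.symm
    rw [e, e1, e2, y2, y2', sub_sub_cancel]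

theorem mem_curlOp_domain_of_mem_graph_L {ω : ℂ} {u f : L2} (h : (u, f) ∈ (M.L ω).graph) :
    u ∈ (curlOp M.k).domain := by
  have := LinearPMap.mem_domain_of_mem_graph h
  exact this.1

theorem solves_iff {ω : ℂ} {u : L2} {F : ℝ → C3} {f : L2} (hf : ∀ᵐ x, F x = f x) :
    Solves (M.L ω) u F ↔ (u, f) ∈ (M.L ω).graph := by
  constructor
  · rintro ⟨hu, h⟩
    have : M.L ω ⟨u, hu⟩ = f := Lp.ext (by filter_upwards [h, hf] with x a b; rw [a, b])
    rw [← this]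
    exact LinearPMap.mem_graph (M.L ω) ⟨u, hu⟩
  · intro h
    obtain ⟨y, h1, h2⟩ := (LinearPMap.mem_graph_iff _).1 h
    simp only at h1 h2
    subst h1
    refine ⟨y.2, ?_⟩
    have e : M.L ω ⟨(y : L2), y.2⟩ = f := h2
    rw [e]
    filter_upwards [hf] with x hx using hx.symm

/-- Regularity: solutions of `L u = f` with `f` in the broken Sobolev space belong to it. -/
theorem exists_J_eq_of_mem_graph {ω₀ : ℂ} (hV : M.RegularV ω₀) {u : L2} {f : M.X}
    (h : (u, M.J f) ∈ (M.L ω₀).graph) : ∃ w : M.X, M.J w = u := by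
  obtain ⟨v, ⟨c1, c2, c3⟩, hv⟩ := (mem_graph_L ω₀ u _).1 h
  obtain ⟨hne, K, hK⟩ := hV.exists_mulBound_inv
  have ml : ∀ (g : L2) (j : Fin 3), MemLp (fun x => g x j) 2 volume := fun g j =>
    (EuclideanSpace.proj (𝕜 := ℂ) j : C3 →L[ℂ] ℂ).comp_memLp g
  obtain ⟨y2, hy2, _⟩ := Y.exists_of_memLp (M := M) (ml u 2) (ml v 1).neg fun i =>
    c2.mono_on (subset_univ _)
  obtain ⟨y1, hy1, _⟩ := Y.exists_of_memLp (M := M) (ml u 1)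
    ((ml v 2).add ((ml u 0).const_mul (Complex.I * M.k))) fun i => c3.mono_on (subset_univ _)
  -- The first row ik u₃ - iV u₁ = f₁ contains no derivative; solved for u₁ it reads u₁ = (k u₃ + i
  -- f₁)/V, a product of a multiplier and functions already known to be regular.
  set y0 : M.Y := M.mulH1 (fun x => (M.V x ω₀)⁻¹) ((M.k : ℂ) • y2 + Complex.I • f 0) with hy0
  refine ⟨![y0, y1, y2], L2.ext_of_ae ?_⟩
  filter_upwards [coe_J ![y0, y1, y2], hy1, hy2, hK.coe_mulH1 ((M.k : ℂ) • y2 + Complex.I • f 0),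
    Y.coe_add ((M.k : ℂ) • y2) (Complex.I • f 0), Y.coe_smul (M.k : ℂ) y2,
    Y.coe_smul Complex.I (f 0), coe_J f, c1, hv, hne] with x a b1 b2 d1 d2 d3 d4 d5 e1 e2 e3 j
  rw [a j]
  fin_cases j
  · change y0.1.1 x = u x 0
    rw [hy0, d1, d2, d3, d4, b2, ← d5 0]
    have e4 := e2 0
    rw [e1] at e4
    have e5 : M.Bdiag ω₀ x 0 = Complex.I * M.V x ω₀ := rfl
    rw [e5] at e4
    rw [inv_mul_eq_iff_eq_mul₀ e3]
    linear_combination (-Complex.I) * e4 + (M.k * u x 2 - M.V x ω₀ * u x 0) * Complex.I_sq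
  · exact b1
  · exact b2

/-! ### The domain is dense -/

/-- The domain contains the test functions times the unit vectors, since V is bounded. A vector
orthogonal to all of them vanishes by the fundamental lemma of the calculus of variations. -/
theorem dense_domain_L {ω : ℂ} {K : ℝ} (hV : M.MulBound (fun x => M.V x ω) K) :
    Dense ((M.L ω).domain : Set L2) := by
  rw [Submodule.dense_iff_topologicalClosure_eq_top, Submodule.topologicalClosure_eq_top_iff,
    Submodule.eq_bot_iff]
  intro g hg
  rw [Submodule.mem_orthogonal] at hg
  have key : ∀ j : Fin 3, ∀ᵐ x, g x j = 0 := by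
    intro j
    refine ae_eq_zero_of_integral_contDiff_smul_eq_zero (locallyIntegrable_comp g j)
      fun η h1 h2 => ?_
    have hdc : Continuous (deriv η) := h1.continuous_deriv (by simp)
    set a : L2s := testLp ⟨η, h1.continuous, h2⟩ with ha
    set a' : L2s := testLp ⟨deriv η, hdc, h2.deriv⟩ with ha'
    have ca : ∀ᵐ x, a x = η x :=
      (memLp_ofReal_of_hasCompactSupport h1.continuous h2).coeFn_toLp
    have ca' : ∀ᵐ x, a' x = (deriv η x : ℝ) :=
      (memLp_ofReal_of_hasCompactSupport hdc h2.deriv).coeFn_toLp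
    have hwa : HasWeakDerivOn (fun x => a x) (fun x => a' x) univ := by
      refine ((isPrim_ofReal_contDiff h1 univ).hasWeakDerivOn ordConnected_univ isOpen_univ).congr'
        ?_ ?_
      · filter_upwards [ca] with x hx using hx.symm
      · filter_upwards [ca'] with x hx using hx.symm
    set c : Fin 3 → ℂ := Pi.single j 1 with hc
    set u : L2 := assemble fun i => c i • a with hu
    have cu : ∀ᵐ x, ∀ i, u x i = c i * a x := by
      filter_upwards [coe_assemble fun i => c i • a, ae_all_iff.2 fun i => Lp.coeFn_smul (c i) a]
        with x h3 h4 i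
      rw [h3 i, h4 i]; rfl
    have hwu : ∀ i, HasWeakDerivOn (fun x => u x i) (fun x => c i * a' x) univ := fun i => by
      refine (hwa.const_mul' (c i)).congr' ?_ EventuallyEq.rfl
      filter_upwards [cu] with x hx using (hx i).symm
    set w : Fin 3 → L2s := ![(Complex.I * M.k) • compL 2 u, -(c 2 • a'),
      c 1 • a' - (Complex.I * M.k) • compL 0 u] with hw
    set v : L2 := assemble w with hv
    have hcurl : IsCurl M.k u v := by
      refine ⟨?_, (hwu 2).congr' EventuallyEq.rfl ?_, (hwu 1).congr' EventuallyEq.rfl ?_⟩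
      · filter_upwards [coe_assemble w, Lp.coeFn_smul (Complex.I * M.k) (compL 2 u), coe_compL 2 u]
          with x h3 h4 h5
        rw [hv, h3 0]
        change ((Complex.I * M.k : ℂ) • compL 2 u : L2s) x = _
        rw [h4, Pi.smul_apply, h5, smul_eq_mul]
      · filter_upwards [coe_assemble w, Lp.coeFn_neg (c 2 • a'), Lp.coeFn_smul (c 2) a']
          with x h3 h4 h5
        rw [hv, h3 1]
        change _ = -(-(c 2 • a') : L2s) x
        rw [h4, Pi.neg_apply, h5, neg_neg]
        rfl
      · filter_upwards [coe_assemble w, Lp.coeFn_smul (Complex.I * M.k) (compL 0 u), coe_compL 0 u,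
          Lp.coeFn_sub (c 1 • a') ((Complex.I * M.k : ℂ) • compL 0 u), Lp.coeFn_smul (c 1) a']
          with x h3 h4 h5 h6 h7
        rw [hv, h3 2]
        change _ = (c 1 • a' - (Complex.I * M.k : ℂ) • compL 0 u : L2s) x + _
        rw [h6, Pi.sub_apply, h7, h4, Pi.smul_apply, Pi.smul_apply, h5, smul_eq_mul, smul_eq_mul]
        ring
    have mV := (MulBound.exists_weakDeriv hV).1
    have hB : ∃ b : L2, ∀ᵐ x, ∀ i, b x i = M.Bdiag ω x i * u x i := by
      have hVm : ∀ i, MemLp (fun x => Complex.I * M.V x ω * u x i) 2 volume := fun i => by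
        refine ((EuclideanSpace.proj (𝕜 := ℂ) i : C3 →L[ℂ] ℂ).comp_memLp u).of_le_mul (c := K)
          ((mV.const_mul _).mul ((EuclideanSpace.proj (𝕜 := ℂ) i : C3 →L[ℂ] ℂ).comp_memLp u).1) ?_
        filter_upwards [hV.ae_norm_le] with x hx
        rw [norm_mul, norm_mul, Complex.norm_I, one_mul]
        exact mul_le_mul_of_nonneg_right hx (norm_nonneg _)
      refine ⟨assemble ![(hVm 0).toLp _, (hVm 1).toLp _, (Complex.I * ω) • compL 2 u], ?_⟩
      filter_upwards [coe_assemble ![(hVm 0).toLp _, (hVm 1).toLp _, (Complex.I * ω) • compL 2 u],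
        (hVm 0).coeFn_toLp, (hVm 1).coeFn_toLp, Lp.coeFn_smul (Complex.I * ω) (compL 2 u),
        coe_compL 2 u] with x h3 h4 h5 h6 h7 i
      rw [h3 i]
      fin_cases i
      · exact h4
      · exact h5
      · change ((Complex.I * ω : ℂ) • compL 2 u : L2s) x = Complex.I * ω * u x 2
        rw [h6, Pi.smul_apply, h7, smul_eq_mul]
    obtain ⟨b, hb⟩ := hB
    have hmem : (u, v - b) ∈ (M.L ω).graph := (mem_graph_L ω u _).2 ⟨v, hcurl, by
      filter_upwards [hb, Lp.coeFn_sub v b] with x h3 h4 i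
      rw [h4, Pi.sub_apply, PiLp.sub_apply, h3 i, sub_add_cancel]⟩
    have h0 := hg u (LinearPMap.mem_domain_of_mem_graph hmem)
    rw [L2.inner_def] at h0
    rw [← h0]
    refine integral_congr_ae ?_
    filter_upwards [cu, ca] with x h3 h4
    rw [PiLp.inner_apply, Finset.sum_eq_single j]
    · rw [h3 j, h4, hc]
      simp [mul_comm]
    · intro i _ hi
      rw [h3 i, hc, Pi.single_eq_of_ne hi]
      simp
    · simp
  refine L2.ext_of_ae ?_
  filter_upwards [ae_all_iff.2 key, Lp.coeFn_zero C3 2 (volume : Measure ℝ)] with x hx h0 j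
  rw [hx j, h0]
  rfl

end Medium

/-! ### Uniform bounds on the coefficients near the eigenvalue -/

namespace Medium

variable {M : Medium}

theorem MulBound.zero {K : ℝ} (hK : 0 ≤ K) : M.MulBound (fun _ => 0) K :=
  ⟨univ, by simp, fun i x _ _ => ⟨by simpa, fun y _ _ => by simpa using by positivity⟩⟩

variable (M) in
/-- Uniform bounds on the coefficients at the frequencies `ω₀ + z` with `‖z‖ < δ`. -/
structure Bounds (ω₀ : ℂ) (δ K : ℝ) : Prop where
  pos : 0 < δ
  nonneg : 0 ≤ K
  holo : ∀ᵐ x, DifferentiableOn ℂ (M.V x) (Metric.ball ω₀ δ)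
  V_mul : M.MulBound (fun x => M.V x ω₀) K
  div : ∀ z, ‖z‖ < δ → M.MulBound (M.divV ω₀ z) K
  div_sub : ∀ z z', ‖z‖ < δ → ‖z'‖ < δ →
    M.MulBound (fun x => M.divV ω₀ z x - M.divV ω₀ z' x) (K * ‖z - z'‖)
  chi : ∀ z, ‖z‖ < δ → ∃ K', M.MulBound (fun x => M.chi3 x (ω₀ + z)) K'
  chi_sub : ∀ z z', ‖z‖ < δ → ‖z'‖ < δ →
    M.MulBound (fun x => M.chi3 x (ω₀ + z) - M.chi3 x (ω₀ + z')) (K * ‖z - z'‖)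

theorem Bounds.mono {ω₀ : ℂ} {δ δ' K : ℝ} (h : M.Bounds ω₀ δ K) (h0 : 0 < δ') (hδ : δ' ≤ δ) :
    M.Bounds ω₀ δ' K where
  pos := h0
  nonneg := h.nonneg
  holo := h.holo.mono fun _ hx => hx.mono (Metric.ball_subset_ball hδ)
  V_mul := h.V_mul
  div := fun z hz => h.div z (hz.trans_le hδ)
  div_sub := fun z z' hz hz' => h.div_sub z z' (hz.trans_le hδ) (hz'.trans_le hδ)
  chi := fun z hz => h.chi z (hz.trans_le hδ)
  chi_sub := fun z z' hz hz' => h.chi_sub z z' (hz.trans_le hδ) (hz'.trans_le hδ)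

theorem exists_bounds {ω₀ : ℂ} (hV : M.RegularV ω₀) (hχ : M.LipschitzChi3 ω₀) :
    ∃ δ K, M.Bounds ω₀ δ K := by
  obtain ⟨δ, K, hδ, h1, h2, h3, h4⟩ := hV.exists_divV
  obtain ⟨δ', hδ', g1, K', hK', g2⟩ := hχ
  have hK : 0 ≤ K := h2.nonneg
  have l1 : ∀ {z : ℂ}, ‖z‖ < min δ δ' → ‖z‖ < δ := fun h => h.trans_le (min_le_left _ _)
  have l2 : ∀ {z : ℂ}, ‖z‖ < min δ δ' → ω₀ + z ∈ Metric.ball ω₀ δ' := fun h => by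
    simpa [mem_ball_iff_norm] using h.trans_le (min_le_right _ _)
  refine ⟨min δ δ', K + 2 * K', by positivity, by positivity, ?_, h2.mono (by linarith), ?_, ?_,
    ?_, ?_⟩
  · exact h1.mono fun x hx => hx.mono (Metric.ball_subset_ball (min_le_left _ _))
  · exact fun z hz => (h3 z (l1 hz)).mono (by linarith)
  · exact fun z z' hz hz' => (h4 z z' (l1 hz) (l1 hz')).mono (by gcongr; linarith)
  · exact fun z hz => exists_mulBound fun i => g1 i _ (l2 hz)
  · intro z z' hz hz'
    rcases eq_or_ne z z' with rfl | hne
    · simpa using MulBound.zero le_rfl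
    -- The factor 2 makes the inequality strict, which requires z ≠ z'.
    · refine (mulBound_of_sobolevNorm_lt (K := 2 * K' * ‖z - z'‖) fun i =>
        (g2 i _ (l2 hz) _ (l2 hz')).trans_lt ?_).mono (by gcongr; linarith)
      have : 0 < ‖z - z'‖ := norm_pos_iff.2 (sub_ne_zero.2 hne)
      rw [add_sub_add_left_eq_sub]
      exact (ENNReal.ofReal_lt_ofReal_iff (by positivity)).2 (by nlinarith [mul_pos hK' this])

/-! ### Diagonal operators on the broken Sobolev space -/

variable (M) in
/-- The difference quotient of `B(·, ω)` between `ω₀` and `ω₀ + z`. -/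
def Dop (ω₀ z : ℂ) : M.X →L[ℂ] M.X :=
  ContinuousLinearMap.pi ![Complex.I • M.mulH1 (M.divV ω₀ z) ∘L ContinuousLinearMap.proj 0,
    Complex.I • M.mulH1 (M.divV ω₀ z) ∘L ContinuousLinearMap.proj 1,
    Complex.I • ContinuousLinearMap.proj 2]

variable (M) in
/-- Multiplication of all components by a function. -/
def mulX (a : ℝ → ℂ) : M.X →L[ℂ] M.X :=
  ContinuousLinearMap.pi fun j => M.mulH1 a ∘L ContinuousLinearMap.proj j

theorem norm_mulX_sub_le {a b : ℝ → ℂ} {C : ℝ} (hC : 0 ≤ C) (h : ‖M.mulH1 a - M.mulH1 b‖ ≤ C) :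
    ‖M.mulX a - M.mulX b‖ ≤ C := by
  refine ContinuousLinearMap.opNorm_le_bound _ hC fun u => ?_
  refine (pi_norm_le_iff_of_nonneg (by positivity)).2 fun j => ?_
  have : (M.mulX a - M.mulX b) u j = (M.mulH1 a - M.mulH1 b) (u j) := rfl
  rw [this]
  exact ((M.mulH1 a - M.mulH1 b).le_of_opNorm_le h _).trans (by gcongr; exact norm_le_pi_norm u j)

theorem norm_Dop_sub_le {ω₀ z z' : ℂ} {C : ℝ} (hC : 0 ≤ C)
    (h : ‖M.mulH1 (M.divV ω₀ z) - M.mulH1 (M.divV ω₀ z')‖ ≤ C) :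
    ‖M.Dop ω₀ z - M.Dop ω₀ z'‖ ≤ C := by
  refine ContinuousLinearMap.opNorm_le_bound _ hC fun u => ?_
  refine (pi_norm_le_iff_of_nonneg (by positivity)).2 fun j => ?_
  have key : ∀ j : Fin 3, ‖Complex.I • M.mulH1 (M.divV ω₀ z) (u j) -
      Complex.I • M.mulH1 (M.divV ω₀ z') (u j)‖ ≤ C * ‖u‖ := fun j => by
    have e : Complex.I • M.mulH1 (M.divV ω₀ z) (u j) - Complex.I • M.mulH1 (M.divV ω₀ z') (u j) =
        Complex.I • (M.mulH1 (M.divV ω₀ z) - M.mulH1 (M.divV ω₀ z')) (u j) :=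
      (smul_sub Complex.I (M.mulH1 (M.divV ω₀ z) (u j)) (M.mulH1 (M.divV ω₀ z') (u j))).symm
    rw [e, norm_smul, Complex.norm_I, one_mul]
    exact (ContinuousLinearMap.le_of_opNorm_le _ h _).trans (by gcongr; exact norm_le_pi_norm u j)
  fin_cases j
  · exact key 0
  · exact key 1
  · change ‖Complex.I • u 2 - Complex.I • u 2‖ ≤ _
    rw [sub_self, norm_zero]
    positivity

theorem lipAt_of_norm_sub_le {F : Type*} [NormedAddCommGroup F] {f : ℂ → F} {δ C : ℝ} (hδ : 0 < δ)
    (hC : 0 ≤ C) (h : ∀ z z', ‖z‖ < δ → ‖z'‖ < δ → ‖f z - f z'‖ ≤ C * ‖z - z'‖) : LipAt f 0 :=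
  ⟨⟨C, hC⟩, Metric.ball 0 δ, Metric.ball_mem_nhds 0 hδ,
    LipschitzOnWith.of_dist_le_mul fun z hz z' hz' => by
      rw [dist_eq_norm, dist_eq_norm]
      exact h z z' (mem_ball_zero_iff.1 hz) (mem_ball_zero_iff.1 hz')⟩

variable {ω₀ : ℂ} {δ K : ℝ}

theorem Bounds.lipAt_Dop (h : M.Bounds ω₀ δ K) : LipAt (M.Dop ω₀) 0 := by
  have hL := lipConst_pos
  refine lipAt_of_norm_sub_le h.pos (C := (1 + lipConst) * K)
    (mul_nonneg (by linarith) h.nonneg) fun z z' hz hz' => ?_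
  have := (h.div z hz).norm_mulH1_sub_le (h.div z' hz') (h.div_sub z z' hz hz')
  rw [← mul_assoc] at this
  exact norm_Dop_sub_le (mul_nonneg (mul_nonneg (by linarith) h.nonneg) (norm_nonneg _)) this

theorem Bounds.lipAt_chi (h : M.Bounds ω₀ δ K) :
    LipAt (fun z => M.mulX (fun x => M.chi3 x (ω₀ + z))) 0 := by
  have hL := lipConst_pos
  refine lipAt_of_norm_sub_le h.pos (C := (1 + lipConst) * K)
    (mul_nonneg (by linarith) h.nonneg) fun z z' hz hz' => ?_
  obtain ⟨K₁, h₁⟩ := h.chi z hz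
  obtain ⟨K₂, h₂⟩ := h.chi z' hz'
  have := h₁.norm_mulH1_sub_le h₂ (h.chi_sub z z' hz hz')
  rw [← mul_assoc] at this
  exact norm_mulX_sub_le (mul_nonneg (mul_nonneg (by linarith) h.nonneg) (norm_nonneg _)) this

theorem Bounds.coe_J_Dop (h : M.Bounds ω₀ δ K) {z : ℂ} (hz : ‖z‖ < δ) (u : M.X) :
    ∀ᵐ x, M.J (M.Dop ω₀ z u) x = !₂[Complex.I * M.divV ω₀ z x * M.J u x 0,
      Complex.I * M.divV ω₀ z x * M.J u x 1, Complex.I * M.J u x 2] := by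
  filter_upwards [coe_J (M.Dop ω₀ z u), coe_J u, (h.div z hz).coe_mulH1 (u 0),
    (h.div z hz).coe_mulH1 (u 1), Y.coe_smul Complex.I (M.mulH1 (M.divV ω₀ z) (u 0)),
    Y.coe_smul Complex.I (M.mulH1 (M.divV ω₀ z) (u 1)), Y.coe_smul Complex.I (u 2)]
    with x a b c0 c1 d0 d1 d2
  ext j
  rw [a j]
  fin_cases j
  · change (Complex.I • M.mulH1 (M.divV ω₀ z) (u 0)).1.1 x = _
    rw [d0, c0, ← b 0, ← mul_assoc]; rfl
  · change (Complex.I • M.mulH1 (M.divV ω₀ z) (u 1)).1.1 x = _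
    rw [d1, c1, ← b 1, ← mul_assoc]; rfl
  · change (Complex.I • u 2).1.1 x = _
    rw [d2, ← b 2]; rfl

theorem Bounds.coe_J_Dop_zero (h : M.Bounds ω₀ δ K) (u : M.X) :
    ∀ᵐ x, M.J (M.Dop ω₀ 0 u) x = M.dB ω₀ x (M.J u x) := by
  filter_upwards [h.coe_J_Dop (z := 0) (by simpa using h.pos) u] with x hx
  rw [hx, divV, add_zero, dslope_same]
  rfl

/-- The identity B(ω₀ + z) = B(ω₀) + z D(z) is exact by definition of the divided difference, so the
frequency shift can be moved to the right side. -/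
theorem Bounds.mem_graph_L_add_iff (h : M.Bounds ω₀ δ K) {z : ℂ} (hz : ‖z‖ < δ) (u f : M.X) :
    (M.J u, M.J f) ∈ (M.L (ω₀ + z)).graph ↔
      (M.J u, M.J (f + z • M.Dop ω₀ z u)) ∈ (M.L ω₀).graph := by
  have key : ∀ᵐ x, ∀ j, M.J f x j + M.Bdiag (ω₀ + z) x j * M.J u x j =
      M.J (f + z • M.Dop ω₀ z u) x j + M.Bdiag ω₀ x j * M.J u x j := by
    have e : M.J (f + z • M.Dop ω₀ z u) = M.J f + z • M.J (M.Dop ω₀ z u) := by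
      rw [map_add, map_smul]
    rw [e]
    filter_upwards [h.coe_J_Dop hz u, Lp.coeFn_add (M.J f) (z • M.J (M.Dop ω₀ z u)),
      Lp.coeFn_smul z (M.J (M.Dop ω₀ z u))] with x a b c j
    have hd : z * M.divV ω₀ z x = M.V x (ω₀ + z) - M.V x ω₀ := by
      have := sub_smul_dslope (M.V x) ω₀ (ω₀ + z)
      rwa [add_sub_cancel_left, smul_eq_mul] at this
    rw [b, Pi.add_apply, PiLp.add_apply, c, Pi.smul_apply, PiLp.smul_apply, a, smul_eq_mul]
    fin_cases j
    · change M.J f x 0 + Complex.I * M.V x (ω₀ + z) * M.J u x 0 = M.J f x 0 + z * (Complex.I *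
        M.divV ω₀ z x * M.J u x 0) + Complex.I * M.V x ω₀ * M.J u x 0
      linear_combination (-Complex.I * M.J u x 0) * hd
    · change M.J f x 1 + Complex.I * M.V x (ω₀ + z) * M.J u x 1 = M.J f x 1 + z * (Complex.I *
        M.divV ω₀ z x * M.J u x 1) + Complex.I * M.V x ω₀ * M.J u x 1
      linear_combination (-Complex.I * M.J u x 1) * hd
    · change M.J f x 2 + Complex.I * (ω₀ + z) * M.J u x 2 = M.J f x 2 + z * (Complex.I *
        M.J u x 2) + Complex.I * ω₀ * M.J u x 2
      ring
  rw [mem_graph_L, mem_graph_L]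
  refine exists_congr fun v => and_congr_right fun _ => ⟨fun hv => ?_, fun hv => ?_⟩
  · filter_upwards [hv, key] with x a b j
    rw [a j, b j]
  · filter_upwards [hv, key] with x a b j
    rw [a j, b j]

/-! ### The nonlinearity on the broken Sobolev space -/

variable (M) in
/-- The expression `2 (|p|² + |q|²) s + (p² + q²) conj s`. -/
def kerr (p q s : M.Y) : M.Y :=
  M.mulY ((2 : ℝ) • (M.mulY p (M.conjY p) + M.mulY q (M.conjY q))) s +
    M.mulY (M.mulY p p + M.mulY q q) (M.conjY s)

theorem coe_kerr (p q s : M.Y) : ∀ᵐ x, (M.kerr p q s).1.1 x =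
    2 * ((‖p.1.1 x‖ ^ 2 + ‖q.1.1 x‖ ^ 2 : ℝ) : ℂ) * s.1.1 x +
      (p.1.1 x ^ 2 + q.1.1 x ^ 2) * conj (s.1.1 x) := by
  filter_upwards [Y.coe_add (M.mulY ((2 : ℝ) • (M.mulY p (M.conjY p) + M.mulY q (M.conjY q))) s)
      (M.mulY (M.mulY p p + M.mulY q q) (M.conjY s)),
    M.coe_mulY ((2 : ℝ) • (M.mulY p (M.conjY p) + M.mulY q (M.conjY q))) s,
    M.coe_mulY (M.mulY p p + M.mulY q q) (M.conjY s), M.coe_conjY s, M.coe_conjY p, M.coe_conjY q,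
    Y.coe_rsmul 2 (M.mulY p (M.conjY p) + M.mulY q (M.conjY q)),
    Y.coe_add (M.mulY p (M.conjY p)) (M.mulY q (M.conjY q)), M.coe_mulY p (M.conjY p),
    M.coe_mulY q (M.conjY q), Y.coe_add (M.mulY p p) (M.mulY q q), M.coe_mulY p p, M.coe_mulY q q]
    with x a1 a2 a3 a4 a5 a6 a7 a8 a9 b1 b2 b3 b4
  rw [kerr, a1, a2, a3, a4, a7, a8, a9, a5, b1, a6, b2, b3, b4, Complex.mul_conj', Complex.mul_conj']
  push_cast
  ring

variable (M) in
/-- The cubic map `u ↦ 2 |u_E|² u_E + (u_E · u_E) conj u_E`. -/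
def cubic (u : M.X) : M.X := ![M.kerr (u 0) (u 1) (u 0), M.kerr (u 0) (u 1) (u 1), 0]

/-- The expression is a polynomial in products and conjugates, which are bounded over ℝ. Because of
the conjugates, smoothness is claimed over ℝ only; this suffices for the Lipschitz property. -/
theorem contDiff_kerr {E : Type*} [NormedAddCommGroup E] [NormedSpace ℝ E] {p q s : E → M.Y}
    (hp : ContDiff ℝ 1 p) (hq : ContDiff ℝ 1 q) (hs : ContDiff ℝ 1 s) :
    ContDiff ℝ 1 fun e => M.kerr (p e) (q e) (s e) := by
  have hm : ∀ {f g : E → M.Y}, ContDiff ℝ 1 f → ContDiff ℝ 1 g →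
      ContDiff ℝ 1 fun e => M.mulY (f e) (g e) := fun hf hg =>
    M.mulY.isBoundedBilinearMap.contDiff.comp (hf.prodMk hg)
  have hc : ∀ {f : E → M.Y}, ContDiff ℝ 1 f → ContDiff ℝ 1 fun e => M.conjY (f e) := fun hf =>
    (ContinuousLinearMap.contDiff M.conjY).comp hf
  exact (hm (((hm hp (hc hp)).add (hm hq (hc hq))).const_smul _) hs).add
    (hm ((hm hp hp).add (hm hq hq)) (hc hs))

theorem contDiff_cubic : ContDiff ℝ 1 M.cubic := by
  refine contDiff_pi.2 fun j => ?_
  fin_cases j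
  · exact contDiff_kerr (contDiff_apply ℝ M.Y 0) (contDiff_apply ℝ M.Y 1) (contDiff_apply ℝ M.Y 0)
  · exact contDiff_kerr (contDiff_apply ℝ M.Y 0) (contDiff_apply ℝ M.Y 1) (contDiff_apply ℝ M.Y 1)
  · exact contDiff_const

theorem kerr_smul (c : ℂ) (p q s : M.Y) :
    M.kerr (c • p) (c • q) (c • s) = (((‖c‖ ^ 2 : ℝ) : ℂ) * c) • M.kerr p q s := by
  refine Y.ext_of_ae ?_
  filter_upwards [coe_kerr (c • p) (c • q) (c • s), coe_kerr p q s,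
    Y.coe_smul (((‖c‖ ^ 2 : ℝ) : ℂ) * c) (M.kerr p q s), Y.coe_smul c p, Y.coe_smul c q,
    Y.coe_smul c s] with x a b d e f g
  rw [a, d, b, e, f, g, norm_mul, norm_mul, map_mul]
  have : ((‖c‖ ^ 2 : ℝ) : ℂ) = c * conj c := by rw [Complex.mul_conj']; push_cast; rfl
  push_cast at this ⊢
  linear_combination (-((p.1.1 x) ^ 2 + (q.1.1 x) ^ 2) * c * conj (s.1.1 x)) * this

theorem cubic_smul (c : ℂ) (u : M.X) :
    M.cubic (c • u) = (((‖c‖ ^ 2 : ℝ) : ℂ) * c) • M.cubic u := by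
  funext j
  fin_cases j
  · exact kerr_smul c (u 0) (u 1) (u 0)
  · exact kerr_smul c (u 0) (u 1) (u 1)
  · exact (smul_zero (A := M.Y) (((‖c‖ ^ 2 : ℝ) : ℂ) * c)).symm

variable (M) in
/-- The nonlinearity `h(·, ω₀ + z, u)` on the broken Sobolev space. -/
def Hop (ω₀ z : ℂ) (u : M.X) : M.X :=
  (-Complex.I * (ω₀ + z) * M.eps0 * M.mu0 ^ 3) • M.mulX (fun x => M.chi3 x (ω₀ + z)) (M.cubic u)

theorem Hop_smul (ω₀ c z : ℂ) (u : M.X) :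
    M.Hop ω₀ z (c • u) = (((‖c‖ ^ 2 : ℝ) : ℂ) * c) • M.Hop ω₀ z u := by
  rw [Hop, cubic_smul, map_smul, smul_comm]; rfl

theorem Bounds.lipAt_Hop (h : M.Bounds ω₀ δ K) (u : M.X) :
    LipAt (fun q : ℂ × M.X => M.Hop ω₀ q.1 q.2) (0, u) := by
  have l1 : LipAt (fun q : ℂ × M.X => -Complex.I * (ω₀ + q.1) * M.eps0 * M.mu0 ^ 3) (0, u) :=
    LipAt.of_contDiffAt (𝕜 := ℂ) (ContDiff.contDiffAt (by fun_prop))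
  have l2 : LipAt (fun q : ℂ × M.X => M.mulX (fun x => M.chi3 x (ω₀ + q.1))) (0, u) :=
    LipAt.comp (g := fun z => M.mulX (fun x => M.chi3 x (ω₀ + z))) (f := fun q : ℂ × M.X => q.1)
      h.lipAt_chi (LipAt.fst' _)
  have l3 : LipAt (fun q : ℂ × M.X => M.cubic q.2) (0, u) :=
    LipAt.comp (g := M.cubic) (f := fun q : ℂ × M.X => q.2)
      (LipAt.of_contDiffAt (𝕜 := ℝ) contDiff_cubic.contDiffAt) (LipAt.snd' _)
  exact l1.smul (l2.clm_apply l3)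

theorem Bounds.coe_J_Hop (h : M.Bounds ω₀ δ K) {z : ℂ} (hz : ‖z‖ < δ) (u : M.X) :
    ∀ᵐ x, M.J (M.Hop ω₀ z u) x = M.h x (ω₀ + z) (M.J u x) := by
  obtain ⟨K', hK'⟩ := h.chi z hz
  set c : ℂ := -Complex.I * (ω₀ + z) * M.eps0 * M.mu0 ^ 3 with hc
  have e : M.J (M.Hop ω₀ z u) = c • M.J (M.mulX (fun x => M.chi3 x (ω₀ + z)) (M.cubic u)) := by
    rw [Hop, map_smul]
  rw [e]
  filter_upwards [Lp.coeFn_smul c (M.J (M.mulX (fun x => M.chi3 x (ω₀ + z)) (M.cubic u))),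
    coe_J (M.mulX (fun x => M.chi3 x (ω₀ + z)) (M.cubic u)), coe_J u,
    ae_all_iff.2 fun j => hK'.coe_mulH1 (M.cubic u j), coe_kerr (u 0) (u 1) (u 0),
    coe_kerr (u 0) (u 1) (u 1), Y.coe_zero (M := M)] with x a1 a2 a3 a4 a5 a6 a7
  ext j
  rw [a1, Pi.smul_apply, PiLp.smul_apply, a2 j]
  change c * (M.mulH1 _ (M.cubic u j)).1.1 x = _
  rw [a4 j]
  rw [← a3 0, ← a3 1] at a5 a6
  simp only [Medium.h, PiLp.smul_apply, smul_eq_mul, hc]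
  fin_cases j
  · change _ * (_ * (M.kerr (u 0) (u 1) (u 0)).1.1 x) = _
    rw [a5, ← mul_assoc]; rfl
  · change _ * (_ * (M.kerr (u 0) (u 1) (u 1)).1.1 x) = _
    rw [a6, ← mul_assoc]; rfl
  · change _ * (_ * (0 : M.Y).1.1 x) = _
    rw [a7, mul_zero, mul_zero]
    exact (mul_zero _).symm

end Medium

/-! ### Lyapunov–Schmidt reduction for the pencil -/

theorem pairing_eq_inner {F : ℝ → C3} {f g : L2} (h : ∀ᵐ x, F x = f x) :
    pairing F g = inner ℂ g f := by
  rw [pairing, L2.inner_def]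
  exact integral_congr_ae (h.mono fun x hx => by simp only [hx])

namespace Medium

variable {M : Medium}

/-- An operator on `L²` that maps the broken Sobolev space to itself is bounded there. -/
theorem exists_clm_of_forall_exists (S : L2 →L[ℂ] L2) (h : ∀ f : M.X, ∃ w : M.X, M.J w = S (M.J f)) :
    ∃ T : M.X →L[ℂ] M.X, ∀ f, M.J (T f) = S (M.J f) := by
  choose T hT using h
  let T' : M.X →ₗ[ℂ] M.X :=
    { toFun := T
      map_add' := fun f g => J_injective (by rw [map_add, hT, hT, hT, map_add, map_add])
      map_smul' := fun c f => J_injective (by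
        rw [RingHom.id_apply, map_smul, hT, hT, map_smul, map_smul]) }
  -- Convergence in `X` implies convergence in L², where S is continuous; injectivity of the
  -- embedding identifies the limits.
  refine ⟨⟨T', T'.continuous_of_seq_closed_graph fun u x y hu hy => ?_⟩, hT⟩
  refine J_injective ?_
  have h1 : Tendsto (fun n => M.J (T (u n))) atTop (𝓝 (M.J y)) :=
    (M.J.continuous.tendsto y).comp hy
  have h2 : Tendsto (fun n => S (M.J (u n))) atTop (𝓝 (S (M.J x))) :=
    ((S.continuous.comp M.J.continuous).tendsto x).comp hu
  simp only [hT] at h1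
  rw [tendsto_nhds_unique h1 h2]
  exact (hT x).symm

variable (M) in
/-- The data of the Lyapunov–Schmidt reduction at a simple eigenvalue. -/
structure Reduction (ω₀ : ℂ) (φ₀ φs : L2) (Φ : M.X) (K : M.X →L[ℂ] M.X) : Prop where
  J_Φ : M.J Φ = φ₀
  graph_φ₀ : (φ₀, 0) ∈ (M.L ω₀).graph
  ker : ∀ u, (u, 0) ∈ (M.L ω₀).graph → ∃ c : ℂ, u = c • φ₀
  ran : ∀ u f, (u, f) ∈ (M.L ω₀).graph → inner ℂ φs f = 0
  ran' : ∀ f, inner ℂ φs f = 0 → ∃ u, (u, f) ∈ (M.L ω₀).graph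
  inner_φ₀ : inner ℂ φs φ₀ = 1
  inner_K : ∀ f, inner ℂ φs (M.J (K f)) = 0
  graph_K : ∀ f, inner ℂ φs (M.J f) = 0 → (M.J (K f), M.J f) ∈ (M.L ω₀).graph
  eq_K : ∀ u f, (u, M.J f) ∈ (M.L ω₀).graph → inner ℂ φs u = 0 → u = M.J (K f)

theorem exists_reduction {ω₀ : ℂ} (hE : M.SimpleIsolatedEigenvalue ω₀) (hV : M.RegularV ω₀)
    {δ C : ℝ} (hb : M.Bounds ω₀ δ C) {φ₀ φs : L2} (hφ₀ : IsNullVector (M.L ω₀) φ₀)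
    (hφs : IsNullVector (M.L ω₀).adjoint φs) (hn : inner ℂ φs φ₀ = 1) :
    ∃ Φ K, M.Reduction ω₀ φ₀ φs Φ K := by
  have hd := dense_domain_L hb.V_mul
  have h0 : φ₀ ≠ 0 := by
    rintro rfl
    simp at hn
  obtain ⟨hφd, hφ⟩ := hφ₀
  have hg : (φ₀, 0) ∈ (M.L ω₀).graph := by
    rw [← hφ]
    exact LinearPMap.mem_graph (M.L ω₀) ⟨φ₀, hφd⟩
  have hker : ∀ u, (u, 0) ∈ (M.L ω₀).graph → ∃ c : ℂ, u = c • φ₀ := by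
    intro u hu
    obtain ⟨y, rfl, hy⟩ := (LinearPMap.mem_graph_iff _).1 hu
    have m1 : (⟨φ₀, hφd⟩ : (M.L ω₀).domain) ∈ LinearMap.ker (M.L ω₀).toFun := hφ
    have m2 : y ∈ LinearMap.ker (M.L ω₀).toFun := hy
    obtain ⟨c, hc⟩ := (finrank_eq_one_iff_of_nonzero' (⟨⟨φ₀, hφd⟩, m1⟩ :
      LinearMap.ker (M.L ω₀).toFun) (fun h => h0 (congrArg
        (fun t : LinearMap.ker (M.L ω₀).toFun => ((t : (M.L ω₀).domain) : L2)) h))).1 hE.1.1 ⟨y, m2⟩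
    exact ⟨c, (congrArg
      (fun t : LinearMap.ker (M.L ω₀).toFun => ((t : (M.L ω₀).domain) : L2)) hc).symm⟩
  have hsimple : ∀ u, (u, φ₀) ∉ (M.L ω₀).graph := by
    intro u hu
    obtain ⟨y, _, hy⟩ := (LinearPMap.mem_graph_iff _).1 hu
    exact hE.1.2 φ₀ ⟨hφd, hφ⟩ h0 ⟨y, hy⟩
  have hs : ∀ u f, (u, f) ∈ (M.L ω₀).graph → inner ℂ φs f = 0 := by
    intro u f hu
    obtain ⟨y, rfl, hy⟩ := (LinearPMap.mem_graph_iff _).1 hu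
    obtain ⟨hsd, hs⟩ := hφs
    have := (LinearPMap.adjoint_isFormalAdjoint (T := M.L ω₀) hd) ⟨φs, hsd⟩ y
    rw [hs, inner_zero_left] at this
    simp only at hy
    rw [← hy, this]
  obtain ⟨K, hK, hKu⟩ := exists_generalized_inverse hE.2 hd hg hker hsimple hs hn
  obtain ⟨Φ, hΦ⟩ := exists_J_eq_of_mem_graph (f := 0) hV (by rw [map_zero]; exact hg)
  -- The generalized inverse satisfies L K f = f - ⟨f, φs⟩φ₀, and the right side is in the broken
  -- Sobolev space together with f and φ₀, so regularity applies to K f.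
  have hKJ : ∀ f : M.X, ∃ w : M.X, M.J w = K (M.J f) := fun f => by
    refine exists_J_eq_of_mem_graph (f := f - inner ℂ φs (M.J f) • Φ) hV ?_
    rw [map_sub, map_smul, hΦ]
    exact (hK _).1
  obtain ⟨T, hT⟩ := exists_clm_of_forall_exists K hKJ
  have gr : ∀ f, inner ℂ φs f = 0 → (K f, f) ∈ (M.L ω₀).graph := fun f hf => by
    have := (hK f).1
    rwa [hf, zero_smul, sub_zero] at this
  exact ⟨Φ, T, hΦ, hg, hker, hs, fun f hf => ⟨K f, gr f hf⟩, hn, fun f => by rw [hT, (hK _).2],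
    fun f hf => by rw [hT]; exact gr _ hf, fun u f h1 h2 => by rw [hT]; exact hKu u _ h1 h2⟩

variable (M) in
/-- The functional `⟨·, φ₀*⟩` on the broken Sobolev space. -/
def pairX (φs : L2) : M.X →L[ℂ] ℂ := innerSL ℂ φs ∘L M.J

theorem pairX_apply (φs : L2) (u : M.X) : M.pairX φs u = inner ℂ φs (M.J u) := rfl

section

variable {ω₀ : ℂ} {φ₀ φs : L2} {Φ : M.X} {K : M.X →L[ℂ] M.X} {δ C : ℝ}

/-- Solvability forces ℓ(g) = 0. Then u - ℓ(u)φ₀ solves the same equation with right side g and zero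
pairing, and so it is K g; the converse adds the kernel element back. -/
theorem Reduction.isSolution_iff (hR : M.Reduction ω₀ φ₀ φs Φ K) (hb : M.Bounds ω₀ δ C) {z : ℂ}
    (hz : ‖z‖ < δ) (x : M.X) : M.IsSolution (ω₀ + z) (M.J x) ↔
      ReducedSolution (M.pairX φs) K Φ (M.Dop ω₀) (M.Hop ω₀) z x := by
  set g := M.Hop ω₀ z x + z • M.Dop ω₀ z x with hg
  have h1 : Solves (M.L (ω₀ + z)) (M.J x) (fun t => M.h t (ω₀ + z) (M.J x t)) ↔
      (M.J x, M.J g) ∈ (M.L ω₀).graph := by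
    rw [solves_iff ((hb.coe_J_Hop hz x).mono fun t ht => ht.symm), hb.mem_graph_L_add_iff hz]
  have hφ : ∀ c : ℂ, (c • φ₀, (0 : L2)) ∈ (M.L ω₀).graph := fun c => by
    have := (M.L ω₀).graph.smul_mem c hR.graph_φ₀
    rwa [Prod.smul_mk, smul_zero] at this
  constructor
  · rintro ⟨-, hs⟩
    have hgr := h1.1 hs
    have hℓ := hR.ran _ _ hgr
    refine ⟨hℓ, ?_⟩
    have h2 := (M.L ω₀).graph.sub_mem hgr (hφ (M.pairX φs x))
    rw [Prod.mk_sub_mk, sub_zero] at h2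
    have h3 := hR.eq_K _ _ h2 (by
      rw [inner_sub_right, inner_smul_right, hR.inner_φ₀, mul_one, pairX_apply, sub_self])
    refine J_injective ?_
    rw [map_add, map_smul, hR.J_Φ, ← h3]
    abel
  · rintro ⟨hℓ, hx⟩
    have h2 := (M.L ω₀).graph.add_mem (hφ (M.pairX φs x)) (hR.graph_K g hℓ)
    rw [Prod.mk_add_mk, zero_add, ← hR.J_Φ, ← map_smul, ← map_add, ← hx] at h2
    have h3 := h1.2 h2
    exact ⟨⟨mem_curlOp_domain_of_mem_graph_L h2, brokenNorm_J_lt_top x⟩, h3⟩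

theorem Reduction.nu_eq (hR : M.Reduction ω₀ φ₀ φs Φ K) (hb : M.Bounds ω₀ δ C) :
    M.nu ω₀ φ₀ φs =
      (reducedMap (M.pairX φs) K Φ (M.Dop ω₀) (M.Hop ω₀) 0).1 := by
  have h1 := hb.coe_J_Hop (z := 0) (by simpa using hb.pos) Φ
  have h2 := hb.coe_J_Dop_zero Φ
  rw [hR.J_Φ] at h1 h2
  rw [add_zero] at h1
  rw [nu, pairing_eq_inner (h1.mono fun t ht => ht.symm),
    pairing_eq_inner (h2.mono fun t ht => ht.symm)]
  simp only [reducedMap, Prod.fst_zero, Prod.snd_zero, add_zero]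
  rfl

/-- The number ν is exactly the one for which the right side of the corrector equation pairs to zero
with φs, so K provides its unique solution. -/
theorem Reduction.isCorrector_iff (hR : M.Reduction ω₀ φ₀ φs Φ K) (hb : M.Bounds ω₀ δ C)
    (hT : M.pairX φs (M.Dop ω₀ 0 Φ) ≠ 0) (φ : L2) : M.IsCorrector ω₀ φ₀ φs φ ↔
      φ = M.J (reducedMap (M.pairX φs) K Φ (M.Dop ω₀) (M.Hop ω₀) 0).2 := by
  have h1 := hb.coe_J_Hop (z := 0) (by simpa using hb.pos) Φ
  have h2 := hb.coe_J_Dop_zero Φ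
  rw [hR.J_Φ] at h1 h2
  rw [add_zero] at h1
  set ν := M.nu ω₀ φ₀ φs with hν
  set g : M.X := ν • M.Dop ω₀ 0 Φ + M.Hop ω₀ 0 Φ with hg
  have e2 : (reducedMap (M.pairX φs) K Φ (M.Dop ω₀) (M.Hop ω₀) 0).2 = K g := by
    rw [hg, hν, hR.nu_eq hb]
    simp only [reducedMap, Prod.fst_zero, Prod.snd_zero, add_zero]
  have e3 : M.J g = ν • M.J (M.Dop ω₀ 0 Φ) + M.J (M.Hop ω₀ 0 Φ) := by
    rw [hg, map_add, map_smul]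
  have h3 : ∀ᵐ x, M.h x ω₀ (φ₀ x) + ν • M.dB ω₀ x (φ₀ x) = M.J g x := by
    rw [e3]
    filter_upwards [h1, h2, Lp.coeFn_add (ν • M.J (M.Dop ω₀ 0 Φ)) (M.J (M.Hop ω₀ 0 Φ)),
      Lp.coeFn_smul ν (M.J (M.Dop ω₀ 0 Φ))] with x a b c d
    rw [c, Pi.add_apply, d, Pi.smul_apply, a, b, add_comm]
  have hℓ : inner ℂ φs (M.J g) = 0 := by
    rw [← pairX_apply, hg, map_add, map_smul, hν, hR.nu_eq hb]
    simp only [reducedMap, Prod.fst_zero, Prod.snd_zero, add_zero, smul_eq_mul]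
    rw [div_mul_cancel₀ _ hT, neg_add_cancel]
  rw [IsCorrector, solves_iff h3, e2]
  constructor
  · rintro ⟨-, a, b⟩
    exact hR.eq_K _ _ b a
  · rintro rfl
    have := hR.graph_K g hℓ
    exact ⟨⟨mem_curlOp_domain_of_mem_graph_L this, brokenNorm_J_lt_top _⟩, hR.inner_K g, this⟩

end

end Medium

/-! ### The PT transformation -/

theorem ae_comp_neg {p : ℝ → Prop} (h : ∀ᵐ x, p x) : ∀ᵐ x, p (-x) :=
  (Measure.measurePreserving_neg (volume : Measure ℝ)).quasiMeasurePreserving.ae h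

/-- Complex conjugation on `ℂ³`. -/
def conjC3 : C3 →L[ℝ] C3 :=
  LinearMap.toContinuousLinearMap
    { toFun := fun w => WithLp.toLp 2 fun j => conj (w j)
      map_add' := fun v w => by ext j; simp
      map_smul' := fun c w => by ext j; simp }

theorem norm_conjC3 (w : C3) : ‖conjC3 w‖ = ‖w‖ := by
  rw [EuclideanSpace.norm_eq, EuclideanSpace.norm_eq]
  congr 1
  exact Finset.sum_congr rfl fun j _ => congrArg (· ^ 2) (RCLike.norm_conj (w j))

/-- The transformation `u ↦ conj (u(-·))`. -/
def ptMap : L2 →L[ℝ] L2 :=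
  conjC3.compLpL 2 volume ∘L (Lp.compMeasurePreservingₗᵢ ℝ (E := C3) (p := 2) Neg.neg
    (Measure.measurePreserving_neg (volume : Measure ℝ))).toContinuousLinearMap

theorem coe_ptMap (u : L2) : ∀ᵐ x, ∀ j, ptMap u x j = conj (u (-x) j) := by
  have h1 := Lp.coeFn_compMeasurePreserving u (Measure.measurePreserving_neg (volume : Measure ℝ))
  have h2 := conjC3.coeFn_compLp (Lp.compMeasurePreserving Neg.neg
    (Measure.measurePreserving_neg (volume : Measure ℝ)) u)
  filter_upwards [h1, h2] with x a b j
  have e : ptMap u x = conjC3 (u (-x)) := by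
    rw [Function.comp_apply] at a
    rw [← a, ← b]; rfl
  rw [e]; rfl

theorem norm_ptMap (u : L2) : ‖ptMap u‖ = ‖u‖ := by
  rw [← Lp.norm_compMeasurePreserving u (Measure.measurePreserving_neg (volume : Measure ℝ))]
  refine le_antisymm (Lp.norm_le_norm_of_ae_le ?_) (Lp.norm_le_norm_of_ae_le ?_) <;>
  · filter_upwards [conjC3.coeFn_compLp (Lp.compMeasurePreserving Neg.neg
      (Measure.measurePreserving_neg (volume : Measure ℝ)) u)] with x b
    have e : ptMap u x = conjC3 (Lp.compMeasurePreserving Neg.neg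
      (Measure.measurePreserving_neg (volume : Measure ℝ)) u x) := b
    rw [e, norm_conjC3]

theorem ptMap_smul (c : ℂ) (u : L2) : ptMap (c • u) = conj c • ptMap u := by
  refine L2.ext_of_ae ?_
  filter_upwards [coe_ptMap (c • u), coe_ptMap u, Lp.coeFn_smul (conj c) (ptMap u),
    ae_comp_neg (Lp.coeFn_smul c u)] with x a b d e j
  rw [a j, d, e, Pi.smul_apply, Pi.smul_apply, PiLp.smul_apply, PiLp.smul_apply, b j, smul_eq_mul,
    smul_eq_mul, map_mul]

theorem isPTSymmetric_iff (u : L2) : IsPTSymmetric u ↔ ptMap u = u := by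
  constructor
  · intro h
    refine L2.ext_of_ae ?_
    filter_upwards [h, coe_ptMap u] with x a b j
    rw [b j, a j]
  · intro h
    have := coe_ptMap u
    rw [h] at this
    exact this

/-- The substitution x ↦ -x in the testing identity; the minus sign comes from differentiating the
reflected test function. -/
theorem HasWeakDerivOn.conj_comp_neg {f g f' g' : ℝ → ℂ} (h : HasWeakDerivOn f g univ)
    (hf : LocallyIntegrable f' volume) (hg : LocallyIntegrable g' volume)
    (hff : ∀ᵐ x, f' x = conj (f (-x))) (hgg : ∀ᵐ x, g' x = -conj (g (-x))) :
    HasWeakDerivOn f' g' univ := by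
  refine ⟨hf.locallyIntegrableOn _, hg.locallyIntegrableOn _, fun η h1 h2 _ => ?_⟩
  have hd : ∀ x, deriv (fun t => η (-t)) x = -deriv η (-x) := fun x => deriv_comp_neg η x
  have h3 := h.2.2 (fun t => η (-t)) (h1.comp contDiff_neg)
    (h2.comp_homeomorph (Homeomorph.neg ℝ)) (subset_univ _)
  have e1 : ∫ x, deriv η x • f' x = -conj (∫ x, deriv (fun t => η (-t)) x • f x) := by
    rw [← integral_conj, ← integral_neg, ← integral_neg_eq_self]
    refine integral_congr_ae ?_
    filter_upwards [ae_comp_neg hff] with x hx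
    rw [hx, hd, neg_neg]
    simp
  have e2 : ∫ x, η x • g' x = -conj (∫ x, η (-x) • g x) := by
    rw [← integral_conj, ← integral_neg, ← integral_neg_eq_self]
    refine integral_congr_ae ?_
    filter_upwards [ae_comp_neg hgg] with x hx
    rw [hx, neg_neg]
    simp
  rw [e1, e2, h3, map_neg]

/-- The reflection changes the sign of the derivative and the conjugation that of ik, so the curl
anticommutes with the PT transformation. -/
theorem IsCurl.ptMap {k : ℝ} {u v : L2} (h : IsCurl k u v) :
    IsCurl k (ptMap u) (-SPP.ptMap v) := by
  obtain ⟨h1, h2, h3⟩ := h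
  have hn := Lp.coeFn_neg (SPP.ptMap v)
  have hn' : ∀ᵐ x, ∀ j, (-SPP.ptMap v : L2) x j = -conj (v (-x) j) := by
    filter_upwards [hn, coe_ptMap v] with x a b j
    rw [a, Pi.neg_apply, PiLp.neg_apply, b j]
  refine ⟨?_, ?_, ?_⟩
  · filter_upwards [hn', coe_ptMap u, ae_comp_neg h1] with x a b c
    rw [a 0, b 2, c]
    simp
  · refine h2.conj_comp_neg (locallyIntegrable_comp _ 2) (locallyIntegrable_comp _ 1).neg ?_ ?_
    · exact (coe_ptMap u).mono fun x hx => hx 2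
    · filter_upwards [hn'] with x a
      rw [a 1, map_neg]
  · refine h3.conj_comp_neg (locallyIntegrable_comp _ 1) ((locallyIntegrable_comp _ 2).add
      ((locallyIntegrable_comp _ 0).smul (Complex.I * k))) ?_ ?_
    · exact (coe_ptMap u).mono fun x hx => hx 1
    · filter_upwards [hn', coe_ptMap u] with x a b
      rw [a 2, b 0]
      simp
      ring

/-! ### PT symmetry of the pencil and of the reduced map -/

namespace Medium

variable {M : Medium}

/-- For real ω conjugation also changes the sign of the factors i in B, while V is symmetric; thus
all of L anticommutes with the PT transformation. -/
theorem mem_graph_L_ptMap {ω : ℝ} (h : ∀ᵐ x, M.V x ω = conj (M.V (-x) ω)) {u f : L2}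
    (hg : (u, f) ∈ (M.L ω).graph) : (ptMap u, -ptMap f) ∈ (M.L ω).graph := by
  obtain ⟨v, hc, hv⟩ := (mem_graph_L _ _ _).1 hg
  refine (mem_graph_L _ _ _).2 ⟨_, hc.ptMap, ?_⟩
  filter_upwards [coe_ptMap u, coe_ptMap v, coe_ptMap f, Lp.coeFn_neg (ptMap v),
    Lp.coeFn_neg (ptMap f), ae_comp_neg hv, h] with x a b c d e g hV j
  rw [d, e, Pi.neg_apply, Pi.neg_apply, PiLp.neg_apply, PiLp.neg_apply, a j, b j, c j, g j]
  fin_cases j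
  · change -conj (f (-x) 0 + Complex.I * M.V (-x) ω * u (-x) 0) =
      -conj (f (-x) 0) + Complex.I * M.V x ω * conj (u (-x) 0)
    rw [hV]; simp; ring
  · change -conj (f (-x) 1 + Complex.I * M.V (-x) ω * u (-x) 1) =
      -conj (f (-x) 1) + Complex.I * M.V x ω * conj (u (-x) 1)
    rw [hV]; simp; ring
  · change -conj (f (-x) 2 + Complex.I * ω * u (-x) 2) =
      -conj (f (-x) 2) + Complex.I * ω * conj (u (-x) 2)
    simp; ring

/-- The divided differences of `V` at real frequencies inherit its symmetry. -/
theorem Bounds.divV_symm {ω₀ δ C : ℝ} (hb : M.Bounds ω₀ δ C)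
    (h : ∀ ω ∈ Ioo (ω₀ - δ) (ω₀ + δ), ∀ᵐ x : ℝ, M.V x (ω : ℂ) = conj (M.V (-x) (ω : ℂ))) {t : ℝ}
    (ht : |t| < δ) : ∀ᵐ x, M.divV ω₀ t x = conj (M.divV ω₀ t (-x)) := by
  have hδ := hb.pos
  have h0 : ∀ᵐ x : ℝ, M.V x (ω₀ : ℂ) = conj (M.V (-x) (ω₀ : ℂ)) :=
    h ω₀ ⟨by linarith, by linarith⟩
  have hne : ∀ t : ℝ, t ≠ 0 → |t| < δ → ∀ᵐ x, M.divV ω₀ t x = conj (M.divV ω₀ t (-x)) := by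
    intro t ht0 ht
    rw [abs_lt] at ht
    filter_upwards [h (ω₀ + t) ⟨by linarith, by linarith⟩, h0] with x a b
    have hz : (ω₀ : ℂ) + t ≠ ω₀ := by simpa using ht0
    push_cast at a
    rw [divV, divV, dslope_of_ne _ hz, dslope_of_ne _ hz, slope_def_field, slope_def_field, a, b,
      map_div₀, map_sub, map_sub, map_add, Complex.conj_ofReal, Complex.conj_ofReal]
  rcases eq_or_ne t 0 with rfl | ht0
  -- At t = 0 the divided difference is a derivative. It is reached as the limit along t = δ/(n +
  -- 2): the sequence is countable, so one null set serves all n.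
  · have ha : ∀ᵐ x, ∀ n : ℕ, M.divV ω₀ (δ / (n + 2) : ℝ) x =
        conj (M.divV ω₀ (δ / (n + 2) : ℝ) (-x)) := ae_all_iff.2 fun n => by
      refine hne _ (by positivity) ?_
      rw [abs_of_pos (by positivity), div_lt_iff₀ (by positivity)]
      nlinarith [(Nat.cast_nonneg n : (0 : ℝ) ≤ n)]
    have hlim : Tendsto (fun n : ℕ => (ω₀ : ℂ) + ((δ / (n + 2) : ℝ) : ℂ)) atTop (𝓝 (ω₀ : ℂ)) := by
      have h1 : Tendsto (fun n : ℕ => δ / ((n : ℝ) + 2)) atTop (𝓝 0) :=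
        tendsto_const_nhds.div_atTop
          (tendsto_atTop_add_const_right _ _ tendsto_natCast_atTop_atTop)
      have h2 := (Complex.continuous_ofReal.tendsto 0).comp h1
      simpa using h2.const_add (ω₀ : ℂ)
    filter_upwards [ha, hb.holo, ae_comp_neg hb.holo] with x a b c
    have hn : Metric.ball (ω₀ : ℂ) δ ∈ 𝓝 (ω₀ : ℂ) := Metric.ball_mem_nhds _ hδ
    have l1 := (continuousAt_dslope_same.2 (b.differentiableAt hn)).tendsto.comp hlim
    have l2 := (Complex.continuous_conj.tendsto _).comp
      ((continuousAt_dslope_same.2 (c.differentiableAt hn)).tendsto.comp hlim)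
    have e := tendsto_nhds_unique (l1.congr a) l2
    simpa [divV] using e
  · exact hne t ht0 ht

theorem Bounds.ptMap_Dop {ω₀ δ C : ℝ} (hb : M.Bounds ω₀ δ C)
    (h : ∀ ω ∈ Ioo (ω₀ - δ) (ω₀ + δ), ∀ᵐ x : ℝ, M.V x (ω : ℂ) = conj (M.V (-x) (ω : ℂ))) {t : ℝ}
    (ht : |t| < δ) {s : ℂ} {v : M.X} (hv : s • ptMap (M.J v) = M.J v) :
    s • ptMap (M.J (M.Dop ω₀ t v)) = -M.J (M.Dop ω₀ t v) := by
  have hz : ‖(t : ℂ)‖ < δ := by rwa [Complex.norm_real]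
  have hv' : ∀ᵐ x, ∀ j, M.J v x j = s * conj (M.J v (-x) j) := by
    filter_upwards [Lp.coeFn_smul s (ptMap (M.J v)), coe_ptMap (M.J v)] with x a b j
    rw [hv] at a
    rw [a, Pi.smul_apply, PiLp.smul_apply, b j, smul_eq_mul]
  refine L2.ext_of_ae ?_
  filter_upwards [Lp.coeFn_smul s (ptMap (M.J (M.Dop ω₀ t v))), coe_ptMap (M.J (M.Dop ω₀ t v)),
    Lp.coeFn_neg (M.J (M.Dop ω₀ t v)), hb.coe_J_Dop hz v, ae_comp_neg (hb.coe_J_Dop hz v), hv',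
    hb.divV_symm h ht] with x a b c d e f g j
  rw [a, Pi.smul_apply, PiLp.smul_apply, b j, c, Pi.neg_apply, PiLp.neg_apply, d, e]
  fin_cases j
  · change s * conj (Complex.I * M.divV ω₀ t (-x) * M.J v (-x) 0) =
      -(Complex.I * M.divV ω₀ t x * M.J v x 0)
    rw [f 0, g]; simp; ring
  · change s * conj (Complex.I * M.divV ω₀ t (-x) * M.J v (-x) 1) =
      -(Complex.I * M.divV ω₀ t x * M.J v x 1)
    rw [f 1, g]; simp; ring
  · change s * conj (Complex.I * M.J v (-x) 2) = -(Complex.I * M.J v x 2)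
    rw [f 2]; simp; ring

/-- The cubic expression is equivariant under conjugation and under multiplication by s with |s| =
1; the minus sign is that of the factor i in h. -/
theorem Bounds.ptMap_Hop {ω₀ δ C : ℝ} (hb : M.Bounds ω₀ δ C)
    (h : ∀ ω ∈ Ioo (ω₀ - δ) (ω₀ + δ), ∀ᵐ x : ℝ, M.chi3 x (ω : ℂ) = conj (M.chi3 (-x) (ω : ℂ)))
    {t : ℝ} (ht : |t| < δ) {s : ℂ} (hs : ‖s‖ = 1) {v : M.X} (hv : s • ptMap (M.J v) = M.J v) :
    s • ptMap (M.J (M.Hop ω₀ t v)) = -M.J (M.Hop ω₀ t v) := by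
  have hz : ‖(t : ℂ)‖ < δ := by rwa [Complex.norm_real]
  have hv' : ∀ᵐ x, ∀ j, M.J v x j = s * conj (M.J v (-x) j) := by
    filter_upwards [Lp.coeFn_smul s (ptMap (M.J v)), coe_ptMap (M.J v)] with x a b j
    rw [hv] at a
    rw [a, Pi.smul_apply, PiLp.smul_apply, b j, smul_eq_mul]
  have hs' : s * conj s = 1 := by rw [Complex.mul_conj', hs]; simp
  rw [abs_lt] at ht
  refine L2.ext_of_ae ?_
  filter_upwards [Lp.coeFn_smul s (ptMap (M.J (M.Hop ω₀ t v))), coe_ptMap (M.J (M.Hop ω₀ t v)),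
    Lp.coeFn_neg (M.J (M.Hop ω₀ t v)), hb.coe_J_Hop hz v, ae_comp_neg (hb.coe_J_Hop hz v), hv',
    h (ω₀ + t) ⟨by linarith, by linarith⟩] with x a b c d e f g j
  rw [a, Pi.smul_apply, PiLp.smul_apply, b j, c, Pi.neg_apply, PiLp.neg_apply, d, e]
  push_cast at g
  have key : ∀ p q r : ℂ, s * conj ((-Complex.I * (ω₀ + t) * M.eps0 * M.mu0 ^ 3 *
      M.chi3 (-x) (ω₀ + t)) * (2 * ((‖p‖ ^ 2 + ‖q‖ ^ 2 : ℝ) : ℂ) * r + (p ^ 2 + q ^ 2) * conj r)) =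
      -((-Complex.I * (ω₀ + t) * M.eps0 * M.mu0 ^ 3 * M.chi3 x (ω₀ + t)) *
        (2 * ((‖s * conj p‖ ^ 2 + ‖s * conj q‖ ^ 2 : ℝ) : ℂ) * (s * conj r) +
          ((s * conj p) ^ 2 + (s * conj q) ^ 2) * conj (s * conj r))) := by
    intro p q r
    rw [norm_mul, norm_mul, hs, one_mul, one_mul, RCLike.norm_conj, RCLike.norm_conj, g]
    simp only [map_mul, map_add, map_neg, map_pow, Complex.conj_conj, Complex.conj_I,
      Complex.conj_ofReal, map_ofNat]
    linear_combination (-Complex.I * (ω₀ + t) * M.eps0 * M.mu0 ^ 3 * conj (M.chi3 (-x) (ω₀ + t)) *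
      s * (conj p ^ 2 + conj q ^ 2) * r) * hs'
  fin_cases j
  · have := key (M.J v (-x) 0) (M.J v (-x) 1) (M.J v (-x) 0)
    rw [← f 0, ← f 1] at this
    exact this
  · have := key (M.J v (-x) 0) (M.J v (-x) 1) (M.J v (-x) 1)
    rw [← f 0, ← f 1] at this
    exact this
  · change s * conj (_ * (0 : ℂ)) = -(_ * (0 : ℂ))
    simp

section

variable {ω₀ : ℝ} {φ₀ φs : L2} {Φ : M.X} {K : M.X →L[ℂ] M.X} {δ C : ℝ}

/-- The PT transformation preserves the one-dimensional kernel and the norm, so it maps φ₀ to aφ₀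
with |a| = 1. A square root c of a works, because conj(c)c² = c. -/
theorem Reduction.exists_phase (hR : M.Reduction ω₀ φ₀ φs Φ K)
    (hV : ∀ᵐ x, M.V x ω₀ = conj (M.V (-x) ω₀)) (hn : ‖φ₀‖ = 1) :
    ∃ c : ℂ, ‖c‖ = 1 ∧ IsPTSymmetric (c • φ₀) := by
  have h1 := mem_graph_L_ptMap hV hR.graph_φ₀
  rw [map_zero, neg_zero] at h1
  obtain ⟨a, ha⟩ := hR.ker _ h1
  have hna : ‖a‖ = 1 := by
    have := norm_ptMap φ₀
    rwa [ha, norm_smul, hn, mul_one] at this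
  obtain ⟨c, hc⟩ := IsAlgClosed.exists_pow_nat_eq a (n := 2) two_pos
  have hnc : ‖c‖ = 1 := by
    have : ‖c‖ ^ 2 = 1 := by rw [← norm_pow, hc, hna]
    exact (pow_eq_one_iff_of_nonneg (norm_nonneg c) two_ne_zero).1 this
  refine ⟨c, hnc, (isPTSymmetric_iff _).2 ?_⟩
  have hcc : conj c * c = 1 := by rw [Complex.conj_mul', hnc]; simp
  rw [ptMap_smul, ha, smul_smul, ← hc]
  congr 1
  linear_combination c * hcc

/-- The functional `⟨·, φ₀*⟩` is symmetric. -/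
theorem Reduction.inner_ptMap (hR : M.Reduction ω₀ φ₀ φs Φ K)
    (hV : ∀ᵐ x, M.V x ω₀ = conj (M.V (-x) ω₀)) {s : ℂ} (hs : s • ptMap φ₀ = φ₀) (u : L2) :
    inner ℂ φs (s • ptMap u) = conj (inner ℂ φs u) := by
  set a : ℂ := inner ℂ φs u with ha
  -- The remainder u - ℓ(u)φ₀ is in the range of L(ω₀), which the PT transformation preserves and φs
  -- annihilates.
  obtain ⟨w, hw⟩ := hR.ran' (u - a • φ₀) (by
    rw [inner_sub_right, inner_smul_right, hR.inner_φ₀, mul_one, ha, sub_self])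
  have h1 := hR.ran _ _ ((M.L ω₀).graph.smul_mem (-s) (mem_graph_L_ptMap hV hw))
  rw [map_sub, ptMap_smul] at h1
  have e : -s • -(ptMap u - conj a • ptMap φ₀) = s • ptMap u - conj a • φ₀ := by
    rw [smul_neg, neg_smul, neg_neg, smul_sub, smul_comm s, hs]
  rw [e, inner_sub_right, inner_smul_right φs φ₀, hR.inner_φ₀, mul_one, sub_eq_zero] at h1
  exact h1

/-- This moves the phase into the transformation: the branch stays normalized by φ₀ and is invariant
under s times the PT map with s = conj(c)². -/
theorem isPTSymmetric_smul_iff {c : ℂ} (hc : ‖c‖ = 1) (u : L2) :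
    IsPTSymmetric (c • u) ↔ conj c ^ 2 • ptMap u = u := by
  have hcc : conj c * c = 1 := by rw [Complex.conj_mul', hc]; simp
  rw [isPTSymmetric_iff, ptMap_smul]
  constructor
  · intro h
    rw [pow_two, mul_smul, h, smul_smul, hcc, one_smul]
  · intro h
    nth_rewrite 2 [← h]
    rw [smul_smul]
    congr 1
    linear_combination (-conj c) * hcc

/-- The map `reducedMap` preserves the real frequencies and the PT-symmetric functions. -/
theorem Reduction.reducedMap_symm (hR : M.Reduction ω₀ φ₀ φs Φ K) (hb : M.Bounds ω₀ δ C)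
    (hPT : ∀ ω ∈ Ioo (ω₀ - δ) (ω₀ + δ), ∀ᵐ x : ℝ, M.V x (ω : ℂ) = conj (M.V (-x) (ω : ℂ)) ∧
      M.chi3 x (ω : ℂ) = conj (M.chi3 (-x) (ω : ℂ))) {s : ℂ} (hs : ‖s‖ = 1)
    (hsφ : s • ptMap φ₀ = φ₀) {q : ℂ × M.X} (hq : ‖q.1‖ < δ) (hq₁ : q.1.im = 0)
    (hq₂ : s • ptMap (M.J q.2) = M.J q.2)
    (hne : M.pairX φs (M.Dop ω₀ q.1 (Φ + q.2)) ≠ 0) :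
    (reducedMap (M.pairX φs) K Φ (M.Dop ω₀) (M.Hop ω₀) q).1.im = 0 ∧
      s • ptMap (M.J (reducedMap (M.pairX φs) K Φ (M.Dop ω₀) (M.Hop ω₀) q).2) =
        M.J (reducedMap (M.pairX φs) K Φ (M.Dop ω₀) (M.Hop ω₀) q).2 := by
  obtain ⟨z, y⟩ := q
  simp only at hq hq₁ hq₂ hne
  obtain ⟨t, rfl⟩ : ∃ t : ℝ, (t : ℂ) = z := ⟨z.re, Complex.ext rfl hq₁.symm⟩
  have ht : |t| < δ := by rwa [Complex.norm_real] at hq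
  have hδ := hb.pos
  have hV := fun ω hω => (hPT ω hω).mono fun x hx => hx.1
  have hχ := fun ω hω => (hPT ω hω).mono fun x hx => hx.2
  have hV0 := hV ω₀ ⟨by linarith, by linarith⟩
  set v := Φ + y with hv
  have hvs : s • ptMap (M.J v) = M.J v := by
    rw [hv, map_add, map_add, smul_add, hR.J_Φ, hsφ, hq₂]
  have hD := hb.ptMap_Dop hV ht hvs
  have hH := hb.ptMap_Hop hχ ht hs hvs
  set D := M.Dop ω₀ t v with hDd
  set H := M.Hop ω₀ t v with hHd
  set μ : ℂ := -M.pairX φs H / M.pairX φs D with hμ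
  have e : reducedMap (M.pairX φs) K Φ (M.Dop ω₀) (M.Hop ω₀) ((t : ℂ), y) =
    (μ, K (μ • D + H)) := rfl
  rw [e]
  have hiD := hR.inner_ptMap hV0 hsφ (M.J D)
  have hiH := hR.inner_ptMap hV0 hsφ (M.J H)
  rw [hD, inner_neg_right, ← pairX_apply] at hiD
  rw [hH, inner_neg_right, ← pairX_apply] at hiH
  -- Numerator and denominator of μ are both purely imaginary, as each equals minus its conjugate.
  have hμr : conj μ = μ := by
    rw [hμ, map_div₀, map_neg, ← hiD, ← hiH]
    ring
  have hg0 : inner ℂ φs (M.J (μ • D + H)) = 0 := by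
    rw [← pairX_apply, map_add, map_smul, smul_eq_mul, hμ, div_mul_cancel₀ _ hne, neg_add_cancel]
  refine ⟨Complex.conj_eq_iff_im.1 hμr, ?_⟩
  -- The transform of K g solves the same equation with zero pairing, since the sign from L cancels
  -- the one from g; uniqueness identifies it with K g.
  refine hR.eq_K _ _ ?_ ?_
  · have h1 := (M.L ω₀).graph.smul_mem s (mem_graph_L_ptMap hV0 (hR.graph_K _ hg0))
    have e2 : s • -ptMap (M.J (μ • D + H)) = M.J (μ • D + H) := by
      rw [map_add, map_smul, map_add, ptMap_smul, hμr, smul_neg, smul_add, smul_comm s, hD, hH]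
      rw [smul_neg, neg_add, neg_neg, neg_neg]
    rwa [Prod.smul_mk, e2] at h1
  · rw [hR.inner_ptMap hV0 hsφ, hR.inner_K, map_zero]

end

end Medium

end SPP

end

/-! ### The bifurcation theorem -/

theorem mainTheorem2 (M : SPP.Medium) (ω₀ : ℝ) (hω₀ : ω₀ ≠ 0)
    (hE : M.SimpleIsolatedEigenvalue (ω₀ : ℂ))
    (hV : M.RegularV (ω₀ : ℂ))
    (hNa : M.LipschitzChi3 (ω₀ : ℂ))
    (φ₀ φs : SPP.L2)
    (hφ₀ : SPP.IsNullVector (M.L (ω₀ : ℂ)) φ₀) (hφ₀_norm : ‖φ₀‖ = 1)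
    (hφs : SPP.IsNullVector (M.L (ω₀ : ℂ)).adjoint φs) (hφs_norm : inner ℂ φs φ₀ = 1)
    (hT : SPP.pairing (fun x => M.dB (ω₀ : ℂ) x (φ₀ x)) φs ≠ 0)
    (hPT : M.PTSymmetric ω₀) :
    ∃ φ : SPP.L2, M.IsCorrector (ω₀ : ℂ) φ₀ φs φ ∧
      (∀ φ' : SPP.L2, M.IsCorrector (ω₀ : ℂ) φ₀ φs φ' → φ' = φ) ∧
      ∃ (ε₀ r C : ℝ) (ω σ : ℝ → ℂ) (u ψ : ℝ → SPP.L2), 0 < ε₀ ∧ 0 < r ∧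
        -- the solution family and its expansion
        (∀ ε ∈ Set.Ioo 0 ε₀,
          M.IsSolution (ω ε) (u ε) ∧
          inner ℂ φs (u ε) = ((ε ^ (1 / 2 : ℝ) : ℝ) : ℂ) ∧
          ω ε = ω₀ + ε * M.nu (ω₀ : ℂ) φ₀ φs + (ε : ℂ) ^ 2 * σ ε ∧
          u ε = ((ε ^ (1 / 2 : ℝ) : ℝ) : ℂ) • φ₀ + ((ε ^ (3 / 2 : ℝ) : ℝ) : ℂ) • φ
            + ((ε ^ (5 / 2 : ℝ) : ℝ) : ℂ) • ψ ε ∧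
          M.InSpace (ψ ε) ∧ inner ℂ φs (ψ ε) = 0 ∧
          ‖σ ε‖ ≤ C ∧ M.brokenNorm (ψ ε) ≤ ENNReal.ofReal C) ∧
        -- it is a continuous curve in `ℂ × 𝓗¹`
        ContinuousOn ω (Set.Ioo 0 ε₀) ∧
        (∀ ε ∈ Set.Ioo 0 ε₀,
          Filter.Tendsto (fun t => M.brokenNorm (u t - u ε)) (nhds ε) (nhds 0)) ∧
        -- local uniqueness under the normalization
        (∀ ε ∈ Set.Ioo 0 ε₀,
          ‖ω ε - ω₀‖ < r ∧ M.brokenNorm (u ε) < ENNReal.ofReal r ∧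
          ∀ (ω' : ℂ) (u' : SPP.L2), M.IsSolution ω' u' → ‖ω' - ω₀‖ < r →
            M.brokenNorm u' < ENNReal.ofReal r →
            inner ℂ φs u' = ((ε ^ (1 / 2 : ℝ) : ℝ) : ℂ) → ω' = ω ε ∧ u' = u ε) ∧
        -- every nontrivial solution near `(ω₀, 0)` lies on the branch, up to a constant phase
        (∃ r' : ℝ, 0 < r' ∧ ∀ (ω' : ℂ) (u' : SPP.L2), M.IsSolution ω' u' → u' ≠ 0 →
          ‖ω' - ω₀‖ < r' → M.brokenNorm u' < ENNReal.ofReal r' →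
          ∃ ε ∈ Set.Ioo 0 ε₀, ∃ c : ℂ, ‖c‖ = 1 ∧ ω' = ω ε ∧ u' = c • u ε) ∧
        -- the frequencies are real
        (∀ ε ∈ Set.Ioo 0 ε₀, (ω ε).im = 0) ∧
        -- the solutions can be chosen PT-symmetric, through the phase of the eigenfunction
        (∃ c : ℂ, ‖c‖ = 1 ∧ SPP.IsPTSymmetric (c • φ₀)) ∧
        (∀ c : ℂ, ‖c‖ = 1 → SPP.IsPTSymmetric (c • φ₀) → ∀ ε ∈ Set.Ioo 0 ε₀,
          M.IsSolution (ω ε) (c • u ε) ∧ SPP.IsPTSymmetric (c • u ε)) := by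
  obtain ⟨δ₁, B, hb₁⟩ := SPP.Medium.exists_bounds hV hNa
  obtain ⟨δ₂, hδ₂, hPT⟩ := hPT
  have hδ : 0 < min δ₁ δ₂ := lt_min hb₁.pos hδ₂
  have hb := hb₁.mono hδ (min_le_left _ _)
  set δ := min δ₁ δ₂
  replace hPT : ∀ ω ∈ Set.Ioo (ω₀ - δ) (ω₀ + δ), ∀ᵐ x : ℝ,
      M.V x (ω : ℂ) = (starRingEnd ℂ) (M.V (-x) (ω : ℂ)) ∧
        M.chi3 x (ω : ℂ) = (starRingEnd ℂ) (M.chi3 (-x) (ω : ℂ)) := fun ω hω => by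
    have : δ ≤ δ₂ := min_le_right _ _
    exact hPT ω ⟨by linarith [hω.1], by linarith [hω.2]⟩
  have hV₀ := (hPT ω₀ ⟨by linarith, by linarith⟩).mono fun x hx => hx.1
  obtain ⟨Φ, K, hR⟩ := SPP.Medium.exists_reduction hE hV hb hφ₀ hφs hφs_norm
  have hDΦ : M.pairX φs (M.Dop ω₀ 0 Φ) ≠ 0 := by
    have h2 := hb.coe_J_Dop_zero Φ
    rw [hR.J_Φ] at h2
    rwa [SPP.pairing_eq_inner (h2.mono fun t ht => ht.symm)] at hT
  obtain ⟨C₁, hC₁, hJ⟩ := SPP.Medium.brokenNorm_J_le (M := M)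
  -- Uniqueness holds for ‖x‖ < r in `X`, while the statement measures in the broken norm, which is
  -- at most C₁ times larger. Demanding ‖x‖ < κ r on the branch makes its broken norm less than r.
  have hκ : 0 < 1 / (C₁ + 1) := by positivity
  obtain ⟨ε₀, r, C, ζ, y, hε₀, hr, hrδ, hC, hbr, ⟨r', hr', hr'δ, hall⟩, hinv⟩ :=
    SPP.exists_bifurcation_branch (K := K) (h := M.Hop ω₀) (SPP.Medium.Hop_smul (ω₀ : ℂ))
      (by rw [SPP.Medium.pairX_apply, hR.J_Φ, hR.inner_φ₀]) hR.inner_K hb.lipAt_Dop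
      (hb.lipAt_Hop Φ) (hb.lipAt_Hop 0) hDΦ hδ hκ
  have hν := hR.nu_eq hb
  set w := (SPP.reducedMap (M.pairX φs) K Φ (M.Dop ω₀) (M.Hop ω₀) 0).2 with hw
  set ν := M.nu (ω₀ : ℂ) φ₀ φs
  have hcor := (hR.isCorrector_iff hb hDΦ (M.J w)).2 rfl
  set x : ℝ → M.X := fun ε => ((√ε : ℝ) : ℂ) • (Φ + y ε) with hx
  have hsq : ∀ ε : ℝ, ε ^ (1 / 2 : ℝ) = √ε := fun ε => (Real.sqrt_eq_rpow ε).symm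
  have hsol : ∀ ε ∈ Set.Ioo 0 ε₀, M.IsSolution (ω₀ + ζ ε) (M.J (x ε)) := fun ε hε =>
    (hR.isSolution_iff hb ((hbr ε hε).2.2.2.2.2.1.trans_le hrδ) _).2 (hbr ε hε).1
  have hlt : ∀ {v : M.X} {R : ℝ}, M.brokenNorm (M.J v) < ENNReal.ofReal R → ‖v‖ < R := by
    intro v R hv
    obtain ⟨v', hv', hle⟩ := SPP.Medium.exists_J_eq (SPP.Medium.brokenNorm_J_lt_top v)
    rw [SPP.Medium.J_injective hv'] at hle
    exact lt_of_not_ge fun h => (hle.trans_lt hv).not_ge (ENNReal.ofReal_le_ofReal h)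
  have hback : ∀ ω' u', M.IsSolution ω' u' → ‖ω' - ω₀‖ < δ → ∃ v, M.J v = u' ∧
      SPP.ReducedSolution (M.pairX φs) K Φ (M.Dop ω₀) (M.Hop ω₀) (ω' - ω₀) v := by
    intro ω' u' hs hz
    obtain ⟨v, rfl, -⟩ := SPP.Medium.exists_J_eq hs.1.2
    exact ⟨v, rfl, (hR.isSolution_iff hb hz v).1 (by rwa [add_sub_cancel])⟩
  have hsymm : ∀ c : ℂ, ‖c‖ = 1 → SPP.IsPTSymmetric (c • φ₀) → ∀ ε ∈ Set.Ioo 0 ε₀,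
      (ζ ε).im = 0 ∧ SPP.IsPTSymmetric (c • M.J (x ε)) := by
    intro c hc hcφ ε hε
    rw [SPP.Medium.isPTSymmetric_smul_iff hc] at hcφ ⊢
    set s := (starRingEnd ℂ) c ^ 2
    have hs : ‖s‖ = 1 := by rw [norm_pow, RCLike.norm_conj, hc, one_pow]
    -- The set of pairs with real frequency and symmetric correction is closed, contains 0, and is
    -- stable under real scaling and under the reduced map; hence it contains the branch.
    obtain ⟨h1, h2⟩ := hinv {q | q.1.im = 0 ∧ s • SPP.ptMap (M.J q.2) = M.J q.2}
      ((isClosed_eq (Complex.continuous_im.comp continuous_fst) continuous_const).inter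
        (isClosed_eq (((SPP.ptMap.continuous.comp M.J.continuous).comp continuous_snd).const_smul s)
          (M.J.continuous.comp continuous_snd)))
      (by simp) (fun t q hq => ⟨by simp [hq.1], by
        rw [Prod.smul_snd, map_smul, SPP.ptMap_smul, Complex.conj_ofReal, smul_comm, hq.2]⟩)
      (fun q hq hqδ hne => hR.reducedMap_symm hb hPT hs hcφ hqδ hq.1 hq.2 hne) ε hε
    refine ⟨h1, ?_⟩
    rw [hx, map_smul, SPP.ptMap_smul, Complex.conj_ofReal, smul_comm, map_add, map_add, smul_add,
      hR.J_Φ, hcφ, h2]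
  have hcont : ∀ ε ∈ Set.Ioo 0 ε₀, ContinuousAt ζ ε ∧ ContinuousAt y ε := by
    intro ε hε
    have hev : ∀ᶠ t in nhds ε, t ∈ Set.Ioo 0 ε₀ := isOpen_Ioo.mem_nhds hε
    have hlim : Filter.Tendsto (fun t => C * |t - ε|) (nhds ε) (nhds 0) := by
      have : Continuous fun t => C * |t - ε| := by fun_prop
      simpa using this.tendsto ε
    constructor
    · refine tendsto_iff_norm_sub_tendsto_zero.2 (squeeze_zero' (.of_forall fun _ => norm_nonneg _)
        (hev.mono fun t ht => ((hbr ε hε).2.2.2.2.2.2.2.1 t ht).1) hlim)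
    · refine tendsto_iff_norm_sub_tendsto_zero.2 (squeeze_zero' (.of_forall fun _ => norm_nonneg _)
        (hev.mono fun t ht => ((hbr ε hε).2.2.2.2.2.2.2.1 t ht).2) hlim)
  -- The remainders σ and ψ are defined by the expansion, dividing the second-order errors by ε².
  -- The constant C bounds |σ| and C₁ C bounds the broken norm of ψ.
  refine ⟨M.J w, hcor, fun φ' h => (hR.isCorrector_iff hb hDΦ φ').1 h, ε₀, r, C + C₁ * C,
    fun ε => ω₀ + ζ ε, fun ε => ((ε : ℂ) ^ 2)⁻¹ * (ζ ε - ε * ν), fun ε => M.J (x ε),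
    fun ε => M.J (((ε : ℂ) ^ 2)⁻¹ • (y ε - (ε : ℂ) • w)), hε₀, hr, ?_, ?_, ?_, ?_,
    ?_, ?_, hR.exists_phase hV₀ hφ₀_norm, ?_⟩
  · intro ε hε
    obtain ⟨-, h2, -, h4, h5, -⟩ := hbr ε hε
    have hε0 : (ε : ℂ) ≠ 0 := by exact_mod_cast hε.1.ne'
    have hnε : ‖((ε : ℂ) ^ 2)⁻¹‖ = (ε ^ 2)⁻¹ := by
      rw [norm_inv, norm_pow, Complex.norm_real, Real.norm_of_nonneg hε.1.le]
    have hbd : ∀ a : ℝ, a ≤ C * ε ^ 2 → (ε ^ 2)⁻¹ * a ≤ C := fun a ha => by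
      rw [inv_mul_le_iff₀ (pow_pos hε.1 2)]
      linarith
    have e3 : ((ε ^ (3 / 2 : ℝ) : ℝ) : ℂ) = (√ε : ℂ) * ε := by
      rw [show (3 / 2 : ℝ) = 1 / 2 + 1 by norm_num, Real.rpow_add hε.1, Real.rpow_one, hsq]
      push_cast; rfl
    have e5 : ((ε ^ (5 / 2 : ℝ) : ℝ) : ℂ) = (√ε : ℂ) * (ε : ℂ) ^ 2 := by
      rw [show (5 / 2 : ℝ) = 1 / 2 + (2 : ℕ) by norm_num, Real.rpow_add hε.1, Real.rpow_natCast, hsq]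
      push_cast; rfl
    have hexp : M.J (x ε) = ((√ε : ℝ) : ℂ) • φ₀ + ((√ε : ℂ) * ε) • M.J w +
        ((√ε : ℂ) * (ε : ℂ) ^ 2) • M.J (((ε : ℂ) ^ 2)⁻¹ • (y ε - (ε : ℂ) • w)) := by
      rw [hx, ← hR.J_Φ, map_smul, map_add, map_smul, map_sub, map_smul, smul_smul,
        mul_assoc, mul_inv_cancel₀ (pow_ne_zero 2 hε0), mul_one, smul_add, smul_sub, smul_smul]
      abel
    refine ⟨hsol ε hε, ?_, ?_, ?_, ⟨?_, SPP.Medium.brokenNorm_J_lt_top _⟩, ?_, ?_, ?_⟩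
    · rw [hsq, ← SPP.Medium.pairX_apply, hx, map_smul, map_add, h2, SPP.Medium.pairX_apply, hR.J_Φ,
        hR.inner_φ₀, add_zero, smul_eq_mul, mul_one]
    · rw [mul_inv_cancel_left₀ (pow_ne_zero 2 hε0)]
      ring
    · rw [hsq, e3, e5]
      exact hexp
    -- A nonzero multiple of ψ is the difference of u and its two leading terms, all of which lie in
    -- D(A).
    · have hne : ((√ε : ℂ) * (ε : ℂ) ^ 2) ≠ 0 := by
        refine mul_ne_zero ?_ (pow_ne_zero 2 hε0)
        exact_mod_cast (Real.sqrt_pos.2 hε.1).ne'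
      refine ((SPP.curlOp M.k).domain.smul_mem_iff hne).1 ?_
      rw [← sub_eq_iff_eq_add'.2 hexp]
      exact sub_mem (hsol ε hε).1.1 (add_mem (Submodule.smul_mem _ _
        (SPP.Medium.mem_curlOp_domain_of_mem_graph_L hR.graph_φ₀))
        (Submodule.smul_mem _ _ hcor.1.1))
    · rw [← SPP.Medium.pairX_apply, map_smul, map_sub, map_smul, h2, SPP.Medium.pairX_apply,
        hcor.2.1, smul_zero, sub_zero, smul_zero]
    · rw [norm_mul, hnε]
      have := hbd _ (hν ▸ h4)
      nlinarith
    · refine (hJ _).trans (ENNReal.ofReal_le_ofReal ?_)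
      rw [norm_smul, hnε]
      have := hbd _ h5
      nlinarith
  · exact fun ε hε => (continuousAt_const.add (hcont ε hε).1).continuousWithinAt
  · intro ε hε
    have hxc : ContinuousAt x ε :=
      ((Complex.continuous_ofReal.comp Real.continuous_sqrt).continuousAt).smul
        (continuousAt_const.add (hcont ε hε).2)
    have h1 : Filter.Tendsto (fun t => ENNReal.ofReal (C₁ * ‖x t - x ε‖)) (nhds ε) (nhds 0) := by
      have h2 := (tendsto_iff_norm_sub_tendsto_zero.1 hxc).const_mul C₁
      simpa using ENNReal.tendsto_ofReal h2
    refine tendsto_of_tendsto_of_tendsto_of_le_of_le tendsto_const_nhds h1 (fun _ => zero_le) ?_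
    intro t
    simp only
    rw [← map_sub]
    exact hJ _
  · intro ε hε
    obtain ⟨-, -, -, -, -, h6, h7, -, h9⟩ := hbr ε hε
    refine ⟨by simpa using h6, (hJ _).trans_lt ((ENNReal.ofReal_lt_ofReal_iff hr).2 ?_), ?_⟩
    · have h10 : C₁ * ‖x ε‖ ≤ C₁ * (1 / (C₁ + 1) * r) := by gcongr
      have h11 : C₁ * (1 / (C₁ + 1) * r) = r - r / (C₁ + 1) := by field_simp; ring
      have h12 : 0 < r / (C₁ + 1) := by positivity
      linarith
    · intro ω' u' hs hz hu hi
      obtain ⟨v, rfl, hv⟩ := hback ω' u' hs (hz.trans_le hrδ)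
      obtain ⟨a, b⟩ := h9 _ v hv hz (hlt hu) (by rw [SPP.Medium.pairX_apply, hi, hsq])
      exact ⟨eq_add_of_sub_eq' a, by rw [b]⟩
  · refine ⟨r', hr', fun ω' u' hs hu hz hn => ?_⟩
    obtain ⟨v, rfl, hv⟩ := hback ω' u' hs (hz.trans_le hr'δ)
    obtain ⟨ε, hε, c, hc, a, b⟩ := hall _ v hv (by rintro rfl; exact hu (map_zero _)) hz (hlt hn)
    exact ⟨ε, hε, c, hc, eq_add_of_sub_eq' a, by rw [b, map_smul]⟩
  · intro ε hε
    obtain ⟨c, hc, hcφ⟩ := hR.exists_phase hV₀ hφ₀_norm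
    simp [(hsymm c hc hcφ ε hε).1]
  · intro c hc hcφ ε hε
    refine ⟨?_, (hsymm c hc hcφ ε hε).2⟩
    rw [← map_smul]
    exact (hR.isSolution_iff hb ((hbr ε hε).2.2.2.2.2.1.trans_le hrδ) _).2
      ((hbr ε hε).1.smul (SPP.Medium.Hop_smul (ω₀ : ℂ)) hc)
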